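/- Let $0<q<1$ and $\phi\in\mathbb R$. Let $U=\mathcal U_{q,\phi}(\hat u(2))$ be the complex algebra generated by $e,f$ and invertible $k,k^*$ with relations $ek=qe^{-4i\phi}ke$, $kf=qe^{-4i\phi}fk$, $k^*f=qe^{4i\phi}fk^*$, $ek^*=qe^{4i\phi}k^*e$, $kk^*=k^*k$, $ef-fe=\frac{1}{q^{-1}-q}\left(kk^*-k^{-1}(k^*)^{-1}\right)$, with $\Delta k=k\otimes k$, $\Delta k^*=k^*\otimes k^*$, $\Delta e=e\otimes k+k^{-1}\otimes e$, $\Delta f=f\otimes k^*+(k^*)^{-1}\otimes f$, $\epsilon(e)=\epsilon(f)=0$, $\epsilon(k)=\epsilon(k^*)=1$, $S(e)=-q^{-1}e^{4i\phi}e$, $S(f)=-qe^{4i\phi}f$, $S(k)=k^{-1}$, $S(k^*)=(k^*)^{-1}$, graded by the index $\delta(e)=-2$, $\delta(f)=2$, $\delta(k)=\delta(k^*)=0$. Let $A=SU_{q,\phi}(2)$ be the complex algebra generated by $\alpha,\alpha^*,\gamma,\gamma^*$ with relations $\alpha\gamma=qe^{4i\phi}\gamma\alpha$, $\alpha\gamma^*=qe^{-4i\phi}\gamma^*\alpha$,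 $\gamma\alpha^*=qe^{4i\phi}\alpha^*\gamma$, $\gamma^*\alpha^*=qe^{-4i\phi}\alpha^*\gamma^*$, $\alpha\alpha^*+q^2\gamma^*\gamma=1$, $\alpha^*\alpha+\gamma\gamma^*=1$, $\gamma\gamma^*=\gamma^*\gamma$, with $\Delta\alpha=\alpha\otimes\alpha-qe^{-4i\phi}\gamma^*\otimes\gamma$, $\Delta\gamma=\gamma\otimes\alpha+\alpha^*\otimes\gamma$, $\Delta\alpha^*=\alpha^*\otimes\alpha^*-qe^{-4i\phi}\gamma\otimes\gamma^*$, $\Delta\gamma^*=\gamma^*\otimes\alpha^*+\alpha\otimes\gamma^*$, $\epsilon(\alpha)=\epsilon(\alpha^*)=1$, $\epsilon(\gamma)=\epsilon(\gamma^*)=0$, $S(\alpha)=\alpha^*$, $S(\alpha^*)=\alpha$, $S(\gamma)=-qe^{4i\phi}\gamma$, $S(\gamma^*)=-q^{-1}e^{4i\phi}\gamma^*$, graded by $\delta(\alpha)=\delta(\alpha^*)=0$, $\delta(\gamma)=-2$, $\delta(\gamma^*)=2$. On homogeneous elements the braidings $\Psi$ of $U$ and of $A$ and the braiding $\Xi:U\otimes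 A\to A\otimes U$ are all given by $x\otimes y\mapsto e^{2i\phi\,\delta(x)\delta(y)}\,y\otimes x$. The maps $\Delta$ and $S$ are extended from the generators by $\Delta(1)=1\otimes1$, $S(1)=1$, $\Delta(xy)=(m\otimes m)(\mathrm{id}\otimes\Psi\otimes\mathrm{id})(\Delta x\otimes\Delta y)$ and $S(xy)=m\,\Psi(Sx\otimes Sy)$, where $m$ is the product, and $\epsilon$ is extended as a unital algebra homomorphism. Theorem. There is a bilinear form $\langle\cdot,\cdot\rangle:U\otimes A\to\mathbb C$ whose values on pairs of elements of $\{e,f,k,k^*,k^{-1},(k^*)^{-1}\}$ and $\{\alpha,\alpha^*,\gamma,\gamma^*\}$ are $$\begin{aligned} &\langle e,\gamma^*\rangle=-q^{-1}e^{-4i\phi}, && \langle f,\gamma\rangle=1,\\ &\langle k,\alpha\rangle=q^{-1/2}e^{2i\phi}, && \langle k,\alpha^*\rangle=q^{1/2}e^{-2i\phi},\\ &\langle k^*,\alpha\rangle=q^{-1/2}e^{-2i\phi}, && \langle k^*,\alpha^*\rangle=q^{1/2}e^{2i\phi},\\ &\langle k^{-1},\alpha\rangle=q^{1/2}e^{-2i\phi},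 && \langle k^{-1},\alpha^*\rangle=q^{-1/2}e^{2i\phi},\\ &\langle (k^*)^{-1},\alpha\rangle=q^{1/2}e^{2i\phi}, && \langle (k^*)^{-1},\alpha^*\rangle=q^{-1/2}e^{-2i\phi}, \end{aligned}$$ and $0$ on all other such pairs, and which is a braided pairing satisfying the two additional conditions below. It is the only braided pairing with these values. Here "braided pairing" means the following. $U$ and $A$ are braided Hopf algebras. $\Xi$ is bijective and compatible with the products, units, coproducts and counits of $U$ and $A$. Moreover, for all $h,g\in U$ and $a,b\in A$, $$\begin{aligned} \langle h,ab\rangle&=(\langle\cdot,\cdot\rangle\otimes\langle\cdot,\cdot\rangle)(\mathrm{id}\otimes\Xi\otimes\mathrm{id})(\Delta h\otimes a\otimes b),\\ \langle hg,a\rangle&=(\langle\cdot,\cdot\rangle\otimes\langle\cdot,\cdot\rangle)(\mathrm{id}\otimes\Xi\otimes\mathrm{id})(h\otimes g\otimes\Delta a),\\ \langle S h,a\rangle&=\langle h,S a\rangle,\qquad \langle h,1\rangle=\epsilon(h),\qquad \langle 1,a\rangle=\epsilon(a). \end{aligned}$$ The two additional conditions are $$(\mathrm{id}\otimes\langle\cdot,\cdot\rangle)(\Xi\otimes\mathrm{id})(\mathrm{id}\otimes\Psi)=\langle\cdot,\cdot\rangle\otimes\mathrm{id}\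 \text{ on }U\otimes A\otimes A,$$ $$(\langle\cdot,\cdot\rangle\otimes\mathrm{id})(\mathrm{id}\otimes\Xi)(\Psi\otimes\mathrm{id})=\mathrm{id}\otimes\langle\cdot,\cdot\rangle\ \text{ on }U\otimes U\otimes A.$$ -/

import Mathlib

open scoped TensorProduct LaurentPolynomial

set_option linter.unusedSimpArgs false
set_option linter.unnecessarySeqFocus false

namespace BraidedPairing

noncomputable section

section Diagrams

variable {K : Type*} [Field K] {X H A Y : Type*}
  [AddCommGroup X] [Module K X] [AddCommGroup H] [Module K H]
  [AddCommGroup A] [Module K A] [AddCommGroup Y] [Module K Y]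

/-- `id ⊗ Ξ ⊗ id`, applied to the two middle legs. -/
def midSwap (Ξ : H ⊗[K] A →ₗ[K] A ⊗[K] H) :
    (X ⊗[K] H) ⊗[K] (A ⊗[K] Y) →ₗ[K] (X ⊗[K] A) ⊗[K] (H ⊗[K] Y) :=
  (TensorProduct.assoc K X A (H ⊗[K] Y)).symm.toLinearMap ∘ₗ
    LinearMap.lTensor X ((TensorProduct.assoc K A H Y).toLinearMap ∘ₗ
      LinearMap.rTensor Y Ξ ∘ₗ (TensorProduct.assoc K H A Y).symm.toLinearMap) ∘ₗ
    (TensorProduct.assoc K X H (A ⊗[K] Y)).toLinearMap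

/-- `(Ξ ⊗ id) ∘ (id ⊗ Ξ) : (H ⊗ H) ⊗ A → A ⊗ (H ⊗ H)`. -/
def braidHH (Ξ : H ⊗[K] A →ₗ[K] A ⊗[K] H) :
    (H ⊗[K] H) ⊗[K] A →ₗ[K] A ⊗[K] (H ⊗[K] H) :=
  (TensorProduct.assoc K A H H).toLinearMap ∘ₗ LinearMap.rTensor H Ξ ∘ₗ
    (TensorProduct.assoc K H A H).symm.toLinearMap ∘ₗ LinearMap.lTensor H Ξ ∘ₗ
    (TensorProduct.assoc K H H A).toLinearMap

/-- `(id ⊗ Ξ) ∘ (Ξ ⊗ id) : H ⊗ (A ⊗ A) → (A ⊗ A) ⊗ H`. -/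
def braidAA (Ξ : H ⊗[K] A →ₗ[K] A ⊗[K] H) :
    H ⊗[K] (A ⊗[K] A) →ₗ[K] (A ⊗[K] A) ⊗[K] H :=
  (TensorProduct.assoc K A A H).symm.toLinearMap ∘ₗ LinearMap.lTensor A Ξ ∘ₗ
    (TensorProduct.assoc K A H A).toLinearMap ∘ₗ LinearMap.rTensor A Ξ ∘ₗ
    (TensorProduct.assoc K H A A).symm.toLinearMap

end Diagrams

section Hopf

variable {K : Type*} [Field K]

/-- The structure maps of a braided Hopf algebra on an algebra `H`: no law is imposed here. -/
structure BraidedHopfData (K H : Type*) [Field K] [Ring H] [Algebra K H] where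
  comul : H →ₗ[K] H ⊗[K] H
  counit : H →ₗ[K] K
  antipode : H →ₗ[K] H
  braid : H ⊗[K] H →ₗ[K] H ⊗[K] H

variable {H A : Type*} [Ring H] [Algebra K H] [Ring A] [Algebra K A]

/-- The product `(m ⊗ m) ∘ (id ⊗ Ψ ⊗ id)` of the braided tensor square. -/
def braidedMul (Ψ : H ⊗[K] H →ₗ[K] H ⊗[K] H) :
    H ⊗[K] H →ₗ[K] H ⊗[K] H →ₗ[K] H ⊗[K] H :=
  TensorProduct.curry
    (TensorProduct.map (LinearMap.mul' K H) (LinearMap.mul' K H) ∘ₗ midSwap Ψ)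

/-- `Ξ : H ⊗ A → A ⊗ H` is a braiding compatible with products, units, coproducts and counits,
both in `H` and in `A`. -/
structure IsCompatibleBraiding (DH : BraidedHopfData K H) (DA : BraidedHopfData K A)
    (Ξ : H ⊗[K] A →ₗ[K] A ⊗[K] H) : Prop where
  bijective : Function.Bijective Ξ
  mul_left : Ξ ∘ₗ LinearMap.rTensor A (LinearMap.mul' K H) =
    LinearMap.lTensor A (LinearMap.mul' K H) ∘ₗ braidHH Ξ
  mul_right : Ξ ∘ₗ LinearMap.lTensor H (LinearMap.mul' K A) =
    LinearMap.rTensor H (LinearMap.mul' K A) ∘ₗ braidAA Ξ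
  one_left : ∀ a : A, Ξ (1 ⊗ₜ a) = a ⊗ₜ 1
  one_right : ∀ h : H, Ξ (h ⊗ₜ 1) = 1 ⊗ₜ h
  comul_left : braidHH Ξ ∘ₗ LinearMap.rTensor A DH.comul = LinearMap.lTensor A DH.comul ∘ₗ Ξ
  comul_right : braidAA Ξ ∘ₗ LinearMap.lTensor H DA.comul = LinearMap.rTensor H DA.comul ∘ₗ Ξ
  counit_left : ∀ (h : H) (a : A),
    TensorProduct.rid K A (LinearMap.lTensor A DH.counit (Ξ (h ⊗ₜ a))) = DH.counit h • a
  counit_right : ∀ (h : H) (a : A),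
    TensorProduct.lid K H (LinearMap.rTensor H DA.counit (Ξ (h ⊗ₜ a))) = DA.counit a • h

/-- The laws of a braided Hopf algebra. -/
structure IsBraidedHopfAlgebra (D : BraidedHopfData K H) : Prop where
  braid_compatible : IsCompatibleBraiding D D D.braid
  yang_baxter :
    LinearMap.rTensor H D.braid ∘ₗ
      ((TensorProduct.assoc K H H H).symm.toLinearMap ∘ₗ LinearMap.lTensor H D.braid ∘ₗ
        (TensorProduct.assoc K H H H).toLinearMap) ∘ₗ LinearMap.rTensor H D.braid =
    ((TensorProduct.assoc K H H H).symm.toLinearMap ∘ₗ LinearMap.lTensor H D.braid ∘ₗ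
        (TensorProduct.assoc K H H H).toLinearMap) ∘ₗ LinearMap.rTensor H D.braid ∘ₗ
      ((TensorProduct.assoc K H H H).symm.toLinearMap ∘ₗ LinearMap.lTensor H D.braid ∘ₗ
        (TensorProduct.assoc K H H H).toLinearMap)
  coassoc : (TensorProduct.assoc K H H H).toLinearMap ∘ₗ LinearMap.rTensor H D.comul ∘ₗ D.comul =
    LinearMap.lTensor H D.comul ∘ₗ D.comul
  counit_comul : ∀ h, TensorProduct.lid K H (LinearMap.rTensor H D.counit (D.comul h)) = h
  comul_counit : ∀ h, TensorProduct.rid K H (LinearMap.lTensor H D.counit (D.comul h)) = h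
  comul_one : D.comul 1 = 1 ⊗ₜ 1
  comul_mul : ∀ g h, D.comul (g * h) = braidedMul D.braid (D.comul g) (D.comul h)
  counit_one : D.counit 1 = 1
  counit_mul : ∀ g h, D.counit (g * h) = D.counit g * D.counit h
  antipode_left : ∀ h,
    LinearMap.mul' K H (LinearMap.rTensor H D.antipode (D.comul h)) = algebraMap K H (D.counit h)
  antipode_right : ∀ h,
    LinearMap.mul' K H (LinearMap.lTensor H D.antipode (D.comul h)) = algebraMap K H (D.counit h)

/-- `⟨·,·⟩ ⊗ ⟨·,·⟩`. -/
def pairPair (B : H ⊗[K] A →ₗ[K] K) : (H ⊗[K] A) ⊗[K] (H ⊗[K] A) →ₗ[K] K :=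
  LinearMap.mul' K K ∘ₗ TensorProduct.map B B

/-- `B` is a braided pairing between the braided Hopf algebras `H` and `A`, with `Ξ` as the
braiding between `H` and `A`. -/
structure IsBraidedPairing (DH : BraidedHopfData K H) (DA : BraidedHopfData K A)
    (Ξ : H ⊗[K] A →ₗ[K] A ⊗[K] H) (B : H ⊗[K] A →ₗ[K] K) : Prop where
  left_hopf : IsBraidedHopfAlgebra DH
  right_hopf : IsBraidedHopfAlgebra DA
  braiding : IsCompatibleBraiding DH DA Ξ
  pair_mul : ∀ (h : H) (a b : A),
    B (h ⊗ₜ (a * b)) = pairPair B (midSwap Ξ (DH.comul h ⊗ₜ (a ⊗ₜ b)))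
  mul_pair : ∀ (h g : H) (a : A),
    B ((h * g) ⊗ₜ a) = pairPair B (midSwap Ξ ((h ⊗ₜ g) ⊗ₜ DA.comul a))
  antipode_pair : ∀ (h : H) (a : A), B (DH.antipode h ⊗ₜ a) = B (h ⊗ₜ DA.antipode a)
  pair_one : ∀ h : H, B (h ⊗ₜ 1) = DH.counit h
  one_pair : ∀ a : A, B (1 ⊗ₜ a) = DA.counit a

/-- The two additional conditions on a braided pairing that make
`h ▷ a = (id ⊗ ⟨·,·⟩)(Ξ ⊗ id)(id ⊗ Δ)(h ⊗ a)` a braided left action. -/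
structure SatisfiesActionConditions (DH : BraidedHopfData K H) (DA : BraidedHopfData K A)
    (Ξ : H ⊗[K] A →ₗ[K] A ⊗[K] H) (B : H ⊗[K] A →ₗ[K] K) : Prop where
  /-- `(id ⊗ ⟨·,·⟩)(Ξ ⊗ id)(id ⊗ Ψ) = ⟨·,·⟩ ⊗ id` on `H ⊗ A ⊗ A`. -/
  right : ∀ (h : H) (a b : A),
    TensorProduct.rid K A (LinearMap.lTensor A B (TensorProduct.assoc K A H A
      (LinearMap.rTensor A Ξ ((TensorProduct.assoc K H A A).symm
        (h ⊗ₜ DA.braid (a ⊗ₜ b)))))) = B (h ⊗ₜ a) • b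
  /-- `(⟨·,·⟩ ⊗ id)(id ⊗ Ξ)(Ψ ⊗ id) = id ⊗ ⟨·,·⟩` on `H ⊗ H ⊗ A`. -/
  left : ∀ (h g : H) (a : A),
    TensorProduct.lid K H (LinearMap.rTensor H B ((TensorProduct.assoc K H A H).symm
      (LinearMap.lTensor H Ξ (TensorProduct.assoc K H H A
        (DH.braid (h ⊗ₜ g) ⊗ₜ a))))) = B (g ⊗ₜ a) • h

end Hopf

section Grading

/-- `e^{i n φ}`. -/
def phase (φ : ℝ) (n : ℤ) : ℂ := Complex.exp (φ * Complex.I) ^ n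

variable {H A : Type*} [Ring H] [Algebra ℂ H] [Ring A] [Algebra ℂ A]

/-- An algebra map `δ : A → A[z, z⁻¹]` records a `ℤ`-grading; `x` has index `n` when
`δ x = x zⁿ`, and the coefficient of `zⁿ` in `δ x` is the index `n` part of `x`. -/
def HasIndex (δ : A →ₐ[ℂ] A[T;T⁻¹]) (n : ℤ) (x : A) : Prop :=
  δ x = AddMonoidAlgebra.single n x

/-- The linear map underlying `δ`, with values in families of homogeneous parts. -/
def parts (δ : A →ₐ[ℂ] A[T;T⁻¹]) : A →ₗ[ℂ] (ℤ →₀ A) :=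
  (AddMonoidAlgebra.coeffLinearEquiv (R := ℂ) (S := A) (M := ℤ)).toLinearMap ∘ₗ δ.toLinearMap

/-- The braiding `h ⊗ a ↦ e^{2 i φ δ(h) δ(a)} a ⊗ h` (on homogeneous elements) between two
graded algebras. -/
def gradedBraiding (φ : ℝ) (δH : H →ₐ[ℂ] H[T;T⁻¹]) (δA : A →ₐ[ℂ] A[T;T⁻¹]) :
    H ⊗[ℂ] A →ₗ[ℂ] A ⊗[ℂ] H :=
  TensorProduct.lift
    ((Finsupp.lsum ℂ fun m : ℤ => LinearMap.flip
        (Finsupp.lsum ℂ fun n : ℤ => phase φ (2 * m * n) • TensorProduct.mk ℂ A H)).compl₁₂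
      (parts δH) (parts δA))


theorem phase_ne_zero (φ : ℝ) (n : ℤ) : phase φ n ≠ 0 := zpow_ne_zero _ (Complex.exp_ne_zero _)

theorem phase_zero (φ : ℝ) : phase φ 0 = 1 := zpow_zero _

theorem phase_add (φ : ℝ) (m n : ℤ) : phase φ (m + n) = phase φ m * phase φ n :=
  zpow_add₀ (Complex.exp_ne_zero _) m n

theorem gradedBraiding_tmul (φ : ℝ) {δH : H →ₐ[ℂ] H[T;T⁻¹]} {δA : A →ₐ[ℂ] A[T;T⁻¹]}
    {m n : ℤ} {h : H} {a : A} (hh : HasIndex δH m h) (ha : HasIndex δA n a) :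
    gradedBraiding φ δH δA (h ⊗ₜ a) = phase φ (2 * m * n) • (a ⊗ₜ h) := by
  have h1 : parts δH h = Finsupp.single m h := by
    change (δH h).coeff = _
    rw [hh]; rfl
  have h2 : parts δA a = Finsupp.single n a := by
    change (δA a).coeff = _
    rw [ha]; rfl
  simp [gradedBraiding, h1, h2]

/-- The algebra endomorphism multiplying the part of index `n` by `e^{2 i φ m n}`. -/
def twist (φ : ℝ) (δ : A →ₐ[ℂ] A[T;T⁻¹]) (m : ℤ) : A →ₐ[ℂ] A :=
  (AddMonoidAlgebra.liftNCAlgHom (AlgHom.id ℂ A)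
    { toFun := fun n => algebraMap ℂ A (phase φ (2 * m * n.toAdd))
      map_one' := by simp [phase_zero]
      map_mul' := fun x y => by
        rw [← map_mul, ← phase_add]; congr 2; rw [toAdd_mul]; ring }
    (fun x y => Algebra.commute_algebraMap_right _ _)).comp δ

theorem twist_of_index (φ : ℝ) {δ : A →ₐ[ℂ] A[T;T⁻¹]} (m : ℤ) {n : ℤ} {x : A}
    (hx : HasIndex δ n x) : twist φ δ m x = phase φ (2 * m * n) • x := by
  have : twist φ δ m x = AddMonoidAlgebra.liftNC _ _ (δ x) := rfl
  rw [this, hx, AddMonoidAlgebra.liftNC_single]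
  simp [Algebra.smul_def, Algebra.commutes]

theorem gradedBraiding_of_index (φ : ℝ) {δH : H →ₐ[ℂ] H[T;T⁻¹]} (δA : A →ₐ[ℂ] A[T;T⁻¹])
    {m : ℤ} {h : H} (hh : HasIndex δH m h) (a : A) :
    gradedBraiding φ δH δA (h ⊗ₜ a) = twist φ δA m a ⊗ₜ h := by
  have h1 : parts δH h = Finsupp.single m h := by
    change (δH h).coeff = _
    rw [hh]; rfl
  have h2 : twist φ δA m a = AddMonoidAlgebra.liftNC _ _ (δA a) := rfl
  rw [h2]
  simp only [gradedBraiding, TensorProduct.lift.tmul, LinearMap.compl₁₂_apply, h1,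
    Finsupp.lsum_single, LinearMap.flip_apply]
  change (Finsupp.lsum ℂ fun n : ℤ => phase φ (2 * m * n) • TensorProduct.mk ℂ A H)
    (δA a).coeff h = _
  generalize δA a = p
  induction p using AddMonoidAlgebra.induction_linear with
  | zero => simp
  | add p r hp hr => simp only [AddMonoidAlgebra.coeff_add, map_add, LinearMap.add_apply, hp, hr,
      TensorProduct.add_tmul]
  | single n x =>
    rw [AddMonoidAlgebra.liftNC_single, AddMonoidAlgebra.coeff_single, Finsupp.lsum_single]
    simp [← Algebra.commutes, ← Algebra.smul_def, TensorProduct.smul_tmul']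

theorem hasIndex_one (δ : A →ₐ[ℂ] A[T;T⁻¹]) : HasIndex δ 0 1 := by
  rw [HasIndex, map_one]; rfl

theorem HasIndex.mul {δ : A →ₐ[ℂ] A[T;T⁻¹]} {m n : ℤ} {x y : A}
    (hx : HasIndex δ m x) (hy : HasIndex δ n y) : HasIndex δ (m + n) (x * y) := by
  unfold HasIndex at *
  rw [map_mul, hx, hy, AddMonoidAlgebra.single_mul_single]

theorem braidedMul_tmul (φ : ℝ) {δ : A →ₐ[ℂ] A[T;T⁻¹]} {m : ℤ} {b : A} (hb : HasIndex δ m b)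
    (a c d : A) : braidedMul (gradedBraiding φ δ δ) (a ⊗ₜ b) (c ⊗ₜ d) =
      (a * twist φ δ m c) ⊗ₜ (b * d) := by
  simp [braidedMul, midSwap, gradedBraiding_of_index φ δ hb]

theorem braidedMul_comp (φ : ℝ) {δ : A →ₐ[ℂ] A[T;T⁻¹]}
    (hδ : ∀ m n x, twist φ δ m (twist φ δ n x) = twist φ δ (m + n) x)
    {m n m' : ℤ} {b a' b' : A} (a : A) (hb : HasIndex δ m b)
    (ha' : HasIndex δ n a') (hb' : HasIndex δ m' b') :
    braidedMul (gradedBraiding φ δ δ) (a ⊗ₜ b) * braidedMul (gradedBraiding φ δ δ) (a' ⊗ₜ b') =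
      phase φ (2 * m * n) • braidedMul (gradedBraiding φ δ δ) ((a * a') ⊗ₜ (b * b')) := by
  apply TensorProduct.ext'
  intro c d
  rw [Module.End.mul_apply, braidedMul_tmul φ hb', braidedMul_tmul φ hb, LinearMap.smul_apply,
    braidedMul_tmul φ (hb.mul hb'), map_mul, hδ, twist_of_index φ m ha', TensorProduct.smul_tmul']
  simp [mul_assoc]

/-- `y ↦ (m ∘ Ψ)(x ⊗ y)`, the opposite braided left multiplication by `x`. -/
def braidedOpMul (Ψ : A ⊗[ℂ] A →ₗ[ℂ] A ⊗[ℂ] A) : A →ₗ[ℂ] A →ₗ[ℂ] A :=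
  TensorProduct.curry (LinearMap.mul' ℂ A ∘ₗ Ψ)

theorem braidedOpMul_apply (φ : ℝ) {δ : A →ₐ[ℂ] A[T;T⁻¹]} {m : ℤ} {b : A} (hb : HasIndex δ m b)
    (c : A) : braidedOpMul (gradedBraiding φ δ δ) b c = twist φ δ m c * b := by
  simp [braidedOpMul, gradedBraiding_of_index φ δ hb]

theorem braidedOpMul_comp (φ : ℝ) {δ : A →ₐ[ℂ] A[T;T⁻¹]}
    (hδ : ∀ m n x, twist φ δ m (twist φ δ n x) = twist φ δ (m + n) x)
    {m n : ℤ} {a b : A} (ha : HasIndex δ m a) (hb : HasIndex δ n b) :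
    braidedOpMul (gradedBraiding φ δ δ) a * braidedOpMul (gradedBraiding φ δ δ) b =
      phase φ (2 * m * n) • braidedOpMul (gradedBraiding φ δ δ) (b * a) := by
  ext c
  rw [Module.End.mul_apply, braidedOpMul_apply φ hb, braidedOpMul_apply φ ha,
    LinearMap.smul_apply, braidedOpMul_apply φ (hb.mul ha), map_mul, hδ,
    twist_of_index φ m hb, add_comm m n]
  simp [mul_assoc]

end Grading

section Auxiliary

theorem inv_rel {A : Type*} [Ring A] [Algebra ℂ A] {x k k' : A} {c : ℂ} (hc : c ≠ 0)
    (h1 : k * k' = 1) (h2 : k' * k = 1) (h : x * k = c • (k * x)) : x * k' = c⁻¹ • (k' * x) := by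
  calc x * k' = c⁻¹ • (k' * (c • (k * x)) * k') := by
        rw [mul_smul_comm, smul_mul_assoc, smul_smul, inv_mul_cancel₀ hc, one_smul,
          ← mul_assoc, h2, one_mul]
    _ = c⁻¹ • (k' * x) := by rw [← h, ← mul_assoc, mul_assoc, h1, mul_one]

theorem inv_rel' {A : Type*} [Ring A] [Algebra ℂ A] {x k k' : A} {c : ℂ} (hc : c ≠ 0)
    (h1 : k * k' = 1) (h2 : k' * k = 1) (h : k * x = c • (x * k)) : k' * x = c⁻¹ • (x * k') := by
  calc k' * x = c⁻¹ • (k' * (c • (x * k)) * k') := by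
        rw [mul_smul_comm, smul_mul_assoc, smul_smul, inv_mul_cancel₀ hc, one_smul,
          mul_assoc, mul_assoc, h1, mul_one]
    _ = c⁻¹ • (x * k') := by rw [← h, ← mul_assoc, h2, one_mul]

theorem inv_comm {A : Type*} [Ring A] [Algebra ℂ A] {k k' s s' : A}
    (h1 : k * k' = 1) (h2 : k' * k = 1) (h3 : s * s' = 1) (h4 : s' * s = 1)
    (h : k * s = s * k) : k' * s' = s' * k' := by
  have h5 := inv_rel (c := 1) one_ne_zero h3 h4 (by rw [one_smul, h])
  rw [inv_one] at h5
  simpa using inv_rel' one_ne_zero h1 h2 h5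

theorem inv_comm' {A : Type*} [Ring A] [Algebra ℂ A] {k s s' : A}
    (h3 : s * s' = 1) (h4 : s' * s = 1) (h : k * s = s * k) : k * s' = s' * k := by
  have h5 := inv_rel (c := 1) one_ne_zero h3 h4 (by rw [one_smul, h])
  simpa using h5

theorem phase_eq (φ : ℝ) (n : ℤ) : phase φ n = phase φ 1 ^ n := by
  simp [phase]

theorem braidedMul_one (φ : ℝ) {A : Type*} [Ring A] [Algebra ℂ A] (δ : A →ₐ[ℂ] A[T;T⁻¹])
    (hδ : ∀ x, twist φ δ 0 x = x) : braidedMul (gradedBraiding φ δ δ) (1 ⊗ₜ 1) = 1 := by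
  apply TensorProduct.ext'
  intro c d
  rw [braidedMul_tmul φ (hasIndex_one δ), hδ]
  simp

end Auxiliary

section EnvelopingAlgebra

/-- Generators `e, f, k, k⁻¹, k*, (k*)⁻¹`. -/
inductive UGen
  | e | f | k | kInv | kStar | kStarInv

/-- The defining relations, for a family of elements `x` of a `ℂ`-algebra; `kStar_f` and
`e_kStar` are the conjugates (with `e* = f`) of `e_k` and `k_f`. -/
inductive URel {B : Type*} [Ring B] [Algebra ℂ B] (q φ : ℝ) (x : UGen → B) : B → B → Prop
  | k_kInv : URel q φ x (x .k * x .kInv) 1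
  | kInv_k : URel q φ x (x .kInv * x .k) 1
  | kStar_kStarInv : URel q φ x (x .kStar * x .kStarInv) 1
  | kStarInv_kStar : URel q φ x (x .kStarInv * x .kStar) 1
  | e_k : URel q φ x (x .e * x .k) ((q * phase φ (-4)) • (x .k * x .e))
  | kStar_f : URel q φ x (x .kStar * x .f) ((q * phase φ 4) • (x .f * x .kStar))
  | k_f : URel q φ x (x .k * x .f) ((q * phase φ (-4)) • (x .f * x .k))
  | e_kStar : URel q φ x (x .e * x .kStar) ((q * phase φ 4) • (x .kStar * x .e))
  | k_kStar : URel q φ x (x .k * x .kStar) (x .kStar * x .k)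
  | e_f : URel q φ x (x .e * x .f - x .f * x .e)
      ((1 / ((q : ℂ)⁻¹ - q)) • (x .k * x .kStar - x .kInv * x .kStarInv))

/-- The algebra `U_{q,φ}(û(2))`. -/
def Uq (q φ : ℝ) : Type := RingQuot (URel q φ (FreeAlgebra.ι ℂ))

instance (q φ : ℝ) : Ring (Uq q φ) :=
  inferInstanceAs (Ring (RingQuot (URel q φ (FreeAlgebra.ι ℂ))))

instance (q φ : ℝ) : Algebra ℂ (Uq q φ) :=
  inferInstanceAs (Algebra ℂ (RingQuot (URel q φ (FreeAlgebra.ι ℂ))))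

/-- The quotient map from the free algebra. -/
def Uq.mk (q φ : ℝ) : FreeAlgebra ℂ UGen →ₐ[ℂ] Uq q φ :=
  RingQuot.mkAlgHom ℂ (URel q φ (FreeAlgebra.ι ℂ))

/-- The generators of `U_{q,φ}(û(2))`. -/
def Uq.gen (q φ : ℝ) (g : UGen) : Uq q φ := Uq.mk q φ (FreeAlgebra.ι ℂ g)

variable {q φ : ℝ}

theorem URel.map {B : Type*} [Ring B] [Algebra ℂ B] (x : UGen → B) {a b : FreeAlgebra ℂ UGen}
    (h : URel q φ (FreeAlgebra.ι ℂ) a b) :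
    URel q φ x (FreeAlgebra.lift ℂ x a) (FreeAlgebra.lift ℂ x b) := by
  cases h <;> simp only [map_mul, map_sub, map_smul, map_one, FreeAlgebra.lift_ι_apply] <;>
    constructor

/-- The algebra map out of `U_{q,φ}(û(2))` given on generators. -/
def Uq.lift {B : Type*} [Ring B] [Algebra ℂ B] (x : UGen → B)
    (hx : ∀ a b, URel q φ x a b → a = b) : Uq q φ →ₐ[ℂ] B :=
  RingQuot.liftAlgHom ℂ (s := URel q φ (FreeAlgebra.ι ℂ))
    ⟨FreeAlgebra.lift ℂ x, fun _ _ h => hx _ _ (h.map x)⟩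

@[simp] theorem Uq.lift_gen {B : Type*} [Ring B] [Algebra ℂ B] (x : UGen → B)
    (hx : ∀ a b, URel q φ x a b → a = b) (g : UGen) : Uq.lift x hx (Uq.gen q φ g) = x g := by
  have := RingQuot.liftAlgHom_mkAlgHom_apply ℂ (FreeAlgebra.lift ℂ x)
    (s := URel q φ (FreeAlgebra.ι ℂ)) (fun _ _ h => hx _ _ (h.map x)) (FreeAlgebra.ι ℂ g)
  rwa [FreeAlgebra.lift_ι_apply] at this

theorem Uq.hom_ext {B : Type*} [Ring B] [Algebra ℂ B] {F G : Uq q φ →ₐ[ℂ] B}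
    (h : ∀ g, F (Uq.gen q φ g) = G (Uq.gen q φ g)) : F = G := by
  have key : F.comp (Uq.mk q φ) = G.comp (Uq.mk q φ) := FreeAlgebra.hom_ext (funext h)
  ext u
  obtain ⟨a, rfl⟩ := RingQuot.mkAlgHom_surjective ℂ (URel q φ (FreeAlgebra.ι ℂ)) u
  exact DFunLike.congr_fun key a

theorem Uq.rel {a b : FreeAlgebra ℂ UGen} (h : URel q φ (FreeAlgebra.ι ℂ) a b) :
    Uq.mk q φ a = Uq.mk q φ b :=
  RingQuot.mkAlgHom_rel ℂ h

theorem Uq.gen_rel {a b : Uq q φ} (h : URel q φ (Uq.gen q φ) a b) : a = b := by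
  cases h
  · simpa [Uq.gen] using Uq.rel (q := q) (φ := φ) .k_kInv
  · simpa [Uq.gen] using Uq.rel (q := q) (φ := φ) .kInv_k
  · simpa [Uq.gen] using Uq.rel (q := q) (φ := φ) .kStar_kStarInv
  · simpa [Uq.gen] using Uq.rel (q := q) (φ := φ) .kStarInv_kStar
  · simpa [Uq.gen] using Uq.rel (q := q) (φ := φ) .e_k
  · simpa [Uq.gen] using Uq.rel (q := q) (φ := φ) .kStar_f
  · simpa [Uq.gen] using Uq.rel (q := q) (φ := φ) .k_f
  · simpa [Uq.gen] using Uq.rel (q := q) (φ := φ) .e_kStar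
  · simpa [Uq.gen] using Uq.rel (q := q) (φ := φ) .k_kStar
  · simpa [Uq.gen] using Uq.rel (q := q) (φ := φ) .e_f

/-- The index `δ` of the generators. -/
def UGen.index : UGen → ℤ
  | .e => -2
  | .f => 2
  | _ => 0

/-- The `ℤ`-grading `δ` of `U_{q,φ}(û(2))`. -/
def Uq.grading (q φ : ℝ) : Uq q φ →ₐ[ℂ] (Uq q φ)[T;T⁻¹] :=
  Uq.lift (fun g => AddMonoidAlgebra.single g.index (Uq.gen q φ g)) (by
    intro a b h
    cases h <;>
      simp only [AddMonoidAlgebra.single_mul_single, AddMonoidAlgebra.smul_single, UGen.index,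
        AddMonoidAlgebra.one_def, Int.reduceAdd, Int.reduceNeg, ← AddMonoidAlgebra.single_sub] <;>
      refine congrArg (AddMonoidAlgebra.single _) (Uq.gen_rel ?_) <;> constructor)

theorem Uq.hasIndex_gen (g : UGen) : HasIndex (Uq.grading q φ) g.index (Uq.gen q φ g) := by
  rw [HasIndex, Uq.grading, Uq.lift_gen]

theorem Uq.twist_twist (m n : ℤ) (x : Uq q φ) :
    twist φ (Uq.grading q φ) m (twist φ (Uq.grading q φ) n x) =
      twist φ (Uq.grading q φ) (m + n) x := by
  have : (twist φ (Uq.grading q φ) m).comp (twist φ (Uq.grading q φ) n) =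
      twist φ (Uq.grading q φ) (m + n) := by
    apply Uq.hom_ext
    intro g
    simp only [AlgHom.comp_apply, twist_of_index φ _ (Uq.hasIndex_gen g), map_smul, smul_smul,
      ← phase_add]
    congr 2
    ring
  exact DFunLike.congr_fun this x

/-- The braiding `Ψ` of `U_{q,φ}(û(2))`. -/
def Uq.braid (q φ : ℝ) : Uq q φ ⊗[ℂ] Uq q φ →ₗ[ℂ] Uq q φ ⊗[ℂ] Uq q φ :=
  gradedBraiding φ (Uq.grading q φ) (Uq.grading q φ)

theorem Uq.braid_gen (a b : UGen) : Uq.braid q φ (Uq.gen q φ a ⊗ₜ Uq.gen q φ b) =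
    phase φ (2 * a.index * b.index) • (Uq.gen q φ b ⊗ₜ Uq.gen q φ a) :=
  gradedBraiding_tmul φ (Uq.hasIndex_gen a) (Uq.hasIndex_gen b)

/-- The counit of `U_{q,φ}(û(2))`. -/
def Uq.counit (q φ : ℝ) : Uq q φ →ₐ[ℂ] ℂ :=
  Uq.lift (fun
    | .e => 0
    | .f => 0
    | _ => 1) (by
    intro a b h
    cases h <;> simp)

/-- The coproduct of `U_{q,φ}(û(2))` on generators. -/
def Uq.comulGen (q φ : ℝ) : UGen → Uq q φ ⊗[ℂ] Uq q φ
  | .e => gen q φ .e ⊗ₜ gen q φ .k + gen q φ .kInv ⊗ₜ gen q φ .e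
  | .f => gen q φ .f ⊗ₜ gen q φ .kStar + gen q φ .kStarInv ⊗ₜ gen q φ .f
  | g => gen q φ g ⊗ₜ gen q φ g

theorem Uq.mul_gens (a b c d : UGen) :
    braidedMul (Uq.braid q φ) (Uq.gen q φ a ⊗ₜ Uq.gen q φ b) *
      braidedMul (Uq.braid q φ) (Uq.gen q φ c ⊗ₜ Uq.gen q φ d) =
    braidedMul (Uq.braid q φ) (phase φ (2 * b.index * c.index) •
      ((Uq.gen q φ a * Uq.gen q φ c) ⊗ₜ (Uq.gen q φ b * Uq.gen q φ d))) := by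
  rw [map_smul]
  exact braidedMul_comp φ Uq.twist_twist _ (Uq.hasIndex_gen b) (Uq.hasIndex_gen c)
    (Uq.hasIndex_gen d)

theorem Uq.opMul_gens (a b : UGen) :
    braidedOpMul (Uq.braid q φ) (Uq.gen q φ a) * braidedOpMul (Uq.braid q φ) (Uq.gen q φ b) =
    braidedOpMul (Uq.braid q φ) (phase φ (2 * a.index * b.index) •
      (Uq.gen q φ b * Uq.gen q φ a)) := by
  rw [map_smul]
  exact braidedOpMul_comp φ Uq.twist_twist (Uq.hasIndex_gen a) (Uq.hasIndex_gen b)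

theorem Uq.twist_zero (x : Uq q φ) : twist φ (Uq.grading q φ) 0 x = x := by
  have : twist φ (Uq.grading q φ) 0 = AlgHom.id ℂ _ := by
    apply Uq.hom_ext
    intro g
    simp [twist_of_index φ _ (Uq.hasIndex_gen g), phase_zero]
  exact DFunLike.congr_fun this x

theorem Uq.comul_rel (hq : q ≠ 0) : ∀ a b,
    URel q φ (fun g => braidedMul (Uq.braid q φ) (Uq.comulGen q φ g)) a b → a = b := by
  have hq' : (q : ℂ) ≠ 0 := by exact_mod_cast hq
  have h1 := braidedMul_one φ (Uq.grading q φ) Uq.twist_zero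
  change braidedMul (Uq.braid q φ) (1 ⊗ₜ 1) = 1 at h1
  have ht := phase_ne_zero φ 1
  have r1 := Uq.gen_rel (q := q) (φ := φ) .k_kInv
  have r2 := Uq.gen_rel (q := q) (φ := φ) .kInv_k
  have r3 := Uq.gen_rel (q := q) (φ := φ) .kStar_kStarInv
  have r4 := Uq.gen_rel (q := q) (φ := φ) .kStarInv_kStar
  have r5 := Uq.gen_rel (q := q) (φ := φ) .e_k
  have r6 := Uq.gen_rel (q := q) (φ := φ) .kStar_f
  have r7 := Uq.gen_rel (q := q) (φ := φ) .k_f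
  have r8 := Uq.gen_rel (q := q) (φ := φ) .e_kStar
  have r9 := Uq.gen_rel (q := q) (φ := φ) .k_kStar
  have r0 := Uq.gen_rel (q := q) (φ := φ) .e_f
  rw [sub_eq_iff_eq_add] at r0
  have r10 := inv_rel (mul_ne_zero hq' (phase_ne_zero φ _)) r1 r2 r5
  have r11 := inv_rel (mul_ne_zero hq' (phase_ne_zero φ _)) r3 r4 r8
  have r12 := inv_rel' (mul_ne_zero hq' (phase_ne_zero φ _)) r1 r2 r7
  have r13 := inv_rel' (mul_ne_zero hq' (phase_ne_zero φ _)) r3 r4 r6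
  have r14 := inv_comm r1 r2 r3 r4 r9
  have r15 := inv_comm' r3 r4 r9
  have r16 := (inv_comm' r1 r2 r9.symm).symm
  generalize hBM : braidedMul (Uq.braid q φ) = BM at *
  have hmul := Uq.mul_gens (q := q) (φ := φ)
  rw [hBM] at hmul
  intro a b h
  cases h <;>
    simp only [Uq.comulGen, map_add, add_mul, mul_add, hmul] <;>
    simp only [← map_smul, ← map_add, ← map_sub, ← h1, UGen.index] <;>
    refine congrArg BM ?_
  all_goals
    clear h1 hmul hBM BM
    generalize Uq.gen q φ .e = e at *
    generalize Uq.gen q φ .f = f at *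
    generalize Uq.gen q φ .k = k at *
    generalize Uq.gen q φ .kInv = k' at *
    generalize Uq.gen q φ .kStar = s at *
    generalize Uq.gen q φ .kStarInv = s' at *
    norm_num only <;>
    simp only [r1, r2, r3, r4, r5, r6, r7, r8, r9, r10, r11, r12, r13, r14, r15, r16, r0,
      ← TensorProduct.smul_tmul', TensorProduct.tmul_smul, smul_smul, TensorProduct.sub_tmul,
      TensorProduct.tmul_sub, TensorProduct.add_tmul, TensorProduct.tmul_add, smul_sub,
      smul_add] <;>
    simp only [phase_eq φ 4, phase_eq φ 8, phase_eq φ (-4), phase_eq φ (-8), phase_eq φ 0] <;>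
    match_scalars <;> field_simp <;> ring

/-- The coproduct of `U_{q,φ}(û(2))`: the linear map with `Δ 1 = 1 ⊗ 1` and
`Δ (g x) = Δ g · Δ x` for generators `g`, where `·` is the braided product. -/
def Uq.comul (q φ : ℝ) (hq : q ≠ 0) : Uq q φ →ₗ[ℂ] Uq q φ ⊗[ℂ] Uq q φ :=
  LinearMap.applyₗ (1 ⊗ₜ 1) ∘ₗ
    (Uq.lift (B := Module.End ℂ (Uq q φ ⊗[ℂ] Uq q φ))
      (fun g => braidedMul (Uq.braid q φ) (Uq.comulGen q φ g)) (Uq.comul_rel hq)).toLinearMap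

theorem Uq.comul_gen (hq : q ≠ 0) (g : UGen) :
    Uq.comul q φ hq (Uq.gen q φ g) = Uq.comulGen q φ g := by
  have h : ∀ a b, braidedMul (Uq.braid q φ) (Uq.gen q φ a ⊗ₜ Uq.gen q φ b) (1 ⊗ₜ 1) =
      Uq.gen q φ a ⊗ₜ Uq.gen q φ b := by
    intro a b
    simp [Uq.braid, braidedMul_tmul φ (Uq.hasIndex_gen b)]
  cases g <;> simp [Uq.comul, Uq.comulGen, h]

/-- The antipode of `U_{q,φ}(û(2))` on generators. -/
def Uq.antipodeGen (q φ : ℝ) : UGen → Uq q φ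
  | .e => (-(q : ℂ)⁻¹ * phase φ 4) • gen q φ .e
  | .f => (-(q : ℂ) * phase φ 4) • gen q φ .f
  | .k => gen q φ .kInv
  | .kInv => gen q φ .k
  | .kStar => gen q φ .kStarInv
  | .kStarInv => gen q φ .kStar

theorem Uq.antipode_rel (hq : q ≠ 0) : ∀ a b,
    URel q φ (fun g => braidedOpMul (Uq.braid q φ) (Uq.antipodeGen q φ g)) a b → a = b := by
  have hq' : (q : ℂ) ≠ 0 := by exact_mod_cast hq
  have h1 : braidedOpMul (Uq.braid q φ) 1 = 1 := by
    ext c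
    simp [Uq.braid, braidedOpMul_apply φ (hasIndex_one _), Uq.twist_zero]
  have ht := phase_ne_zero φ 1
  have r1 := Uq.gen_rel (q := q) (φ := φ) .k_kInv
  have r2 := Uq.gen_rel (q := q) (φ := φ) .kInv_k
  have r3 := Uq.gen_rel (q := q) (φ := φ) .kStar_kStarInv
  have r4 := Uq.gen_rel (q := q) (φ := φ) .kStarInv_kStar
  have r5 := Uq.gen_rel (q := q) (φ := φ) .e_k
  have r6 := Uq.gen_rel (q := q) (φ := φ) .kStar_f
  have r7 := Uq.gen_rel (q := q) (φ := φ) .k_f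
  have r8 := Uq.gen_rel (q := q) (φ := φ) .e_kStar
  have r9 := Uq.gen_rel (q := q) (φ := φ) .k_kStar
  have r0 := Uq.gen_rel (q := q) (φ := φ) .e_f
  rw [sub_eq_iff_eq_add] at r0
  have r10 := inv_rel (mul_ne_zero hq' (phase_ne_zero φ _)) r1 r2 r5
  have r11 := inv_rel (mul_ne_zero hq' (phase_ne_zero φ _)) r3 r4 r8
  have r12 := inv_rel' (mul_ne_zero hq' (phase_ne_zero φ _)) r1 r2 r7
  have r13 := inv_rel' (mul_ne_zero hq' (phase_ne_zero φ _)) r3 r4 r6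
  have r14 := inv_comm r1 r2 r3 r4 r9
  have r15 := inv_comm' r3 r4 r9
  have r16 := (inv_comm' r1 r2 r9.symm).symm
  generalize hBM : braidedOpMul (Uq.braid q φ) = BM at *
  have hmul := Uq.opMul_gens (q := q) (φ := φ)
  rw [hBM] at hmul
  intro a b h
  cases h <;>
    simp only [Uq.antipodeGen, map_smul, smul_mul_assoc, mul_smul_comm, hmul] <;>
    simp only [← map_smul, ← map_add, ← map_sub, ← h1, UGen.index] <;>
    refine congrArg BM ?_
  all_goals
    clear h1 hmul hBM BM
    generalize Uq.gen q φ .e = e at *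
    generalize Uq.gen q φ .f = f at *
    generalize Uq.gen q φ .k = k at *
    generalize Uq.gen q φ .kInv = k' at *
    generalize Uq.gen q φ .kStar = s at *
    generalize Uq.gen q φ .kStarInv = s' at *
    norm_num only <;>
    simp only [r1, r2, r3, r4, r5, r6, r7, r8, r9, r10, r11, r12, r13, r14, r15, r16, r0, smul_smul,
      smul_sub, smul_add] <;>
    simp only [phase_eq φ 4, phase_eq φ 8, phase_eq φ (-4), phase_eq φ (-8), phase_eq φ 0] <;>
    match_scalars <;> field_simp <;> ring

/-- The antipode of `U_{q,φ}(û(2))`: the linear map with `S 1 = 1` and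
`S (g x) = (m ∘ Ψ) (S g ⊗ S x)` for generators `g`. -/
def Uq.antipode (q φ : ℝ) (hq : q ≠ 0) : Uq q φ →ₗ[ℂ] Uq q φ :=
  LinearMap.applyₗ 1 ∘ₗ
    (Uq.lift (B := Module.End ℂ (Uq q φ))
      (fun g => braidedOpMul (Uq.braid q φ) (Uq.antipodeGen q φ g))
      (Uq.antipode_rel hq)).toLinearMap

theorem Uq.antipode_gen (hq : q ≠ 0) (g : UGen) :
    Uq.antipode q φ hq (Uq.gen q φ g) = Uq.antipodeGen q φ g := by
  have h : ∀ a, braidedOpMul (Uq.braid q φ) (Uq.gen q φ a) 1 = Uq.gen q φ a := by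
    intro a
    simp [Uq.braid, braidedOpMul_apply φ (Uq.hasIndex_gen a)]
  cases g <;> simp [Uq.antipode, Uq.antipodeGen, h]

/-- The braided Hopf algebra structure of `U_{q,φ}(û(2))`. -/
def Uq.hopf (q φ : ℝ) (hq : q ≠ 0) : BraidedHopfData ℂ (Uq q φ) where
  comul := Uq.comul q φ hq
  counit := (Uq.counit q φ).toLinearMap
  antipode := Uq.antipode q φ hq
  braid := Uq.braid q φ

end EnvelopingAlgebra

section CoordinateAlgebra

/-- Generators `α, α*, γ, γ*`. -/
inductive SUGen
  | α | αStar | γ | γStar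

/-- The defining relations, for a family of elements `x` of a `ℂ`-algebra. -/
inductive SURel {B : Type*} [Ring B] [Algebra ℂ B] (q φ : ℝ) (x : SUGen → B) : B → B → Prop
  | α_γ : SURel q φ x (x .α * x .γ) ((q * phase φ 4) • (x .γ * x .α))
  | α_γStar : SURel q φ x (x .α * x .γStar) ((q * phase φ (-4)) • (x .γStar * x .α))
  | γ_αStar : SURel q φ x (x .γ * x .αStar) ((q * phase φ 4) • (x .αStar * x .γ))
  | γStar_αStar : SURel q φ x (x .γStar * x .αStar) ((q * phase φ (-4)) • (x .αStar * x .γStar))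
  | α_αStar : SURel q φ x (x .α * x .αStar + ((q : ℂ) ^ 2) • (x .γStar * x .γ)) 1
  | αStar_α : SURel q φ x (x .αStar * x .α + x .γ * x .γStar) 1
  | γ_γStar : SURel q φ x (x .γ * x .γStar) (x .γStar * x .γ)

/-- The algebra `SU_{q,φ}(2)`. -/
def SUq (q φ : ℝ) : Type := RingQuot (SURel q φ (FreeAlgebra.ι ℂ))

instance (q φ : ℝ) : Ring (SUq q φ) :=
  inferInstanceAs (Ring (RingQuot (SURel q φ (FreeAlgebra.ι ℂ))))

instance (q φ : ℝ) : Algebra ℂ (SUq q φ) :=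
  inferInstanceAs (Algebra ℂ (RingQuot (SURel q φ (FreeAlgebra.ι ℂ))))

/-- The quotient map from the free algebra. -/
def SUq.mk (q φ : ℝ) : FreeAlgebra ℂ SUGen →ₐ[ℂ] SUq q φ :=
  RingQuot.mkAlgHom ℂ (SURel q φ (FreeAlgebra.ι ℂ))

/-- The generators of `SU_{q,φ}(2)`. -/
def SUq.gen (q φ : ℝ) (g : SUGen) : SUq q φ := SUq.mk q φ (FreeAlgebra.ι ℂ g)

variable {q φ : ℝ}

theorem SURel.map {B : Type*} [Ring B] [Algebra ℂ B] (x : SUGen → B) {a b : FreeAlgebra ℂ SUGen}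
    (h : SURel q φ (FreeAlgebra.ι ℂ) a b) :
    SURel q φ x (FreeAlgebra.lift ℂ x a) (FreeAlgebra.lift ℂ x b) := by
  cases h <;> simp only [map_mul, map_add, map_smul, map_one, FreeAlgebra.lift_ι_apply] <;>
    constructor

/-- The algebra map out of `SU_{q,φ}(2)` given on generators. -/
def SUq.lift {B : Type*} [Ring B] [Algebra ℂ B] (x : SUGen → B)
    (hx : ∀ a b, SURel q φ x a b → a = b) : SUq q φ →ₐ[ℂ] B :=
  RingQuot.liftAlgHom ℂ (s := SURel q φ (FreeAlgebra.ι ℂ))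
    ⟨FreeAlgebra.lift ℂ x, fun _ _ h => hx _ _ (h.map x)⟩

@[simp] theorem SUq.lift_gen {B : Type*} [Ring B] [Algebra ℂ B] (x : SUGen → B)
    (hx : ∀ a b, SURel q φ x a b → a = b) (g : SUGen) : SUq.lift x hx (SUq.gen q φ g) = x g := by
  have := RingQuot.liftAlgHom_mkAlgHom_apply ℂ (FreeAlgebra.lift ℂ x)
    (s := SURel q φ (FreeAlgebra.ι ℂ)) (fun _ _ h => hx _ _ (h.map x)) (FreeAlgebra.ι ℂ g)
  rwa [FreeAlgebra.lift_ι_apply] at this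

theorem SUq.hom_ext {B : Type*} [Ring B] [Algebra ℂ B] {F G : SUq q φ →ₐ[ℂ] B}
    (h : ∀ g, F (SUq.gen q φ g) = G (SUq.gen q φ g)) : F = G := by
  have key : F.comp (SUq.mk q φ) = G.comp (SUq.mk q φ) := FreeAlgebra.hom_ext (funext h)
  ext u
  obtain ⟨a, rfl⟩ := RingQuot.mkAlgHom_surjective ℂ (SURel q φ (FreeAlgebra.ι ℂ)) u
  exact DFunLike.congr_fun key a

theorem SUq.rel {a b : FreeAlgebra ℂ SUGen} (h : SURel q φ (FreeAlgebra.ι ℂ) a b) :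
    SUq.mk q φ a = SUq.mk q φ b :=
  RingQuot.mkAlgHom_rel ℂ h

theorem SUq.gen_rel {a b : SUq q φ} (h : SURel q φ (SUq.gen q φ) a b) : a = b := by
  cases h
  · simpa [SUq.gen] using SUq.rel (q := q) (φ := φ) .α_γ
  · simpa [SUq.gen] using SUq.rel (q := q) (φ := φ) .α_γStar
  · simpa [SUq.gen] using SUq.rel (q := q) (φ := φ) .γ_αStar
  · simpa [SUq.gen] using SUq.rel (q := q) (φ := φ) .γStar_αStar
  · simpa [SUq.gen] using SUq.rel (q := q) (φ := φ) .α_αStar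
  · simpa [SUq.gen] using SUq.rel (q := q) (φ := φ) .αStar_α
  · simpa [SUq.gen] using SUq.rel (q := q) (φ := φ) .γ_γStar

/-- The index `δ` of the generators. -/
def SUGen.index : SUGen → ℤ
  | .γ => -2
  | .γStar => 2
  | _ => 0

/-- The `ℤ`-grading `δ` of `SU_{q,φ}(2)`. -/
def SUq.grading (q φ : ℝ) : SUq q φ →ₐ[ℂ] (SUq q φ)[T;T⁻¹] :=
  SUq.lift (fun g => AddMonoidAlgebra.single g.index (SUq.gen q φ g)) (by
    intro a b h
    cases h <;>
      simp only [AddMonoidAlgebra.single_mul_single, AddMonoidAlgebra.smul_single, SUGen.index,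
        AddMonoidAlgebra.one_def, Int.reduceAdd, Int.reduceNeg, ← AddMonoidAlgebra.single_add] <;>
      refine congrArg (AddMonoidAlgebra.single _) (SUq.gen_rel ?_) <;> constructor)

theorem SUq.hasIndex_gen (g : SUGen) : HasIndex (SUq.grading q φ) g.index (SUq.gen q φ g) := by
  rw [HasIndex, SUq.grading, SUq.lift_gen]

theorem SUq.twist_twist (m n : ℤ) (x : SUq q φ) :
    twist φ (SUq.grading q φ) m (twist φ (SUq.grading q φ) n x) =
      twist φ (SUq.grading q φ) (m + n) x := by
  have : (twist φ (SUq.grading q φ) m).comp (twist φ (SUq.grading q φ) n) =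
      twist φ (SUq.grading q φ) (m + n) := by
    apply SUq.hom_ext
    intro g
    simp only [AlgHom.comp_apply, twist_of_index φ _ (SUq.hasIndex_gen g), map_smul, smul_smul,
      ← phase_add]
    congr 2
    ring
  exact DFunLike.congr_fun this x

/-- The braiding `Ψ` of `SU_{q,φ}(2)`. -/
def SUq.braid (q φ : ℝ) : SUq q φ ⊗[ℂ] SUq q φ →ₗ[ℂ] SUq q φ ⊗[ℂ] SUq q φ :=
  gradedBraiding φ (SUq.grading q φ) (SUq.grading q φ)

theorem SUq.braid_gen (a b : SUGen) : SUq.braid q φ (SUq.gen q φ a ⊗ₜ SUq.gen q φ b) =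
    phase φ (2 * a.index * b.index) • (SUq.gen q φ b ⊗ₜ SUq.gen q φ a) :=
  gradedBraiding_tmul φ (SUq.hasIndex_gen a) (SUq.hasIndex_gen b)

/-- The counit of `SU_{q,φ}(2)`. -/
def SUq.counit (q φ : ℝ) : SUq q φ →ₐ[ℂ] ℂ :=
  SUq.lift (fun
    | .γ => 0
    | .γStar => 0
    | _ => 1) (by
    intro a b h
    cases h <;> simp)

/-- The coproduct of `SU_{q,φ}(2)` on generators. -/
def SUq.comulGen (q φ : ℝ) : SUGen → SUq q φ ⊗[ℂ] SUq q φ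
  | .α => gen q φ .α ⊗ₜ gen q φ .α - (q * phase φ (-4)) • (gen q φ .γStar ⊗ₜ gen q φ .γ)
  | .γ => gen q φ .γ ⊗ₜ gen q φ .α + gen q φ .αStar ⊗ₜ gen q φ .γ
  | .αStar =>
    gen q φ .αStar ⊗ₜ gen q φ .αStar - (q * phase φ (-4)) • (gen q φ .γ ⊗ₜ gen q φ .γStar)
  | .γStar => gen q φ .γStar ⊗ₜ gen q φ .αStar + gen q φ .α ⊗ₜ gen q φ .γStar

theorem SUq.mul_gens (a b c d : SUGen) :
    braidedMul (SUq.braid q φ) (SUq.gen q φ a ⊗ₜ SUq.gen q φ b) *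
      braidedMul (SUq.braid q φ) (SUq.gen q φ c ⊗ₜ SUq.gen q φ d) =
    braidedMul (SUq.braid q φ) (phase φ (2 * b.index * c.index) •
      ((SUq.gen q φ a * SUq.gen q φ c) ⊗ₜ (SUq.gen q φ b * SUq.gen q φ d))) := by
  rw [map_smul]
  exact braidedMul_comp φ SUq.twist_twist _ (SUq.hasIndex_gen b) (SUq.hasIndex_gen c)
    (SUq.hasIndex_gen d)

theorem SUq.opMul_gens (a b : SUGen) :
    braidedOpMul (SUq.braid q φ) (SUq.gen q φ a) * braidedOpMul (SUq.braid q φ) (SUq.gen q φ b) =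
    braidedOpMul (SUq.braid q φ) (phase φ (2 * a.index * b.index) •
      (SUq.gen q φ b * SUq.gen q φ a)) := by
  rw [map_smul]
  exact braidedOpMul_comp φ SUq.twist_twist (SUq.hasIndex_gen a) (SUq.hasIndex_gen b)

theorem SUq.twist_zero (x : SUq q φ) : twist φ (SUq.grading q φ) 0 x = x := by
  have : twist φ (SUq.grading q φ) 0 = AlgHom.id ℂ _ := by
    apply SUq.hom_ext
    intro g
    simp [twist_of_index φ _ (SUq.hasIndex_gen g), phase_zero]
  exact DFunLike.congr_fun this x

theorem SUq.comul_rel (hq : q ≠ 0) : ∀ a b,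
    SURel q φ (fun g => braidedMul (SUq.braid q φ) (SUq.comulGen q φ g)) a b → a = b := by
  have hq' : (q : ℂ) ≠ 0 := by exact_mod_cast hq
  have h1 := braidedMul_one φ (SUq.grading q φ) SUq.twist_zero
  change braidedMul (SUq.braid q φ) (1 ⊗ₜ 1) = 1 at h1
  have ht := phase_ne_zero φ 1
  have r1 := SUq.gen_rel (q := q) (φ := φ) .α_γ
  have r2 := SUq.gen_rel (q := q) (φ := φ) .α_γStar
  have r3 := SUq.gen_rel (q := q) (φ := φ) .γ_αStar
  have r4 := SUq.gen_rel (q := q) (φ := φ) .γStar_αStar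
  have r5 := SUq.gen_rel (q := q) (φ := φ) .α_αStar
  have r6 := SUq.gen_rel (q := q) (φ := φ) .αStar_α
  have r7 := SUq.gen_rel (q := q) (φ := φ) .γ_γStar
  rw [← eq_sub_iff_add_eq] at r5 r6
  have hQ : ∀ n, (q : ℂ) * phase φ n ≠ 0 := fun n => mul_ne_zero hq' (phase_ne_zero φ n)
  replace r3 := ((inv_smul_eq_iff₀ (hQ _)).2 r3).symm
  replace r4 := ((inv_smul_eq_iff₀ (hQ _)).2 r4).symm
  generalize hBM : braidedMul (SUq.braid q φ) = BM at *
  have hmul := SUq.mul_gens (q := q) (φ := φ)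
  rw [hBM] at hmul
  intro a b h
  cases h <;>
    simp only [SUq.comulGen, map_add, map_sub, map_smul, add_mul, mul_add, sub_mul, mul_sub,
      smul_mul_assoc, mul_smul_comm, smul_smul, smul_sub, hmul] <;>
    simp only [← map_smul, ← map_add, ← map_sub, ← h1, SUGen.index] <;>
    refine congrArg BM ?_
  all_goals
    clear h1 hmul hBM BM
    generalize SUq.gen q φ .α = a at *
    generalize SUq.gen q φ .αStar = a' at *
    generalize SUq.gen q φ .γ = c at *
    generalize SUq.gen q φ .γStar = c' at *
    norm_num only <;>
    simp only [r1, r2, r3, r4, r5, r6, r7,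
      ← TensorProduct.smul_tmul', TensorProduct.tmul_smul, smul_smul, TensorProduct.sub_tmul,
      TensorProduct.tmul_sub, TensorProduct.add_tmul, TensorProduct.tmul_add, smul_sub,
      smul_add] <;>
    simp only [phase_eq φ 4, phase_eq φ 8, phase_eq φ (-4), phase_eq φ (-8), phase_eq φ 0] <;>
    match_scalars <;> field_simp <;> ring

/-- The coproduct of `SU_{q,φ}(2)`: the linear map with `Δ 1 = 1 ⊗ 1` and
`Δ (g x) = Δ g · Δ x` for generators `g`, where `·` is the braided product. -/
def SUq.comul (q φ : ℝ) (hq : q ≠ 0) : SUq q φ →ₗ[ℂ] SUq q φ ⊗[ℂ] SUq q φ :=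
  LinearMap.applyₗ (1 ⊗ₜ 1) ∘ₗ
    (SUq.lift (B := Module.End ℂ (SUq q φ ⊗[ℂ] SUq q φ))
      (fun g => braidedMul (SUq.braid q φ) (SUq.comulGen q φ g)) (SUq.comul_rel hq)).toLinearMap

theorem SUq.comul_gen (hq : q ≠ 0) (g : SUGen) :
    SUq.comul q φ hq (SUq.gen q φ g) = SUq.comulGen q φ g := by
  have h : ∀ a b, braidedMul (SUq.braid q φ) (SUq.gen q φ a ⊗ₜ SUq.gen q φ b) (1 ⊗ₜ 1) =
      SUq.gen q φ a ⊗ₜ SUq.gen q φ b := by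
    intro a b
    simp [SUq.braid, braidedMul_tmul φ (SUq.hasIndex_gen b)]
  cases g <;> simp [SUq.comul, SUq.comulGen, h]

/-- The antipode of `SU_{q,φ}(2)` on generators. -/
def SUq.antipodeGen (q φ : ℝ) : SUGen → SUq q φ
  | .α => gen q φ .αStar
  | .αStar => gen q φ .α
  | .γ => (-(q : ℂ) * phase φ 4) • gen q φ .γ
  | .γStar => (-(q : ℂ)⁻¹ * phase φ 4) • gen q φ .γStar

theorem SUq.antipode_rel (hq : q ≠ 0) : ∀ a b,
    SURel q φ (fun g => braidedOpMul (SUq.braid q φ) (SUq.antipodeGen q φ g)) a b → a = b := by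
  have hq' : (q : ℂ) ≠ 0 := by exact_mod_cast hq
  have h1 : braidedOpMul (SUq.braid q φ) 1 = 1 := by
    ext c
    simp [SUq.braid, braidedOpMul_apply φ (hasIndex_one _), SUq.twist_zero]
  have ht := phase_ne_zero φ 1
  have r1 := SUq.gen_rel (q := q) (φ := φ) .α_γ
  have r2 := SUq.gen_rel (q := q) (φ := φ) .α_γStar
  have r3 := SUq.gen_rel (q := q) (φ := φ) .γ_αStar
  have r4 := SUq.gen_rel (q := q) (φ := φ) .γStar_αStar
  have r5 := SUq.gen_rel (q := q) (φ := φ) .α_αStar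
  have r6 := SUq.gen_rel (q := q) (φ := φ) .αStar_α
  have r7 := SUq.gen_rel (q := q) (φ := φ) .γ_γStar
  rw [← eq_sub_iff_add_eq] at r5 r6
  have hQ : ∀ n, (q : ℂ) * phase φ n ≠ 0 := fun n => mul_ne_zero hq' (phase_ne_zero φ n)
  replace r3 := ((inv_smul_eq_iff₀ (hQ _)).2 r3).symm
  replace r4 := ((inv_smul_eq_iff₀ (hQ _)).2 r4).symm
  generalize hBM : braidedOpMul (SUq.braid q φ) = BM at *
  have hmul := SUq.opMul_gens (q := q) (φ := φ)
  rw [hBM] at hmul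
  intro a b h
  cases h <;>
    simp only [SUq.antipodeGen, map_smul, smul_mul_assoc, mul_smul_comm, smul_smul, hmul] <;>
    simp only [← map_smul, ← map_add, ← map_sub, ← h1, SUGen.index] <;>
    refine congrArg BM ?_
  all_goals
    clear h1 hmul hBM BM
    generalize SUq.gen q φ .α = a at *
    generalize SUq.gen q φ .αStar = a' at *
    generalize SUq.gen q φ .γ = c at *
    generalize SUq.gen q φ .γStar = c' at *
    norm_num only <;>
    simp only [r1, r2, r3, r4, r5, r6, r7, smul_smul,
      smul_sub, smul_add] <;>
    simp only [phase_eq φ 4, phase_eq φ 8, phase_eq φ (-4), phase_eq φ (-8), phase_eq φ 0] <;>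
    match_scalars <;> field_simp <;> ring

/-- The antipode of `SU_{q,φ}(2)`: the linear map with `S 1 = 1` and
`S (g x) = (m ∘ Ψ) (S g ⊗ S x)` for generators `g`. -/
def SUq.antipode (q φ : ℝ) (hq : q ≠ 0) : SUq q φ →ₗ[ℂ] SUq q φ :=
  LinearMap.applyₗ 1 ∘ₗ
    (SUq.lift (B := Module.End ℂ (SUq q φ))
      (fun g => braidedOpMul (SUq.braid q φ) (SUq.antipodeGen q φ g))
      (SUq.antipode_rel hq)).toLinearMap

theorem SUq.antipode_gen (hq : q ≠ 0) (g : SUGen) :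
    SUq.antipode q φ hq (SUq.gen q φ g) = SUq.antipodeGen q φ g := by
  have h : ∀ a, braidedOpMul (SUq.braid q φ) (SUq.gen q φ a) 1 = SUq.gen q φ a := by
    intro a
    simp [SUq.braid, braidedOpMul_apply φ (SUq.hasIndex_gen a)]
  cases g <;> simp [SUq.antipode, SUq.antipodeGen, h]

/-- The braided Hopf algebra structure of `SU_{q,φ}(2)`. -/
def SUq.hopf (q φ : ℝ) (hq : q ≠ 0) : BraidedHopfData ℂ (SUq q φ) where
  comul := SUq.comul q φ hq
  counit := (SUq.counit q φ).toLinearMap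
  antipode := SUq.antipode q φ hq
  braid := SUq.braid q φ

end CoordinateAlgebra

section Pairing

/-- The braiding `Ξ` between `U_{q,φ}(û(2))` and `SU_{q,φ}(2)`. -/
def mixedBraid (q φ : ℝ) : Uq q φ ⊗[ℂ] SUq q φ →ₗ[ℂ] SUq q φ ⊗[ℂ] Uq q φ :=
  gradedBraiding φ (Uq.grading q φ) (SUq.grading q φ)

theorem mixedBraid_gen (q φ : ℝ) (a : UGen) (b : SUGen) :
    mixedBraid q φ (Uq.gen q φ a ⊗ₜ SUq.gen q φ b) =
      phase φ (2 * a.index * b.index) • (SUq.gen q φ b ⊗ₜ Uq.gen q φ a) :=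
  gradedBraiding_tmul φ (Uq.hasIndex_gen a) (SUq.hasIndex_gen b)

/-- The values of the pairing on generators. -/
def pairGen (q φ : ℝ) : UGen → SUGen → ℂ
  | .e, .γStar => -(q : ℂ)⁻¹ * phase φ (-4)
  | .f, .γ => 1
  | .k, .α => (√q : ℂ)⁻¹ * phase φ 2
  | .k, .αStar => (√q : ℂ) * phase φ (-2)
  | .kStar, .α => (√q : ℂ)⁻¹ * phase φ (-2)
  | .kStar, .αStar => (√q : ℂ) * phase φ 2
  | .kInv, .α => (√q : ℂ) * phase φ (-2)
  | .kInv, .αStar => (√q : ℂ)⁻¹ * phase φ 2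
  | .kStarInv, .α => (√q : ℂ) * phase φ 2
  | .kStarInv, .αStar => (√q : ℂ)⁻¹ * phase φ (-2)
  | _, _ => 0

end Pairing

end

end BraidedPairing

open BraidedPairing

/-! The pairing is `⟨x, a⟩ = ε(x ▷ a)` for an explicit left action of `U` on `A`. If a pairing
exists, one expects `x ▷ a = (id ⊗ ⟨·,·⟩)(Ξ ⊗ id)(x ⊗ Δa)`. On the generators of `A` this dictates
that `k` and `k*` act by rescaling automorphisms, and that `e` and `f` act by derivations twisted by
these automorphisms and by the braiding phase. That such operators exist is a check on the relations
of `A` (`SUq.der_e_rel`, `SUq.der_f_rel`). That they satisfy the relations of `U` is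
`SUq.actGen_rel`, whose real content is the commutator of `e` and `f` (`SUq.der_e_der_f`).

Two properties of the action give the two product formulas. First, `A` is a braided module algebra
(`SUq.act_mul`); since `ε` is multiplicative, this yields the formula for `⟨x, ab⟩`. Second, the
operators act on the right leg of a coproduct, `Δ(x ▷ a) = (twist ⊗ x ▷)(Δa)` (`SUq.comul_act`), and
with the counit law this yields the formula for `⟨xy, a⟩`. Compatibility with the antipodes then
comes for free: `⟨S ·, ·⟩` is a left and `⟨·, S ·⟩` a right convolution inverse of the pairing on
the braided tensor product coalgebra `U ⊗ A` (`antipode_pair_of_mul`). The two additional conditions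
say that the pairing is invariant under twisting both arguments (`SUq.pairing_twist`). Uniqueness
holds because the product and unit laws reduce every value to values on generators
(`IsBraidedPairing.ext_gen`).

Throughout, braiding past a homogeneous element of index `n` is the flip combined with the
automorphism `twist φ δ n`, so an identity of braid diagrams becomes a statement about maps
commuting with twists. The braided Hopf laws propagate from generators to products
(`IsBraidedHopfOn.isBraidedHopfAlgebra`), which leaves finitely many computations for `U` and `A`.
-/

namespace BraidedPairing

noncomputable section

/-! ### Graded algebras and the braidings defined by their gradings -/

section GradedAlgebras

variable {H A M N : Type*} [Ring H] [Algebra ℂ H] [Ring A] [Algebra ℂ A]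
  [AddCommGroup M] [Module ℂ M] [AddCommGroup N] [Module ℂ N]

/-- The homogeneous elements span the algebra. -/
def IsSpanned (δ : A →ₐ[ℂ] A[T;T⁻¹]) : Prop :=
  Submodule.span ℂ {x | ∃ n, HasIndex δ n x} = ⊤

variable {φ : ℝ} {δ δA : A →ₐ[ℂ] A[T;T⁻¹]} {δH : H →ₐ[ℂ] H[T;T⁻¹]}

theorem IsSpanned.ext (hδ : IsSpanned δ) {F G : A →ₗ[ℂ] M}
    (h : ∀ n x, HasIndex δ n x → F x = G x) : F = G :=
  LinearMap.ext_on hδ (by rintro x ⟨n, hx⟩; exact h n x hx)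

theorem IsSpanned.tensor_ext_left (hδ : IsSpanned δ) {F G : A ⊗[ℂ] N →ₗ[ℂ] M}
    (h : ∀ n x, HasIndex δ n x → ∀ y, F (x ⊗ₜ y) = G (x ⊗ₜ y)) : F = G :=
  TensorProduct.ext (hδ.ext fun n x hx => LinearMap.ext fun y => h n x hx y)

theorem IsSpanned.tensor_ext_right (hδ : IsSpanned δ) {F G : N ⊗[ℂ] A →ₗ[ℂ] M}
    (h : ∀ n x, HasIndex δ n x → ∀ y, F (y ⊗ₜ x) = G (y ⊗ₜ x)) : F = G :=
  TensorProduct.ext (LinearMap.ext fun y => hδ.ext fun n x hx => h n x hx y)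

theorem IsSpanned.tensor_ext_outer (hδ : IsSpanned δ) {F G : (A ⊗[ℂ] N) ⊗[ℂ] A →ₗ[ℂ] M}
    (h : ∀ m n x z, HasIndex δ m x → HasIndex δ n z → ∀ y,
      F ((x ⊗ₜ y) ⊗ₜ z) = G ((x ⊗ₜ y) ⊗ₜ z)) : F = G :=
  hδ.tensor_ext_right fun n z hz T => DFunLike.congr_fun
    (hδ.tensor_ext_left (F := F ∘ₗ (TensorProduct.mk ℂ (A ⊗[ℂ] N) A).flip z)
      (G := G ∘ₗ (TensorProduct.mk ℂ (A ⊗[ℂ] N) A).flip z)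
      fun m x hx y => h m n x z hx hz y) T

theorem HasIndex.smul {n : ℤ} {x : A} (hx : HasIndex δ n x) (c : ℂ) : HasIndex δ n (c • x) := by
  unfold HasIndex at *
  rw [map_smul, hx, AddMonoidAlgebra.smul_single]

theorem HasIndex.twist {n : ℤ} {x : A} (hx : HasIndex δ n x) (m : ℤ) :
    HasIndex δ n (twist φ δ m x) := by
  rw [twist_of_index φ m hx]
  exact hx.smul _

theorem IsSpanned.twist_twist (hδ : IsSpanned δ) (m n : ℤ) (x : A) :
    twist φ δ m (twist φ δ n x) = twist φ δ (m + n) x := by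
  refine DFunLike.congr_fun (hδ.ext (F := (twist φ δ m).toLinearMap ∘ₗ (twist φ δ n).toLinearMap)
    (G := (twist φ δ (m + n)).toLinearMap) fun k y hy => ?_) x
  simp only [LinearMap.comp_apply, AlgHom.toLinearMap_apply, twist_of_index φ _ hy, map_smul,
    smul_smul, ← phase_add]
  congr 2
  ring

theorem IsSpanned.twist_zero (hδ : IsSpanned δ) (x : A) : twist φ δ 0 x = x := by
  refine DFunLike.congr_fun (hδ.ext (F := (twist φ δ 0).toLinearMap)
    (G := LinearMap.id) fun k y hy => ?_) x
  simp [twist_of_index φ _ hy, phase_zero]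

theorem IsSpanned.twist_comm (hδ : IsSpanned δ) (m n : ℤ) (x : A) :
    twist φ δ m (twist φ δ n x) = twist φ δ n (twist φ δ m x) := by
  rw [hδ.twist_twist, hδ.twist_twist, add_comm]

/-- The phase is symmetric in the two indices, so the twist may be put on either factor. Every later
computation picks the side on which the homogeneous element sits. -/
theorem gradedBraiding_of_index_right (hH : IsSpanned δH) {n : ℤ} {a : A}
    (ha : HasIndex δA n a) (h : H) :
    gradedBraiding φ δH δA (h ⊗ₜ a) = a ⊗ₜ twist φ δH n h := by
  refine DFunLike.congr_fun (hH.ext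
    (F := gradedBraiding φ δH δA ∘ₗ (TensorProduct.mk ℂ H A).flip a)
    (G := TensorProduct.mk ℂ A H a ∘ₗ (twist φ δH n).toLinearMap) fun k y hy => ?_) h
  simp only [LinearMap.comp_apply, LinearMap.flip_apply, TensorProduct.mk_apply,
    AlgHom.toLinearMap_apply, gradedBraiding_tmul φ hy ha, twist_of_index φ _ hy,
    TensorProduct.tmul_smul]
  congr 2
  ring

theorem phase_neg_left (n : ℤ) : phase (-φ) n = phase φ (-n) := by
  simp [phase, Complex.exp_neg]

/-- Replacing `φ` by `-φ` inverts the phase, so the inverse of a graded braiding is again a graded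
braiding, in the opposite direction. -/
theorem gradedBraiding_neg_comp (hH : IsSpanned δH) (hA : IsSpanned δA) :
    gradedBraiding (-φ) δA δH ∘ₗ gradedBraiding φ δH δA = LinearMap.id := by
  refine hH.tensor_ext_left fun m h hh a => ?_
  refine DFunLike.congr_fun (hA.ext
    (F := gradedBraiding (-φ) δA δH ∘ₗ gradedBraiding φ δH δA ∘ₗ TensorProduct.mk ℂ H A h)
    (G := TensorProduct.mk ℂ H A h) fun n a ha => ?_) a
  simp only [LinearMap.comp_apply, TensorProduct.mk_apply, gradedBraiding_tmul φ hh ha, map_smul,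
    gradedBraiding_tmul (-φ) ha hh, smul_smul, phase_neg_left, ← phase_add]
  rw [show 2 * m * n + -(2 * n * m) = 0 by ring, phase_zero, one_smul]

theorem gradedBraiding_bijective (hH : IsSpanned δH) (hA : IsSpanned δA) :
    Function.Bijective (gradedBraiding φ δH δA) := by
  refine Function.bijective_iff_has_inverse.2 ⟨gradedBraiding (-φ) δA δH, fun x => ?_, fun x => ?_⟩
  · exact DFunLike.congr_fun (gradedBraiding_neg_comp hH hA) x
  · have := gradedBraiding_neg_comp (φ := -φ) hA hH
    rw [neg_neg] at this
    exact DFunLike.congr_fun this x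

theorem braidHH_of_index (hH : IsSpanned δH) {n : ℤ} {a : A} (ha : HasIndex δA n a)
    (T : H ⊗[ℂ] H) : braidHH (gradedBraiding φ δH δA) (T ⊗ₜ a) =
      a ⊗ₜ TensorProduct.map (twist φ δH n).toLinearMap (twist φ δH n).toLinearMap T := by
  induction T with
  | zero => simp
  | add x y hx hy => simp only [TensorProduct.add_tmul, TensorProduct.tmul_add, map_add, hx, hy]
  | tmul x y => simp [braidHH, gradedBraiding_of_index_right hH ha]

theorem braidAA_of_index {n : ℤ} {h : H} (hh : HasIndex δH n h)
    (T : A ⊗[ℂ] A) : braidAA (gradedBraiding φ δH δA) (h ⊗ₜ T) =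
      TensorProduct.map (twist φ δA n).toLinearMap (twist φ δA n).toLinearMap T ⊗ₜ h := by
  induction T with
  | zero => simp
  | add x y hx hy => simp only [TensorProduct.add_tmul, TensorProduct.tmul_add, map_add, hx, hy]
  | tmul x y => simp [braidAA, gradedBraiding_of_index φ δA hh]

theorem midSwap_of_index {n : ℤ} {h : H} (hh : HasIndex δH n h) (x : M) (a : A) (y : N) :
    midSwap (gradedBraiding φ δH δA) ((x ⊗ₜ h) ⊗ₜ (a ⊗ₜ y)) =
      (x ⊗ₜ twist φ δA n a) ⊗ₜ (h ⊗ₜ y) := by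
  simp [midSwap, gradedBraiding_of_index φ δA hh]

theorem midSwap_of_index_right (hH : IsSpanned δH) {n : ℤ} {a : A} (ha : HasIndex δA n a)
    (x : M) (h : H) (y : N) :
    midSwap (gradedBraiding φ δH δA) ((x ⊗ₜ h) ⊗ₜ (a ⊗ₜ y)) =
      (x ⊗ₜ a) ⊗ₜ (twist φ δH n h ⊗ₜ y) := by
  simp [midSwap, gradedBraiding_of_index_right hH ha]

/-- The coproduct and the counit of `D` preserve the grading `δ`. -/
structure PreservesIndex (φ : ℝ) (δ : A →ₐ[ℂ] A[T;T⁻¹]) (D : BraidedHopfData ℂ A) : Prop where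
  isSpanned : IsSpanned δ
  comul_twist : ∀ n x, D.comul (twist φ δ n x) =
    TensorProduct.map (twist φ δ n).toLinearMap (twist φ δ n).toLinearMap (D.comul x)
  counit_twist : ∀ n x, D.counit (twist φ δ n x) = D.counit x

/-- With one argument homogeneous, each axiom says that a twist respects one structure map of the
other algebra. For products and units this holds because twists are unital algebra maps; for
coproducts and counits it is the hypothesis `PreservesIndex`. -/
theorem PreservesIndex.isCompatibleBraiding {DH : BraidedHopfData ℂ H} {DA : BraidedHopfData ℂ A}
    (hH : PreservesIndex φ δH DH) (hA : PreservesIndex φ δA DA) :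
    IsCompatibleBraiding DH DA (gradedBraiding φ δH δA) where
  bijective := gradedBraiding_bijective hH.isSpanned hA.isSpanned
  mul_left := by
    refine hA.isSpanned.tensor_ext_right fun n a ha T => ?_
    simp only [LinearMap.comp_apply, LinearMap.rTensor_tmul, braidHH_of_index hH.isSpanned ha,
      LinearMap.lTensor_tmul, gradedBraiding_of_index_right hH.isSpanned ha]
    congr 1
    induction T with
    | zero => simp
    | add x y hx hy => simp only [map_add, hx, hy]
    | tmul x y => simp
  mul_right := by
    refine hH.isSpanned.tensor_ext_left fun n h hh T => ?_
    simp only [LinearMap.comp_apply, LinearMap.rTensor_tmul, braidAA_of_index hh,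
      LinearMap.lTensor_tmul, gradedBraiding_of_index φ δA hh]
    congr 1
    induction T with
    | zero => simp
    | add x y hx hy => simp only [map_add, hx, hy]
    | tmul x y => simp
  one_left a := by
    rw [gradedBraiding_of_index φ δA (hasIndex_one δH), hA.isSpanned.twist_zero]
  one_right h := by
    rw [gradedBraiding_of_index_right hH.isSpanned (hasIndex_one δA), hH.isSpanned.twist_zero]
  comul_left := by
    refine hA.isSpanned.tensor_ext_right fun n a ha T => ?_
    simp [braidHH_of_index hH.isSpanned ha, gradedBraiding_of_index_right hH.isSpanned ha,
      hH.comul_twist]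
  comul_right := by
    refine hH.isSpanned.tensor_ext_left fun n a ha T => ?_
    simp [braidAA_of_index ha, gradedBraiding_of_index φ δA ha, hA.comul_twist]
  counit_left h a := by
    refine DFunLike.congr_fun (hA.isSpanned.ext
      (F := (TensorProduct.rid ℂ A).toLinearMap ∘ₗ LinearMap.lTensor A DH.counit ∘ₗ
        gradedBraiding φ δH δA ∘ₗ TensorProduct.mk ℂ H A h)
      (G := DH.counit h • LinearMap.id) fun n a ha => ?_) a
    simp [gradedBraiding_of_index_right hH.isSpanned ha, hH.counit_twist]
  counit_right h a := by
    refine DFunLike.congr_fun (hH.isSpanned.ext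
      (F := (TensorProduct.lid ℂ H).toLinearMap ∘ₗ LinearMap.rTensor H DA.counit ∘ₗ
        gradedBraiding φ δH δA ∘ₗ (TensorProduct.mk ℂ H A).flip a)
      (G := DA.counit a • LinearMap.id) fun n h hh => ?_) h
    simp [gradedBraiding_of_index φ δA hh, hA.counit_twist]

/-- Homogeneous outer legs suffice: on either side the middle leg is twisted by both of their
indices, in opposite orders, and twists commute. -/
theorem gradedBraiding_yang_baxter (hδ : IsSpanned δ) :
    LinearMap.rTensor A (gradedBraiding φ δ δ) ∘ₗ
      ((TensorProduct.assoc ℂ A A A).symm.toLinearMap ∘ₗ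
        LinearMap.lTensor A (gradedBraiding φ δ δ) ∘ₗ
        (TensorProduct.assoc ℂ A A A).toLinearMap) ∘ₗ
        LinearMap.rTensor A (gradedBraiding φ δ δ) =
    ((TensorProduct.assoc ℂ A A A).symm.toLinearMap ∘ₗ
        LinearMap.lTensor A (gradedBraiding φ δ δ) ∘ₗ
        (TensorProduct.assoc ℂ A A A).toLinearMap) ∘ₗ
        LinearMap.rTensor A (gradedBraiding φ δ δ) ∘ₗ
      ((TensorProduct.assoc ℂ A A A).symm.toLinearMap ∘ₗ
        LinearMap.lTensor A (gradedBraiding φ δ δ) ∘ₗ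
        (TensorProduct.assoc ℂ A A A).toLinearMap) := by
  refine hδ.tensor_ext_outer fun m n a c ha hc b => ?_
  simp [gradedBraiding_of_index φ δ ha, gradedBraiding_of_index_right hδ hc,
    gradedBraiding_of_index_right hδ (hc.twist m), hδ.twist_comm m n]

end GradedAlgebras

/-! ### The braided tensor product of two coalgebras -/

section TripleSwap

variable {H A M : Type*} [Ring H] [Algebra ℂ H] [Ring A] [Algebra ℂ A]
  [AddCommGroup M] [Module ℂ M]

variable {φ : ℝ} {δ δA : A →ₐ[ℂ] A[T;T⁻¹]} {δH : H →ₐ[ℂ] H[T;T⁻¹]}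

/-- `(x ⊗ (y ⊗ z)) ⊗ (a ⊗ (b ⊗ c)) ↦ (x ⊗ a) ⊗ ((y ⊗ b) ⊗ (z ⊗ c))`, braiding the legs past each
other with `Ξ`. -/
def tripleSwap (Ξ : H ⊗[ℂ] A →ₗ[ℂ] A ⊗[ℂ] H) :
    (H ⊗[ℂ] (H ⊗[ℂ] H)) ⊗[ℂ] (A ⊗[ℂ] (A ⊗[ℂ] A)) →ₗ[ℂ]
      (H ⊗[ℂ] A) ⊗[ℂ] ((H ⊗[ℂ] A) ⊗[ℂ] (H ⊗[ℂ] A)) :=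
  LinearMap.lTensor (H ⊗[ℂ] A) (midSwap Ξ) ∘ₗ midSwap (braidHH Ξ)

/-- The coproduct of the braided tensor product coalgebra `H ⊗ A`. -/
def tensorComul (Ξ : H ⊗[ℂ] A →ₗ[ℂ] A ⊗[ℂ] H) (ΔH : H →ₗ[ℂ] H ⊗[ℂ] H) (ΔA : A →ₗ[ℂ] A ⊗[ℂ] A) :
    H ⊗[ℂ] A →ₗ[ℂ] (H ⊗[ℂ] A) ⊗[ℂ] (H ⊗[ℂ] A) :=
  midSwap Ξ ∘ₗ TensorProduct.map ΔH ΔA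

theorem midSwap_braidHH_of_index (hH : IsSpanned δH) {n : ℤ} {a : A} (ha : HasIndex δA n a)
    (x : H) (Y : H ⊗[ℂ] H) (y : M) :
    midSwap (braidHH (gradedBraiding φ δH δA)) ((x ⊗ₜ Y) ⊗ₜ (a ⊗ₜ y)) =
      (x ⊗ₜ a) ⊗ₜ (TensorProduct.map (twist φ δH n).toLinearMap (twist φ δH n).toLinearMap Y ⊗ₜ
        y) := by
  simp [midSwap, braidHH_of_index hH ha]

/-- Naturality of the braiding in the coproduct of `H`: splitting the right leg of `H` before or
after it crosses a leg of `A` makes no difference. -/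
theorem tripleSwap_lTensor (hH : IsSpanned δH) (hA : IsSpanned δA) {ΔH : H →ₗ[ℂ] H ⊗[ℂ] H}
    (hΔ : ∀ n x, ΔH (twist φ δH n x) =
      TensorProduct.map (twist φ δH n).toLinearMap (twist φ δH n).toLinearMap (ΔH x))
    (ΔA : A →ₗ[ℂ] A ⊗[ℂ] A) (S : H ⊗[ℂ] H) (T : A ⊗[ℂ] A) :
    tripleSwap (gradedBraiding φ δH δA) (LinearMap.lTensor H ΔH S ⊗ₜ LinearMap.lTensor A ΔA T) =
      LinearMap.lTensor (H ⊗[ℂ] A) (tensorComul (gradedBraiding φ δH δA) ΔH ΔA)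
        (midSwap (gradedBraiding φ δH δA) (S ⊗ₜ T)) := by
  induction S with
  | zero => simp
  | add S S' hS hS' => simp only [map_add, TensorProduct.add_tmul, hS, hS']
  | tmul x y =>
    refine DFunLike.congr_fun (hA.tensor_ext_left
      (F := tripleSwap (gradedBraiding φ δH δA) ∘ₗ
        TensorProduct.mk ℂ _ _ (LinearMap.lTensor H ΔH (x ⊗ₜ y)) ∘ₗ LinearMap.lTensor A ΔA)
      (G := LinearMap.lTensor (H ⊗[ℂ] A) (tensorComul (gradedBraiding φ δH δA) ΔH ΔA) ∘ₗ
        midSwap (gradedBraiding φ δH δA) ∘ₗ TensorProduct.mk ℂ _ _ (x ⊗ₜ y))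
      fun n a ha b => ?_) T
    simp [tripleSwap, midSwap_braidHH_of_index hH ha, midSwap_of_index_right hH ha, tensorComul, hΔ]

/-- `tripleSwap` moves the first leg of `A` past the last two legs of `H`. Here the same permutation
is done in the other order, with `z` crossing the first two legs of `A` at once. -/
theorem tripleSwap_assoc (hH : IsSpanned δH) (hA : IsSpanned δA) {z : H} {m : ℤ}
    (hz : HasIndex δH m z)
    (X : H ⊗[ℂ] H) (U : A ⊗[ℂ] A) (c : A) :
    tripleSwap (gradedBraiding φ δH δA)
      (TensorProduct.assoc ℂ H H H (X ⊗ₜ z) ⊗ₜ TensorProduct.assoc ℂ A A A (U ⊗ₜ c)) =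
    TensorProduct.assoc ℂ _ _ _ (midSwap (gradedBraiding φ δH δA)
      (X ⊗ₜ TensorProduct.map (twist φ δA m).toLinearMap (twist φ δA m).toLinearMap U) ⊗ₜ
        (z ⊗ₜ c)) := by
  induction X with
  | zero => simp only [TensorProduct.zero_tmul, LinearMap.map_zero, LinearEquiv.map_zero]
  | add X X' hX hX' =>
    simp only [LinearMap.map_add, LinearEquiv.map_add, TensorProduct.add_tmul, hX, hX']
  | tmul x y =>
    refine DFunLike.congr_fun (hA.tensor_ext_left
      (F := tripleSwap (gradedBraiding φ δH δA) ∘ₗ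
        TensorProduct.mk ℂ _ _ (TensorProduct.assoc ℂ H H H ((x ⊗ₜ y) ⊗ₜ z)) ∘ₗ
        (TensorProduct.assoc ℂ A A A).toLinearMap ∘ₗ (TensorProduct.mk ℂ _ _).flip c)
      (G := (TensorProduct.assoc ℂ _ _ _).toLinearMap ∘ₗ (TensorProduct.mk ℂ _ _).flip (z ⊗ₜ c) ∘ₗ
        midSwap (gradedBraiding φ δH δA) ∘ₗ TensorProduct.mk ℂ _ _ (x ⊗ₜ y) ∘ₗ
        TensorProduct.map (twist φ δA m).toLinearMap (twist φ δA m).toLinearMap)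
      fun n a ha b => ?_) U
    simp only [tripleSwap, LinearMap.comp_apply, TensorProduct.mk_apply, LinearMap.flip_apply,
      LinearEquiv.coe_coe, TensorProduct.assoc_tmul, midSwap_braidHH_of_index hH ha,
      TensorProduct.map_tmul, LinearMap.lTensor_tmul, AlgHom.toLinearMap_apply,
      midSwap_of_index (hz.twist n), midSwap_of_index_right hH (ha.twist m)]
    -- The crossing of `z` and `a` is recorded as a twist of `z` on one side and of `a` on the
    -- other; both are the same scalar.
    simp only [twist_of_index φ m ha, twist_of_index φ n hz, TensorProduct.tmul_smul,
      ← TensorProduct.smul_tmul', mul_right_comm 2 m n]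

theorem tripleSwap_rTensor (hH : IsSpanned δH) (hA : IsSpanned δA) (ΔH : H →ₗ[ℂ] H ⊗[ℂ] H)
    {ΔA : A →ₗ[ℂ] A ⊗[ℂ] A} (hΔ : ∀ n x, ΔA (twist φ δA n x) =
      TensorProduct.map (twist φ δA n).toLinearMap (twist φ δA n).toLinearMap (ΔA x))
    (S : H ⊗[ℂ] H) (T : A ⊗[ℂ] A) :
    tripleSwap (gradedBraiding φ δH δA) (TensorProduct.assoc ℂ H H H (LinearMap.rTensor H ΔH S) ⊗ₜ
      TensorProduct.assoc ℂ A A A (LinearMap.rTensor A ΔA T)) =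
      TensorProduct.assoc ℂ _ _ _ (LinearMap.rTensor (H ⊗[ℂ] A)
        (tensorComul (gradedBraiding φ δH δA) ΔH ΔA)
        (midSwap (gradedBraiding φ δH δA) (S ⊗ₜ T))) := by
  induction T with
  | zero => simp
  | add T T' hT hT' => simp only [map_add, TensorProduct.tmul_add, hT, hT']
  | tmul a c =>
    refine DFunLike.congr_fun (hH.tensor_ext_right
      (F := tripleSwap (gradedBraiding φ δH δA) ∘ₗ (TensorProduct.mk ℂ _ _).flip
        (TensorProduct.assoc ℂ A A A (LinearMap.rTensor A ΔA (a ⊗ₜ c))) ∘ₗ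
        (TensorProduct.assoc ℂ H H H).toLinearMap ∘ₗ LinearMap.rTensor H ΔH)
      (G := (TensorProduct.assoc ℂ _ _ _).toLinearMap ∘ₗ LinearMap.rTensor (H ⊗[ℂ] A)
        (tensorComul (gradedBraiding φ δH δA) ΔH ΔA) ∘ₗ
        midSwap (gradedBraiding φ δH δA) ∘ₗ (TensorProduct.mk ℂ _ _).flip (a ⊗ₜ c))
      fun n z hz x => ?_) S
    simp only [LinearMap.comp_apply, LinearMap.flip_apply, TensorProduct.mk_apply,
      LinearMap.rTensor_tmul, LinearEquiv.coe_coe, tripleSwap_assoc hH hA hz,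
      midSwap_of_index hz, tensorComul, TensorProduct.map_tmul, hΔ]

/-- The braided tensor product of two coalgebras is coassociative. -/
theorem tensorComul_coassoc (hH : IsSpanned δH) (hA : IsSpanned δA)
    {ΔH : H →ₗ[ℂ] H ⊗[ℂ] H} {ΔA : A →ₗ[ℂ] A ⊗[ℂ] A}
    (hΔH : ∀ n x, ΔH (twist φ δH n x) =
      TensorProduct.map (twist φ δH n).toLinearMap (twist φ δH n).toLinearMap (ΔH x))
    (hΔA : ∀ n x, ΔA (twist φ δA n x) =
      TensorProduct.map (twist φ δA n).toLinearMap (twist φ δA n).toLinearMap (ΔA x))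
    (cH : (TensorProduct.assoc ℂ H H H).toLinearMap ∘ₗ LinearMap.rTensor H ΔH ∘ₗ ΔH =
      LinearMap.lTensor H ΔH ∘ₗ ΔH)
    (cA : (TensorProduct.assoc ℂ A A A).toLinearMap ∘ₗ LinearMap.rTensor A ΔA ∘ₗ ΔA =
      LinearMap.lTensor A ΔA ∘ₗ ΔA) :
    (TensorProduct.assoc ℂ _ _ _).toLinearMap ∘ₗ
      LinearMap.rTensor (H ⊗[ℂ] A) (tensorComul (gradedBraiding φ δH δA) ΔH ΔA) ∘ₗ
      tensorComul (gradedBraiding φ δH δA) ΔH ΔA =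
    LinearMap.lTensor (H ⊗[ℂ] A) (tensorComul (gradedBraiding φ δH δA) ΔH ΔA) ∘ₗ
      tensorComul (gradedBraiding φ δH δA) ΔH ΔA := by
  refine TensorProduct.ext' fun h a => ?_
  -- Both iterated coproducts of `h ⊗ a` are `tripleSwap` applied to the iterated coproducts of `h`
  -- and `a`, which agree by `cH` and `cA`.
  have h1 := tripleSwap_lTensor hH hA hΔH ΔA (ΔH h) (ΔA a)
  have h2 := tripleSwap_rTensor hH hA ΔH hΔA (ΔH h) (ΔA a)
  have h3 := DFunLike.congr_fun cH h
  have h4 := DFunLike.congr_fun cA a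
  simp only [LinearMap.comp_apply, LinearEquiv.coe_coe] at h3 h4
  rw [h3, h4, h1] at h2
  simpa [tensorComul] using h2.symm

end TripleSwap

/-! ### Braided Hopf laws deduced from generators -/

section Generators

variable {ι A M : Type*} [Ring A] [Algebra ℂ A] [AddCommGroup M] [Module ℂ M]

/-- `x` is a product of `gen i`s, and `n` is the sum of the `idx i`. -/
inductive IsMonomial (gen : ι → A) (idx : ι → ℤ) : ℤ → A → Prop
  | one : IsMonomial gen idx 0 1
  | mul (i : ι) {n : ℤ} {x : A} (hx : IsMonomial gen idx n x) :
    IsMonomial gen idx (idx i + n) (gen i * x)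

variable {φ : ℝ} {δ : A →ₐ[ℂ] A[T;T⁻¹]} {gen : ι → A} {idx : ι → ℤ}

/-- The algebra is spanned by the products of the homogeneous elements `gen i`, of index `idx i`. -/
structure IsGeneratedBy (δ : A →ₐ[ℂ] A[T;T⁻¹]) (gen : ι → A) (idx : ι → ℤ) : Prop where
  hasIndex : ∀ i, HasIndex δ (idx i) (gen i)
  eq_top : ∀ S : Submodule ℂ A, 1 ∈ S → (∀ i, ∀ x ∈ S, gen i * x ∈ S) → S = ⊤

namespace IsGeneratedBy

theorem ext (h : IsGeneratedBy δ gen idx) {F G : A →ₗ[ℂ] M} (h1 : F 1 = G 1)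
    (hm : ∀ i x, F x = G x → F (gen i * x) = G (gen i * x)) : F = G :=
  LinearMap.ext fun x => (h.eq_top (LinearMap.eqLocus F G) h1 hm ▸ Submodule.mem_top :
    x ∈ LinearMap.eqLocus F G)

/-- For arguments in which the index of the element enters: a monomial comes with its index and
still allows induction on length, which a general homogeneous element does not. -/
theorem ext_monomial (h : IsGeneratedBy δ gen idx) {F G : A →ₗ[ℂ] M}
    (hm : ∀ n x, IsMonomial gen idx n x → F x = G x) : F = G := by
  refine LinearMap.ext_on (s := {x | ∃ n, IsMonomial gen idx n x}) (h.eq_top _ ?_ ?_) ?_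
  · exact Submodule.subset_span ⟨0, .one⟩
  · intro i x hx
    refine Submodule.span_induction (p := fun x _ => gen i * x ∈ Submodule.span ℂ _)
      ?_ ?_ ?_ ?_ hx
    · rintro x ⟨n, hn⟩
      exact Submodule.subset_span ⟨_, .mul i hn⟩
    · rw [mul_zero]; exact zero_mem _
    · intro x y _ _ hx hy
      rw [mul_add]; exact add_mem hx hy
    · intro c x _ hx
      rw [mul_smul_comm]; exact Submodule.smul_mem _ _ hx
  · rintro x ⟨n, hn⟩
    exact hm n x hn

theorem hasIndex_of_isMonomial (h : IsGeneratedBy δ gen idx) {n : ℤ} {x : A}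
    (hx : IsMonomial gen idx n x) : HasIndex δ n x := by
  induction hx with
  | one => exact hasIndex_one δ
  | mul i _ ih => exact (h.hasIndex i).mul ih

theorem isSpanned (h : IsGeneratedBy δ gen idx) : IsSpanned δ := by
  refine h.eq_top _ (Submodule.subset_span ⟨0, hasIndex_one δ⟩) fun i x hx => ?_
  refine Submodule.span_induction (p := fun x _ => gen i * x ∈ Submodule.span ℂ _) ?_ ?_ ?_ ?_ hx
  · rintro x ⟨n, hn⟩
    exact Submodule.subset_span ⟨_, (h.hasIndex i).mul hn⟩
  · rw [mul_zero]; exact zero_mem _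
  · intro x y _ _ hx hy
    rw [mul_add]; exact add_mem hx hy
  · intro c x _ hx
    rw [mul_smul_comm]; exact Submodule.smul_mem _ _ hx

end IsGeneratedBy

theorem braidedMul_tmul_right (hδ : IsSpanned δ) {n : ℤ} {c : A} (hc : HasIndex δ n c)
    (a b d : A) : braidedMul (gradedBraiding φ δ δ) (a ⊗ₜ b) (c ⊗ₜ d) =
      (a * c) ⊗ₜ (twist φ δ n b * d) := by
  simp [braidedMul, midSwap, gradedBraiding_of_index_right hδ hc]

/-- No closure of `P` under scalars is required, because a scalar can be moved to the unrestricted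
leg. -/
theorem tensor_induction_left (hδ : IsSpanned δ) {P : A ⊗[ℂ] A → Prop}
    (add : ∀ s t, P s → P t → P (s + t))
    (tmul : ∀ m a b, HasIndex δ m a → P (a ⊗ₜ b)) (t : A ⊗[ℂ] A) : P t := by
  have h0 : P 0 := by simpa using tmul 0 1 0 (hasIndex_one δ)
  induction t with
  | zero => exact h0
  | add s t hs ht => exact add s t hs ht
  | tmul a b =>
    refine Submodule.span_induction (p := fun a _ => ∀ b, P (a ⊗ₜ b)) ?_ ?_ ?_ ?_
      (hδ ▸ Submodule.mem_top : a ∈ _) b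
    · rintro x ⟨n, hn⟩ b
      exact tmul n x b hn
    · intro b
      rwa [TensorProduct.zero_tmul]
    · intro x y _ _ hx hy b
      rw [TensorProduct.add_tmul]
      exact add _ _ (hx b) (hy b)
    · intro c x _ hx b
      rw [TensorProduct.smul_tmul]
      exact hx _

theorem tensor_induction_right (hδ : IsSpanned δ) {P : A ⊗[ℂ] A → Prop}
    (add : ∀ s t, P s → P t → P (s + t))
    (tmul : ∀ m a b, HasIndex δ m b → P (a ⊗ₜ b)) (t : A ⊗[ℂ] A) : P t := by
  have h0 : P 0 := by simpa using tmul 0 0 1 (hasIndex_one δ)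
  induction t with
  | zero => exact h0
  | add s t hs ht => exact add s t hs ht
  | tmul a b =>
    refine Submodule.span_induction (p := fun b _ => ∀ a, P (a ⊗ₜ b)) ?_ ?_ ?_ ?_
      (hδ ▸ Submodule.mem_top : b ∈ _) a
    · rintro x ⟨n, hn⟩ b
      exact tmul n b x hn
    · intro b
      rwa [TensorProduct.tmul_zero]
    · intro x y _ _ hx hy b
      rw [TensorProduct.tmul_add]
      exact add _ _ (hx b) (hy b)
    · intro c x _ hx b
      rw [← TensorProduct.smul_tmul]
      exact hx _

theorem braidedMul_apply (Ψ : A ⊗[ℂ] A →ₗ[ℂ] A ⊗[ℂ] A) (s t : A ⊗[ℂ] A) :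
    braidedMul Ψ s t =
      TensorProduct.map (LinearMap.mul' ℂ A) (LinearMap.mul' ℂ A) (midSwap Ψ (s ⊗ₜ t)) := rfl

theorem map_twist_braidedMul (hδ : IsSpanned δ) (k : ℤ) (s t : A ⊗[ℂ] A) :
    TensorProduct.map (twist φ δ k).toLinearMap (twist φ δ k).toLinearMap
      (braidedMul (gradedBraiding φ δ δ) s t) =
    braidedMul (gradedBraiding φ δ δ)
      (TensorProduct.map (twist φ δ k).toLinearMap (twist φ δ k).toLinearMap s)
      (TensorProduct.map (twist φ δ k).toLinearMap (twist φ δ k).toLinearMap t) := by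
  induction s with
  | zero => simp
  | add s s' hs hs' => simp only [map_add, LinearMap.add_apply, hs, hs']
  | tmul x y =>
    induction t using tensor_induction_left hδ with
    | add t t' ht ht' => simp only [map_add, ht, ht']
    | tmul n c d hc =>
      simp [braidedMul_tmul_right hδ hc, braidedMul_tmul_right hδ (hc.twist k), hδ.twist_comm k n]

/-- When the left legs `c` and `e` are homogeneous, `y` crosses `c e` at once or `c` and `e` in
turn; the indices add, and so do the twists. -/
theorem braidedMul_assoc (hδ : IsSpanned δ) (s t u : A ⊗[ℂ] A) :
    braidedMul (gradedBraiding φ δ δ) (braidedMul (gradedBraiding φ δ δ) s t) u =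
      braidedMul (gradedBraiding φ δ δ) s (braidedMul (gradedBraiding φ δ δ) t u) := by
  induction u using tensor_induction_left hδ with
  | add u u' hu hu' => simp only [map_add, hu, hu']
  | tmul n e f he =>
    induction t using tensor_induction_left hδ with
    | add t t' ht ht' => simp only [map_add, LinearMap.add_apply, ht, ht']
    | tmul m c d hc =>
      induction s with
      | zero => simp
      | add s s' hs hs' => simp only [map_add, LinearMap.add_apply, hs, hs']
      | tmul x y =>
        simp [braidedMul_tmul_right hδ hc, braidedMul_tmul_right hδ he,
          braidedMul_tmul_right hδ (hc.mul he), hδ.twist_twist, mul_assoc, add_comm m n]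

/-- The laws of a graded braided Hopf algebra, on generators. -/
structure IsBraidedHopfOn (φ : ℝ) (δ : A →ₐ[ℂ] A[T;T⁻¹]) (D : BraidedHopfData ℂ A)
    (gen : ι → A) (idx : ι → ℤ) : Prop extends IsGeneratedBy δ gen idx where
  braid_eq : D.braid = gradedBraiding φ δ δ
  comul_one : D.comul 1 = 1 ⊗ₜ 1
  comul_gen_mul : ∀ i x,
    D.comul (gen i * x) = braidedMul (gradedBraiding φ δ δ) (D.comul (gen i)) (D.comul x)
  map_twist_comul_gen : ∀ i n, TensorProduct.map (twist φ δ n).toLinearMap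
    (twist φ δ n).toLinearMap (D.comul (gen i)) = phase φ (2 * n * idx i) • D.comul (gen i)
  coassoc_gen : ∀ i, TensorProduct.assoc ℂ A A A (LinearMap.rTensor A D.comul (D.comul (gen i))) =
    LinearMap.lTensor A D.comul (D.comul (gen i))
  counit_comul_gen : ∀ i,
    TensorProduct.lid ℂ A (LinearMap.rTensor A D.counit (D.comul (gen i))) = gen i
  comul_counit_gen : ∀ i,
    TensorProduct.rid ℂ A (LinearMap.lTensor A D.counit (D.comul (gen i))) = gen i
  counit_one : D.counit 1 = 1
  counit_mul : ∀ x y, D.counit (x * y) = D.counit x * D.counit y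
  counit_gen : ∀ i, idx i ≠ 0 → D.counit (gen i) = 0
  antipode_one : D.antipode 1 = 1
  antipode_gen_mul : ∀ i x,
    D.antipode (gen i * x) = twist φ δ (idx i) (D.antipode x) * D.antipode (gen i)
  antipode_gen_index : ∀ i, HasIndex δ (idx i) (D.antipode (gen i))
  antipode_left_gen : ∀ i, LinearMap.mul' ℂ A (LinearMap.rTensor A D.antipode (D.comul (gen i))) =
    algebraMap ℂ A (D.counit (gen i))
  antipode_right_gen : ∀ i, LinearMap.mul' ℂ A (LinearMap.lTensor A D.antipode (D.comul (gen i))) =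
    algebraMap ℂ A (D.counit (gen i))

namespace IsBraidedHopfOn

variable {D : BraidedHopfData ℂ A}

theorem preservesIndex (h : IsBraidedHopfOn φ δ D gen idx) : PreservesIndex φ δ D where
  isSpanned := h.isSpanned
  comul_twist n := by
    refine DFunLike.congr_fun (h.ext (F := D.comul ∘ₗ (twist φ δ n).toLinearMap)
      (G := TensorProduct.map (twist φ δ n).toLinearMap (twist φ δ n).toLinearMap ∘ₗ D.comul)
      ?_ fun i x hx => ?_)
    · simp [h.comul_one]
    · simp only [LinearMap.comp_apply, AlgHom.toLinearMap_apply, map_mul,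
        twist_of_index φ n (h.hasIndex i), smul_mul_assoc, map_smul, h.comul_gen_mul,
        map_twist_braidedMul h.isSpanned, h.map_twist_comul_gen, LinearMap.smul_apply] at hx ⊢
      rw [hx]
  counit_twist n := by
    refine DFunLike.congr_fun (h.ext (F := D.counit ∘ₗ (twist φ δ n).toLinearMap)
      (G := D.counit) ?_ fun i x hx => ?_)
    · simp
    · simp only [LinearMap.comp_apply, AlgHom.toLinearMap_apply, map_mul,
        twist_of_index φ n (h.hasIndex i), h.counit_mul, map_smul, smul_eq_mul] at hx ⊢
      rw [hx]
      -- The phase is trivial in index `0`, and the counit vanishes on the generator otherwise.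
      by_cases hi : idx i = 0
      · simp [hi, phase_zero]
      · simp [h.counit_gen i hi]

/-- Multiplicativity is assumed only for a generator on the left; associativity of the braided
product extends it to all monomials. -/
theorem comul_mul (h : IsBraidedHopfOn φ δ D gen idx) (x y : A) :
    D.comul (x * y) = braidedMul (gradedBraiding φ δ δ) (D.comul x) (D.comul y) := by
  refine DFunLike.congr_fun (h.ext (F := D.comul ∘ₗ (LinearMap.mul ℂ A).flip y)
      (G := (braidedMul (gradedBraiding φ δ δ)).flip (D.comul y) ∘ₗ D.comul) ?_
      fun i x hx => ?_) x
  · simp [h.comul_one, braidedMul_one φ δ h.isSpanned.twist_zero]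
  · simp only [LinearMap.comp_apply, LinearMap.flip_apply, LinearMap.mul_apply', mul_assoc,
      h.comul_gen_mul] at hx ⊢
    rw [hx, braidedMul_assoc h.isSpanned]

theorem comul_comp_mul (h : IsBraidedHopfOn φ δ D gen idx) : D.comul ∘ₗ LinearMap.mul' ℂ A =
    TensorProduct.map (LinearMap.mul' ℂ A) (LinearMap.mul' ℂ A) ∘ₗ
      tensorComul (gradedBraiding φ δ δ) D.comul D.comul :=
  TensorProduct.ext' fun x y => by simp [tensorComul, h.comul_mul, braidedMul]

/-- Together with `rTensor_comul_braidedMul`, this computes both iterated coproducts of a product by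
one and the same formula from those of the factors. Coassociativity therefore passes to products. -/
theorem lTensor_comul_braidedMul (h : IsBraidedHopfOn φ δ D gen idx) (s t : A ⊗[ℂ] A) :
    LinearMap.lTensor A D.comul (braidedMul (gradedBraiding φ δ δ) s t) =
      TensorProduct.map (LinearMap.mul' ℂ A) (TensorProduct.map (LinearMap.mul' ℂ A)
        (LinearMap.mul' ℂ A)) (tripleSwap (gradedBraiding φ δ δ)
          (LinearMap.lTensor A D.comul s ⊗ₜ LinearMap.lTensor A D.comul t)) := by
  rw [tripleSwap_lTensor h.isSpanned h.isSpanned h.preservesIndex.comul_twist]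
  simp only [braidedMul_apply, LinearMap.lTensor, TensorProduct.map_map, LinearMap.id_comp,
    LinearMap.comp_id, h.comul_comp_mul]

theorem rTensor_comul_braidedMul (h : IsBraidedHopfOn φ δ D gen idx) (s t : A ⊗[ℂ] A) :
    TensorProduct.assoc ℂ A A A
      (LinearMap.rTensor A D.comul (braidedMul (gradedBraiding φ δ δ) s t)) =
      TensorProduct.map (LinearMap.mul' ℂ A) (TensorProduct.map (LinearMap.mul' ℂ A)
        (LinearMap.mul' ℂ A)) (tripleSwap (gradedBraiding φ δ δ)
          (TensorProduct.assoc ℂ A A A (LinearMap.rTensor A D.comul s) ⊗ₜ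
            TensorProduct.assoc ℂ A A A (LinearMap.rTensor A D.comul t))) := by
  rw [tripleSwap_rTensor h.isSpanned h.isSpanned _ h.preservesIndex.comul_twist]
  rw [TensorProduct.map_map_assoc]
  simp only [braidedMul_apply, LinearMap.rTensor, TensorProduct.map_map, LinearMap.id_comp,
    LinearMap.comp_id, h.comul_comp_mul]

theorem coassoc (h : IsBraidedHopfOn φ δ D gen idx) :
    (TensorProduct.assoc ℂ A A A).toLinearMap ∘ₗ
    LinearMap.rTensor A D.comul ∘ₗ D.comul = LinearMap.lTensor A D.comul ∘ₗ D.comul := by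
  refine h.ext ?_ fun i x hx => ?_
  · simp [h.comul_one]
  · simp only [LinearMap.comp_apply, LinearEquiv.coe_coe, h.comul_gen_mul,
      h.lTensor_comul_braidedMul, h.rTensor_comul_braidedMul, h.coassoc_gen] at hx ⊢
    rw [hx]

theorem counit_comul (h : IsBraidedHopfOn φ δ D gen idx) (x : A) :
    TensorProduct.lid ℂ A (LinearMap.rTensor A D.counit (D.comul x)) = x := by
  -- `ε ⊗ id` is multiplicative for the braided product, since the twist created by the braiding
  -- falls on a leg to which the twist-invariant `ε` is applied.
  have key : ∀ s t : A ⊗[ℂ] A, TensorProduct.lid ℂ A (LinearMap.rTensor A D.counit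
      (braidedMul (gradedBraiding φ δ δ) s t)) =
      TensorProduct.lid ℂ A (LinearMap.rTensor A D.counit s) *
        TensorProduct.lid ℂ A (LinearMap.rTensor A D.counit t) := by
    intro s t
    induction s using tensor_induction_right h.isSpanned with
    | add s s' hs hs' => simp only [map_add, LinearMap.add_apply, hs, hs', add_mul]
    | tmul m a b hb =>
      induction t with
      | zero => simp
      | add s s' hs hs' => simp only [map_add, hs, hs', mul_add]
      | tmul c d =>
        simp [braidedMul_tmul φ hb, h.counit_mul, h.preservesIndex.counit_twist, smul_smul,
          mul_comm]
  refine DFunLike.congr_fun (h.ext (F := (TensorProduct.lid ℂ A).toLinearMap ∘ₗ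
    LinearMap.rTensor A D.counit ∘ₗ D.comul) (G := LinearMap.id) ?_ fun i x hx => ?_) x
  · simp [h.comul_one, h.counit_one]
  · simp only [LinearMap.comp_apply, LinearEquiv.coe_coe, h.comul_gen_mul, key,
      h.counit_comul_gen, LinearMap.id_apply] at hx ⊢
    rw [hx]

theorem comul_counit (h : IsBraidedHopfOn φ δ D gen idx) (x : A) :
    TensorProduct.rid ℂ A (LinearMap.lTensor A D.counit (D.comul x)) = x := by
  have key : ∀ s t : A ⊗[ℂ] A, TensorProduct.rid ℂ A (LinearMap.lTensor A D.counit
      (braidedMul (gradedBraiding φ δ δ) s t)) =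
      TensorProduct.rid ℂ A (LinearMap.lTensor A D.counit s) *
        TensorProduct.rid ℂ A (LinearMap.lTensor A D.counit t) := by
    intro s t
    induction t using tensor_induction_left h.isSpanned with
    | add s s' hs hs' => simp only [map_add, hs, hs', mul_add]
    | tmul m c d hc =>
      induction s with
      | zero => simp
      | add s s' hs hs' => simp only [map_add, LinearMap.add_apply, hs, hs', add_mul]
      | tmul a b =>
        simp [braidedMul_tmul_right h.isSpanned hc, h.counit_mul, h.preservesIndex.counit_twist,
          smul_smul, mul_comm]
  refine DFunLike.congr_fun (h.ext (F := (TensorProduct.rid ℂ A).toLinearMap ∘ₗ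
    LinearMap.lTensor A D.counit ∘ₗ D.comul) (G := LinearMap.id) ?_ fun i x hx => ?_) x
  · simp [h.comul_one, h.counit_one]
  · simp only [LinearMap.comp_apply, LinearEquiv.coe_coe, h.comul_gen_mul, key,
      h.comul_counit_gen, LinearMap.id_apply] at hx ⊢
    rw [hx]

theorem antipode_twist (h : IsBraidedHopfOn φ δ D gen idx) (n : ℤ) (x : A) :
    D.antipode (twist φ δ n x) = twist φ δ n (D.antipode x) := by
  refine DFunLike.congr_fun (h.ext (F := D.antipode ∘ₗ (twist φ δ n).toLinearMap)
    (G := (twist φ δ n).toLinearMap ∘ₗ D.antipode) ?_ fun i x hx => ?_) x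
  · simp [h.antipode_one]
  · simp only [LinearMap.comp_apply, AlgHom.toLinearMap_apply, map_mul,
      twist_of_index φ n (h.hasIndex i), smul_mul_assoc, map_smul, h.antipode_gen_mul,
      twist_of_index φ n (h.antipode_gen_index i), mul_smul_comm] at hx ⊢
    rw [hx, h.isSpanned.twist_comm]

/-- The recursion for `S` gives the rule with the twist on `S c`, for a monomial on the left. Since
the phase is symmetric, the twist can be transferred to `y`, and the formula then becomes linear in
`y`. -/
theorem antipode_mul_of_index_right (h : IsBraidedHopfOn φ δ D gen idx)
    {k : ℤ} {c : A} (hc : HasIndex δ k c) (y : A) :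
    D.antipode (y * c) = D.antipode c * D.antipode (twist φ δ k y) := by
  refine DFunLike.congr_fun (h.ext_monomial (F := D.antipode ∘ₗ (LinearMap.mul ℂ A).flip c)
    (G := LinearMap.mul ℂ A (D.antipode c) ∘ₗ D.antipode ∘ₗ (twist φ δ k).toLinearMap)
    fun n y hy => ?_) y
  have hy' : D.antipode (y * c) = twist φ δ n (D.antipode c) * D.antipode y := by
    induction hy with
    | one => simp [h.antipode_one, h.isSpanned.twist_zero]
    | mul i hy ih =>
      simp only [mul_assoc, h.antipode_gen_mul, ih, map_mul, h.isSpanned.twist_twist]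
  simp only [LinearMap.comp_apply, LinearMap.flip_apply, LinearMap.mul_apply', hy',
    ← h.antipode_twist, AlgHom.toLinearMap_apply, twist_of_index φ n hc,
    twist_of_index φ k (h.hasIndex_of_isMonomial hy), map_smul, smul_mul_assoc,
    mul_right_comm 2 n k]

theorem antipode_mul_of_index (h : IsBraidedHopfOn φ δ D gen idx)
    {m : ℤ} {z : A} (hz : HasIndex δ m z) (d : A) :
    D.antipode (z * d) = twist φ δ m (D.antipode d) * D.antipode z := by
  refine DFunLike.congr_fun (h.isSpanned.ext (F := D.antipode ∘ₗ LinearMap.mul ℂ A z)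
    (G := (LinearMap.mul ℂ A).flip (D.antipode z) ∘ₗ (twist φ δ m).toLinearMap ∘ₗ D.antipode)
    fun n d hd => ?_) d
  simp only [LinearMap.comp_apply, LinearMap.flip_apply, LinearMap.mul_apply',
    ← h.antipode_twist, AlgHom.toLinearMap_apply, twist_of_index φ m hd,
    h.antipode_mul_of_index_right hd, twist_of_index φ n hz, map_smul,
    mul_smul_comm, mul_right_comm 2 n m]

/-- In the convolution of `S` and `id` on a product `g x`, braided antimultiplicativity places the
contribution of `g` in the middle, where it collapses to `ε(g)`. -/
theorem antipode_left (h : IsBraidedHopfOn φ δ D gen idx) (x : A) :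
    LinearMap.mul' ℂ A (LinearMap.rTensor A D.antipode (D.comul x)) =
      algebraMap ℂ A (D.counit x) := by
  have key : ∀ i, ∀ t : A ⊗[ℂ] A, LinearMap.mul' ℂ A (LinearMap.rTensor A D.antipode
      (braidedMul (gradedBraiding φ δ δ) (D.comul (gen i)) t)) =
      D.counit (gen i) • LinearMap.mul' ℂ A (LinearMap.rTensor A D.antipode t) := by
    intro i t
    induction t using tensor_induction_left h.isSpanned with
    | add t t' ht ht' => simp only [map_add, ht, ht', smul_add]
    | tmul k c d hc =>
      have aux : ∀ s : A ⊗[ℂ] A, LinearMap.mul' ℂ A (LinearMap.rTensor A D.antipode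
          (braidedMul (gradedBraiding φ δ δ) s (c ⊗ₜ d))) =
          D.antipode c * LinearMap.mul' ℂ A (LinearMap.rTensor A D.antipode
            (TensorProduct.map (twist φ δ k).toLinearMap (twist φ δ k).toLinearMap s)) * d := by
        intro s
        induction s with
        | zero => simp
        | add s s' hs hs' => simp only [map_add, LinearMap.add_apply, hs, hs', mul_add, add_mul]
        | tmul x y =>
          simp [braidedMul_tmul_right h.isSpanned hc, h.antipode_mul_of_index_right hc, mul_assoc]
      -- The phase left over from twisting `Δ g` disappears against `ε(g)`, because `ε` is
      -- twist-invariant.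
      have hε := h.preservesIndex.counit_twist k (gen i)
      rw [twist_of_index φ k (h.hasIndex i), map_smul, smul_eq_mul] at hε
      rw [aux, h.map_twist_comul_gen, map_smul, map_smul, h.antipode_left_gen]
      simp [Algebra.algebraMap_eq_smul_one, smul_smul, hε]
  refine DFunLike.congr_fun (h.ext (F := LinearMap.mul' ℂ A ∘ₗ LinearMap.rTensor A D.antipode ∘ₗ
    D.comul) (G := Algebra.linearMap ℂ A ∘ₗ D.counit) ?_ fun i x hx => ?_) x
  · simp [h.comul_one, h.counit_one, h.antipode_one]
  · simp only [LinearMap.comp_apply, h.comul_gen_mul, key, h.counit_mul,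
      Algebra.linearMap_apply] at hx ⊢
    rw [hx, map_mul, Algebra.smul_def]

theorem antipode_right (h : IsBraidedHopfOn φ δ D gen idx) (x : A) :
    LinearMap.mul' ℂ A (LinearMap.lTensor A D.antipode (D.comul x)) =
      algebraMap ℂ A (D.counit x) := by
  -- With `S` on the right leg it is the second factor that collapses first. So the induction
  -- hypothesis on `t = Δx` enters here, with `r = ε(x)`, and the law for the generator is used
  -- afterwards.
  have key : ∀ (r : ℂ) (t : A ⊗[ℂ] A),
      LinearMap.mul' ℂ A (LinearMap.lTensor A D.antipode t) = algebraMap ℂ A r → ∀ s : A ⊗[ℂ] A,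
      LinearMap.mul' ℂ A (LinearMap.lTensor A D.antipode
        (braidedMul (gradedBraiding φ δ δ) s t)) =
      r • LinearMap.mul' ℂ A (LinearMap.lTensor A D.antipode s) := by
    intro r t ht s
    induction s using tensor_induction_right h.isSpanned with
    | add s s' hs hs' => simp only [map_add, LinearMap.add_apply, hs, hs', smul_add]
    | tmul m y z hz =>
      have aux : LinearMap.mul' ℂ A (LinearMap.lTensor A D.antipode
          (braidedMul (gradedBraiding φ δ δ) (y ⊗ₜ z) t)) =
          y * twist φ δ m (LinearMap.mul' ℂ A (LinearMap.lTensor A D.antipode t)) *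
            D.antipode z := by
        clear ht
        induction t with
        | zero => simp
        | add s s' hs hs' => simp only [map_add, hs, hs', mul_add, add_mul]
        | tmul c d =>
          simp [braidedMul_tmul φ hz, h.antipode_mul_of_index hz, mul_assoc]
      rw [aux, ht]
      simp [Algebra.algebraMap_eq_smul_one]
  refine DFunLike.congr_fun (h.ext (F := LinearMap.mul' ℂ A ∘ₗ LinearMap.lTensor A D.antipode ∘ₗ
    D.comul) (G := Algebra.linearMap ℂ A ∘ₗ D.counit) ?_ fun i x hx => ?_) x
  · simp [h.comul_one, h.counit_one, h.antipode_one]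
  · simp only [LinearMap.comp_apply, Algebra.linearMap_apply] at hx ⊢
    rw [h.comul_gen_mul, key _ _ hx, h.antipode_right_gen, h.counit_mul, mul_comm, map_mul,
      Algebra.smul_def]

theorem isBraidedHopfAlgebra (h : IsBraidedHopfOn φ δ D gen idx) : IsBraidedHopfAlgebra D where
  braid_compatible := h.braid_eq ▸ h.preservesIndex.isCompatibleBraiding h.preservesIndex
  yang_baxter := h.braid_eq ▸ gradedBraiding_yang_baxter h.isSpanned
  coassoc := h.coassoc
  counit_comul := h.counit_comul
  comul_counit := h.comul_counit
  comul_one := h.comul_one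
  comul_mul := h.braid_eq ▸ h.comul_mul
  counit_one := h.counit_one
  counit_mul := h.counit_mul
  antipode_left := h.antipode_left
  antipode_right := h.antipode_right

end IsBraidedHopfOn

end Generators

/-! ### Antipodes as convolution inverses of a pairing -/

section PairingAntipode

variable {H A : Type*} [Ring H] [Algebra ℂ H] [Ring A] [Algebra ℂ A]

variable {φ : ℝ} {δA : A →ₐ[ℂ] A[T;T⁻¹]} {δH : H →ₐ[ℂ] H[T;T⁻¹]}

/-- The outer legs never meet `Ξ`, so no naturality of `Ξ` is needed. This lets the antipode be
pulled out of the braided coproduct of `H ⊗ A`. -/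
theorem midSwap_rTensor_outer (Ξ : H ⊗[ℂ] A →ₗ[ℂ] A ⊗[ℂ] H) (f : H →ₗ[ℂ] H) (s : H ⊗[ℂ] H)
    (t : A ⊗[ℂ] A) : midSwap Ξ (LinearMap.rTensor H f s ⊗ₜ t) =
      LinearMap.rTensor (H ⊗[ℂ] A) (LinearMap.rTensor A f) (midSwap Ξ (s ⊗ₜ t)) := by
  induction s with
  | zero => simp
  | add s s' hs hs' => simp only [map_add, TensorProduct.add_tmul, hs, hs']
  | tmul x y =>
    induction t with
    | zero => simp
    | add s s' hs hs' => simp only [map_add, TensorProduct.tmul_add, hs, hs']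
    | tmul a b =>
      simp only [midSwap, LinearMap.comp_apply, LinearEquiv.coe_coe, TensorProduct.assoc_tmul,
        LinearMap.rTensor_tmul, LinearMap.lTensor_tmul, TensorProduct.assoc_symm_tmul]
      induction Ξ (y ⊗ₜ a) with
      | zero => simp
      | add s s' hs hs' => simp only [map_add, TensorProduct.add_tmul, TensorProduct.tmul_add,
          hs, hs']
      | tmul c d => simp

theorem midSwap_lTensor_outer (Ξ : H ⊗[ℂ] A →ₗ[ℂ] A ⊗[ℂ] H) (f : A →ₗ[ℂ] A) (s : H ⊗[ℂ] H)
    (t : A ⊗[ℂ] A) : midSwap Ξ (s ⊗ₜ LinearMap.lTensor A f t) =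
      LinearMap.lTensor (H ⊗[ℂ] A) (LinearMap.lTensor H f) (midSwap Ξ (s ⊗ₜ t)) := by
  induction s with
  | zero => simp
  | add s s' hs hs' => simp only [map_add, TensorProduct.add_tmul, hs, hs']
  | tmul x y =>
    induction t with
    | zero => simp
    | add s s' hs hs' => simp only [map_add, TensorProduct.tmul_add, hs, hs']
    | tmul a b =>
      simp only [midSwap, LinearMap.comp_apply, LinearEquiv.coe_coe, TensorProduct.assoc_tmul,
        LinearMap.rTensor_tmul, LinearMap.lTensor_tmul, TensorProduct.assoc_symm_tmul]
      induction Ξ (y ⊗ₜ a) with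
      | zero => simp
      | add s s' hs hs' => simp only [map_add, TensorProduct.add_tmul, TensorProduct.tmul_add,
          hs, hs']
      | tmul c d => simp

/-- The braided tensor product of the coalgebras `H` and `A`. -/
@[reducible] def tensorCoalgebra {DH : BraidedHopfData ℂ H} {DA : BraidedHopfData ℂ A}
    (hH : PreservesIndex φ δH DH) (hA : PreservesIndex φ δA DA)
    (lH : IsBraidedHopfAlgebra DH) (lA : IsBraidedHopfAlgebra DA) : Coalgebra ℂ (H ⊗[ℂ] A) where
  comul := tensorComul (gradedBraiding φ δH δA) DH.comul DA.comul
  counit := LinearMap.mul' ℂ ℂ ∘ₗ TensorProduct.map DH.counit DA.counit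
  coassoc := tensorComul_coassoc hH.isSpanned hA.isSpanned hH.comul_twist hA.comul_twist
    lH.coassoc lA.coassoc
  rTensor_counit_comp_comul := by
    have key : ∀ (s : H ⊗[ℂ] H) (t : A ⊗[ℂ] A),
        LinearMap.rTensor (H ⊗[ℂ] A) (LinearMap.mul' ℂ ℂ ∘ₗ TensorProduct.map DH.counit DA.counit)
          (midSwap (gradedBraiding φ δH δA) (s ⊗ₜ t)) =
        1 ⊗ₜ (TensorProduct.lid ℂ H (LinearMap.rTensor H DH.counit s) ⊗ₜ
          TensorProduct.lid ℂ A (LinearMap.rTensor A DA.counit t)) := by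
      intro s t
      induction s using tensor_induction_right hH.isSpanned with
      | add s s' hs hs' => simp only [map_add, TensorProduct.add_tmul, TensorProduct.tmul_add,
          hs, hs']
      | tmul m x y hy =>
        induction t with
        | zero => simp
        | add s s' hs hs' => simp only [map_add, TensorProduct.tmul_add, hs, hs']
        | tmul a b =>
          rw [midSwap_of_index hy]
          simp only [LinearMap.rTensor_tmul, LinearMap.comp_apply, TensorProduct.map_tmul,
            LinearMap.mul'_apply, hA.counit_twist, TensorProduct.lid_tmul]
          rw [← mul_one (DH.counit x * DA.counit a), ← smul_eq_mul, TensorProduct.smul_tmul,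
            TensorProduct.smul_tmul_smul]
    refine TensorProduct.ext' fun x a => ?_
    simp only [LinearMap.comp_apply, tensorComul, TensorProduct.map_tmul, key, lH.counit_comul,
      lA.counit_comul, TensorProduct.mk_apply]
  lTensor_counit_comp_comul := by
    have key : ∀ (s : H ⊗[ℂ] H) (t : A ⊗[ℂ] A),
        LinearMap.lTensor (H ⊗[ℂ] A) (LinearMap.mul' ℂ ℂ ∘ₗ TensorProduct.map DH.counit DA.counit)
          (midSwap (gradedBraiding φ δH δA) (s ⊗ₜ t)) =
        (TensorProduct.rid ℂ H (LinearMap.lTensor H DH.counit s) ⊗ₜ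
          TensorProduct.rid ℂ A (LinearMap.lTensor A DA.counit t)) ⊗ₜ 1 := by
      intro s t
      induction t using tensor_induction_left hA.isSpanned with
      | add s s' hs hs' => simp only [map_add, TensorProduct.add_tmul, TensorProduct.tmul_add,
          hs, hs']
      | tmul m a b ha =>
        induction s with
        | zero => simp
        | add s s' hs hs' => simp only [map_add, TensorProduct.add_tmul, hs, hs']
        | tmul x y =>
          rw [midSwap_of_index_right hH.isSpanned ha]
          simp only [LinearMap.lTensor_tmul, LinearMap.comp_apply, TensorProduct.map_tmul,
            LinearMap.mul'_apply, hH.counit_twist, TensorProduct.rid_tmul]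
          rw [← mul_one (DH.counit y * DA.counit b), ← smul_eq_mul, ← TensorProduct.smul_tmul,
            TensorProduct.smul_tmul_smul]
    refine TensorProduct.ext' fun x a => ?_
    simp only [LinearMap.comp_apply, tensorComul, TensorProduct.map_tmul, key, lH.comul_counit,
      lA.comul_counit, TensorProduct.mk_apply, LinearMap.flip_apply]

/-- A form compatible with products and units is compatible with antipodes: `⟨S ·, ·⟩` and
`⟨·, S ·⟩` are both convolution inverses of `⟨·, ·⟩`. -/
theorem antipode_pair_of_mul {DH : BraidedHopfData ℂ H} {DA : BraidedHopfData ℂ A}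
    (hH : PreservesIndex φ δH DH) (hA : PreservesIndex φ δA DA)
    (lH : IsBraidedHopfAlgebra DH) (lA : IsBraidedHopfAlgebra DA) {B : H ⊗[ℂ] A →ₗ[ℂ] ℂ}
    (pair_mul : ∀ (h : H) (a b : A), B (h ⊗ₜ (a * b)) =
      pairPair B (midSwap (gradedBraiding φ δH δA) (DH.comul h ⊗ₜ (a ⊗ₜ b))))
    (mul_pair : ∀ (h g : H) (a : A), B ((h * g) ⊗ₜ a) =
      pairPair B (midSwap (gradedBraiding φ δH δA) ((h ⊗ₜ g) ⊗ₜ DA.comul a)))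
    (pair_one : ∀ h : H, B (h ⊗ₜ 1) = DH.counit h) (one_pair : ∀ a : A, B (1 ⊗ₜ a) = DA.counit a)
    (h : H) (a : A) : B (DH.antipode h ⊗ₜ a) = B (h ⊗ₜ DA.antipode a) := by
  -- This coalgebra structure supplies the convolution product on linear forms on `H ⊗ A`.
  let _ := tensorCoalgebra hH hA lH lA
  have hl : WithConv.toConv (B ∘ₗ LinearMap.rTensor A DH.antipode) * WithConv.toConv B = 1 := by
    -- Read backwards, the formula for `⟨hg, a⟩` gathers the two `H` legs into `m(S ⊗ id)Δh`, to
    -- which the antipode law applies. The right inverse does the same on the `A` side, with the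
    -- formula for `⟨h, ab⟩`.
    have key : ∀ (s : H ⊗[ℂ] H) (a : A),
        LinearMap.mul' ℂ ℂ (TensorProduct.map (B ∘ₗ LinearMap.rTensor A DH.antipode) B
          (midSwap (gradedBraiding φ δH δA) (s ⊗ₜ DA.comul a))) =
        B (LinearMap.mul' ℂ H (LinearMap.rTensor H DH.antipode s) ⊗ₜ a) := by
      intro s a
      rw [← LinearMap.map_comp_rTensor, LinearMap.comp_apply, ← midSwap_rTensor_outer]
      generalize LinearMap.rTensor H DH.antipode s = s
      induction s with
      | zero => simp
      | add s s' hs hs' => simp only [map_add, TensorProduct.add_tmul, hs, hs']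
      | tmul x y => rw [LinearMap.mul'_apply, mul_pair]; rfl
    apply WithConv.ofConv_injective
    refine TensorProduct.ext' fun h a => ?_
    refine (key (DH.comul h) a).trans ?_
    rw [lH.antipode_left, Algebra.algebraMap_eq_smul_one, ← TensorProduct.smul_tmul', map_smul,
      one_pair]
    rfl
  have hr : WithConv.toConv B * WithConv.toConv (B ∘ₗ LinearMap.lTensor H DA.antipode) = 1 := by
    have key : ∀ (h : H) (t : A ⊗[ℂ] A),
        LinearMap.mul' ℂ ℂ (TensorProduct.map B (B ∘ₗ LinearMap.lTensor H DA.antipode)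
          (midSwap (gradedBraiding φ δH δA) (DH.comul h ⊗ₜ t))) =
        B (h ⊗ₜ LinearMap.mul' ℂ A (LinearMap.lTensor A DA.antipode t)) := by
      intro h t
      rw [← LinearMap.map_comp_lTensor, LinearMap.comp_apply, ← midSwap_lTensor_outer]
      generalize LinearMap.lTensor A DA.antipode t = t
      induction t with
      | zero => simp
      | add s s' hs hs' => simp only [map_add, TensorProduct.tmul_add, hs, hs']
      | tmul x y => rw [LinearMap.mul'_apply, pair_mul]; rfl
    apply WithConv.ofConv_injective
    refine TensorProduct.ext' fun h a => ?_
    refine (key h (DA.comul a)).trans ?_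
    rw [lA.antipode_right, Algebra.algebraMap_eq_smul_one, TensorProduct.tmul_smul, map_smul,
      pair_one, smul_eq_mul, mul_comm]
    rfl
  have := congrArg WithConv.ofConv (left_inv_eq_right_inv hl hr)
  exact DFunLike.congr_fun this (h ⊗ₜ a)

end PairingAntipode

/-! ### The braided Hopf algebra laws for `U` and `SU` -/

section ConcreteHopf

variable {q φ : ℝ}

theorem Uq.isGeneratedBy : IsGeneratedBy (Uq.grading q φ) (Uq.gen q φ) UGen.index where
  hasIndex := Uq.hasIndex_gen
  eq_top S h1 hS := by
    -- Quantifying over all `x ∈ S`, instead of `x = 1`, is what makes the product case of the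
    -- induction work.
    have key : ∀ a : FreeAlgebra ℂ UGen, ∀ x ∈ S, Uq.mk q φ a * x ∈ S := by
      intro a
      induction a using FreeAlgebra.induction with
      | grade0 r =>
        intro x hx
        rw [AlgHom.commutes, ← Algebra.smul_def]
        exact S.smul_mem _ hx
      | grade1 g => exact hS g
      | mul a b ha hb =>
        intro x hx
        rw [map_mul, mul_assoc]
        exact ha _ (hb _ hx)
      | add a b ha hb =>
        intro x hx
        rw [map_add, add_mul]
        exact S.add_mem (ha _ hx) (hb _ hx)
    refine eq_top_iff.2 fun u _ => ?_
    obtain ⟨a, rfl⟩ := RingQuot.mkAlgHom_surjective ℂ (URel q φ (FreeAlgebra.ι ℂ)) u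
    have := key a 1 h1
    rwa [mul_one] at this

theorem SUq.isGeneratedBy : IsGeneratedBy (SUq.grading q φ) (SUq.gen q φ) SUGen.index where
  hasIndex := SUq.hasIndex_gen
  eq_top S h1 hS := by
    have key : ∀ a : FreeAlgebra ℂ SUGen, ∀ x ∈ S, SUq.mk q φ a * x ∈ S := by
      intro a
      induction a using FreeAlgebra.induction with
      | grade0 r =>
        intro x hx
        rw [AlgHom.commutes, ← Algebra.smul_def]
        exact S.smul_mem _ hx
      | grade1 g => exact hS g
      | mul a b ha hb =>
        intro x hx
        rw [map_mul, mul_assoc]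
        exact ha _ (hb _ hx)
      | add a b ha hb =>
        intro x hx
        rw [map_add, add_mul]
        exact S.add_mem (ha _ hx) (hb _ hx)
    refine eq_top_iff.2 fun u _ => ?_
    obtain ⟨a, rfl⟩ := RingQuot.mkAlgHom_surjective ℂ (SURel q φ (FreeAlgebra.ι ℂ)) u
    have := key a 1 h1
    rwa [mul_one] at this

theorem Uq.twist_gen (n : ℤ) (g : UGen) : twist φ (Uq.grading q φ) n (Uq.gen q φ g) =
    phase φ (2 * n * g.index) • Uq.gen q φ g :=
  twist_of_index φ n (Uq.hasIndex_gen g)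

theorem SUq.twist_gen (n : ℤ) (g : SUGen) : twist φ (SUq.grading q φ) n (SUq.gen q φ g) =
    phase φ (2 * n * g.index) • SUq.gen q φ g :=
  twist_of_index φ n (SUq.hasIndex_gen g)

theorem Uq.counit_gen (g : UGen) :
    Uq.counit q φ (Uq.gen q φ g) = if g.index = 0 then 1 else 0 := by
  cases g <;> simp [Uq.counit, UGen.index]

theorem SUq.counit_gen (g : SUGen) :
    SUq.counit q φ (SUq.gen q φ g) = if g.index = 0 then 1 else 0 := by
  cases g <;> simp [SUq.counit, SUGen.index]

theorem Uq.antipodeGen_index (g : UGen) :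
    HasIndex (Uq.grading q φ) g.index (Uq.antipodeGen q φ g) := by
  cases g
  · exact (Uq.hasIndex_gen .e).smul _
  · exact (Uq.hasIndex_gen .f).smul _
  · exact Uq.hasIndex_gen .kInv
  · exact Uq.hasIndex_gen .k
  · exact Uq.hasIndex_gen .kStarInv
  · exact Uq.hasIndex_gen .kStar

theorem SUq.antipodeGen_index (g : SUGen) :
    HasIndex (SUq.grading q φ) g.index (SUq.antipodeGen q φ g) := by
  cases g
  · exact SUq.hasIndex_gen .αStar
  · exact SUq.hasIndex_gen .α
  · exact (SUq.hasIndex_gen .γ).smul _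
  · exact (SUq.hasIndex_gen .γStar).smul _

/-- Among these checks only the antipode laws use the defining relations; for `e` and `f` the scalar
in `S` is chosen to cancel the factor from commuting past `k` or `k*`. -/
theorem Uq.isBraidedHopfOn (hq : q ≠ 0) :
    IsBraidedHopfOn φ (Uq.grading q φ) (Uq.hopf q φ hq) (Uq.gen q φ) UGen.index where
  toIsGeneratedBy := Uq.isGeneratedBy
  braid_eq := rfl
  comul_one := by simp [Uq.hopf, Uq.comul]
  comul_gen_mul i x := by
    simp only [Uq.hopf, Uq.comul_gen]
    simp [Uq.comul, Uq.braid]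
  map_twist_comul_gen i n := by
    cases i <;> simp [Uq.hopf, Uq.comul_gen, Uq.comulGen, Uq.twist_gen, UGen.index, phase_zero,
      ← TensorProduct.smul_tmul']
  coassoc_gen i := by
    cases i <;> simp [Uq.hopf, Uq.comul_gen, Uq.comulGen, TensorProduct.add_tmul,
      TensorProduct.tmul_add, add_assoc]
  counit_comul_gen i := by
    cases i <;> simp [Uq.hopf, Uq.comul_gen, Uq.comulGen, Uq.counit_gen, UGen.index]
  comul_counit_gen i := by
    cases i <;> simp [Uq.hopf, Uq.comul_gen, Uq.comulGen, Uq.counit_gen, UGen.index]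
  counit_one := map_one (Uq.counit q φ)
  counit_mul := map_mul (Uq.counit q φ)
  counit_gen i := by
    cases i <;> simp [UGen.index, Uq.hopf, Uq.counit_gen]
  antipode_one := by simp [Uq.hopf, Uq.antipode]
  antipode_gen_mul i x := by
    simp only [Uq.hopf, Uq.antipode_gen, ← braidedOpMul_apply φ (Uq.antipodeGen_index i)]
    simp [Uq.antipode, Uq.braid]
  antipode_gen_index i := by
    simp only [Uq.hopf, Uq.antipode_gen]
    exact Uq.antipodeGen_index i
  antipode_left_gen i := by
    have hq' : (q : ℂ) ≠ 0 := by exact_mod_cast hq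
    have ht := phase_ne_zero φ 1
    cases i <;> simp [Uq.hopf, Uq.comul_gen, Uq.comulGen, Uq.antipode_gen, Uq.antipodeGen,
      Uq.counit_gen, UGen.index, Uq.gen_rel .k_kInv, Uq.gen_rel .kInv_k,
      Uq.gen_rel .kStar_kStarInv, Uq.gen_rel .kStarInv_kStar, Uq.gen_rel .e_k,
      Uq.gen_rel .kStar_f, smul_smul, phase_eq φ 4, phase_eq φ (-4)] <;>
      match_scalars <;> field_simp <;> ring
  antipode_right_gen i := by
    have hq' : (q : ℂ) ≠ 0 := by exact_mod_cast hq
    have ht := phase_ne_zero φ 1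
    have r1 := inv_rel (mul_ne_zero hq' (phase_ne_zero φ _)) (Uq.gen_rel (q := q) .k_kInv)
      (Uq.gen_rel .kInv_k) (Uq.gen_rel .e_k)
    have r2 := inv_rel' (mul_ne_zero hq' (phase_ne_zero φ _)) (Uq.gen_rel (q := q) .kStar_kStarInv)
      (Uq.gen_rel .kStarInv_kStar) (Uq.gen_rel .kStar_f)
    cases i <;> simp [Uq.hopf, Uq.comul_gen, Uq.comulGen, Uq.antipode_gen, Uq.antipodeGen,
      Uq.counit_gen, UGen.index, Uq.gen_rel .k_kInv, Uq.gen_rel .kInv_k,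
      Uq.gen_rel .kStar_kStarInv, Uq.gen_rel .kStarInv_kStar, r1, r2, smul_smul,
      phase_eq φ 4, phase_eq φ (-4)] <;>
      match_scalars <;> field_simp <;> ring

theorem SUq.isBraidedHopfOn (hq : q ≠ 0) :
    IsBraidedHopfOn φ (SUq.grading q φ) (SUq.hopf q φ hq) (SUq.gen q φ) SUGen.index where
  toIsGeneratedBy := SUq.isGeneratedBy
  braid_eq := rfl
  comul_one := by simp [SUq.hopf, SUq.comul]
  comul_gen_mul i x := by
    simp only [SUq.hopf, SUq.comul_gen]
    simp [SUq.comul, SUq.braid]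
  map_twist_comul_gen i n := by
    cases i <;> simp [SUq.hopf, SUq.comul_gen, SUq.comulGen, SUq.twist_gen, SUGen.index, phase_zero,
      ← TensorProduct.smul_tmul', TensorProduct.tmul_smul, smul_smul, ← phase_add]
  coassoc_gen i := by
    cases i <;> simp [SUq.hopf, SUq.comul_gen, SUq.comulGen, TensorProduct.add_tmul,
      TensorProduct.tmul_add, TensorProduct.sub_tmul, TensorProduct.tmul_sub,
      ← TensorProduct.smul_tmul', TensorProduct.tmul_smul] <;> module
  counit_comul_gen i := by
    cases i <;> simp [SUq.hopf, SUq.comul_gen, SUq.comulGen, SUq.counit_gen, SUGen.index]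
  comul_counit_gen i := by
    cases i <;> simp [SUq.hopf, SUq.comul_gen, SUq.comulGen, SUq.counit_gen, SUGen.index]
  counit_one := map_one (SUq.counit q φ)
  counit_mul := map_mul (SUq.counit q φ)
  counit_gen i := by
    cases i <;> simp [SUGen.index, SUq.hopf, SUq.counit_gen]
  antipode_one := by simp [SUq.hopf, SUq.antipode]
  antipode_gen_mul i x := by
    simp only [SUq.hopf, SUq.antipode_gen, ← braidedOpMul_apply φ (SUq.antipodeGen_index i)]
    simp [SUq.antipode, SUq.braid]
  antipode_gen_index i := by
    simp only [SUq.hopf, SUq.antipode_gen]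
    exact SUq.antipodeGen_index i
  antipode_left_gen i := by
    have hq' : (q : ℂ) ≠ 0 := by exact_mod_cast hq
    have ht := phase_ne_zero φ 1
    have r5 := SUq.gen_rel (q := q) (φ := φ) .α_αStar
    have r6 := SUq.gen_rel (q := q) (φ := φ) .αStar_α
    rw [← eq_sub_iff_add_eq] at r5 r6
    cases i <;> simp [SUq.hopf, SUq.comul_gen, SUq.comulGen, SUq.antipode_gen, SUq.antipodeGen,
      SUq.counit_gen, SUGen.index, r5, r6, SUq.gen_rel .α_γ, SUq.gen_rel .α_γStar,
      SUq.gen_rel .γ_αStar, SUq.gen_rel .γStar_αStar, SUq.gen_rel .γ_γStar, smul_smul,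
      phase_eq φ 4, phase_eq φ (-4)] <;>
      match_scalars <;> field_simp <;> ring
  antipode_right_gen i := by
    have hq' : (q : ℂ) ≠ 0 := by exact_mod_cast hq
    have ht := phase_ne_zero φ 1
    have r5 := SUq.gen_rel (q := q) (φ := φ) .α_αStar
    have r6 := SUq.gen_rel (q := q) (φ := φ) .αStar_α
    rw [← eq_sub_iff_add_eq] at r5 r6
    cases i <;> simp [SUq.hopf, SUq.comul_gen, SUq.comulGen, SUq.antipode_gen, SUq.antipodeGen,
      SUq.counit_gen, SUGen.index, r5, r6, SUq.gen_rel .α_γ, SUq.gen_rel .α_γStar,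
      SUq.gen_rel .γ_αStar, SUq.gen_rel .γStar_αStar, SUq.gen_rel .γ_γStar, smul_smul,
      phase_eq φ 4, phase_eq φ (-4)] <;>
      match_scalars <;> field_simp <;> ring

end ConcreteHopf

/-! ### Rescaling automorphisms and twisted derivations of `SU` -/

section Action

variable {q φ : ℝ}

/-- The factor of a generator under `α, γ ↦ u α, u γ` and `α*, γ* ↦ u⁻¹ α*, u⁻¹ γ*`. -/
@[simp] def SUGen.scaleFactor (u : ℂˣ) : SUGen → ℂ
  | .α => u
  | .γ => u
  | .αStar => (u : ℂ)⁻¹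
  | .γStar => (u : ℂ)⁻¹

/-- The automorphism of `SU_{q,φ}(2)` multiplying `α, γ` by `u` and `α*, γ*` by `u⁻¹`. -/
def SUq.scale (q φ : ℝ) (u : ℂˣ) : SUq q φ →ₐ[ℂ] SUq q φ :=
  SUq.lift (fun g => g.scaleFactor u • SUq.gen q φ g) (by
    have hu := u.ne_zero
    have r5 := SUq.gen_rel (q := q) (φ := φ) .α_αStar
    have r6 := SUq.gen_rel (q := q) (φ := φ) .αStar_α
    rw [← eq_sub_iff_add_eq] at r5 r6
    intro a b h
    cases h <;> simp [r5, r6, SUq.gen_rel .α_γ, SUq.gen_rel .α_γStar,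
      SUq.gen_rel .γ_αStar, SUq.gen_rel .γStar_αStar, SUq.gen_rel .γ_γStar, smul_smul] <;>
      match_scalars <;> field_simp)

/-- The matrices `[[σ g, d g], [0, τ g]]`; the corner of an algebra map with these values on
generators is a `(σ, τ)`-derivation. -/
def SUq.derMatrix (σ τ : SUq q φ →ₐ[ℂ] SUq q φ) (d : SUGen → SUq q φ) (g : SUGen) :
    Matrix (Fin 2) (Fin 2) (SUq q φ) :=
  !![σ (SUq.gen q φ g), d g; 0, τ (SUq.gen q φ g)]

/-- The `(σ, τ)`-derivation with values `d` on generators. -/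
def SUq.der {σ τ : SUq q φ →ₐ[ℂ] SUq q φ} {d : SUGen → SUq q φ}
    (h : ∀ a b, SURel q φ (SUq.derMatrix σ τ d) a b → a = b) : SUq q φ →ₗ[ℂ] SUq q φ where
  toFun x := SUq.lift _ h x 0 1
  map_add' x y := by simp
  map_smul' c x := by simp

section Der

variable {σ τ : SUq q φ →ₐ[ℂ] SUq q φ} {d : SUGen → SUq q φ}
  (h : ∀ a b, SURel q φ (SUq.derMatrix σ τ d) a b → a = b)

/-- Upper triangular matrices with diagonal `(σ, τ)` are stable under products, so the shape of the
generators persists. Multiplying two such matrices gives the twisted Leibniz rule `SUq.der_mul` in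
the corner. -/
theorem SUq.lift_derMatrix (x : SUq q φ) :
    SUq.lift _ h x = !![σ x, SUq.der h x; 0, τ x] := by
  have h10 : ∀ x, SUq.lift _ h x 1 0 = 0 := by
    refine DFunLike.congr_fun (SUq.isGeneratedBy.ext (F := Matrix.entryLinearMap ℂ (SUq q φ)
      (1 : Fin 2) (0 : Fin 2) ∘ₗ (SUq.lift _ h).toLinearMap) (G := 0) ?_ fun i x hx => ?_)
    · simp
    · simp only [LinearMap.comp_apply, AlgHom.toLinearMap_apply, Matrix.entryLinearMap_apply,
        LinearMap.zero_apply, map_mul, Matrix.mul_apply, Fin.sum_univ_two, SUq.lift_gen] at hx ⊢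
      simp [hx, SUq.derMatrix]
  have h00 : ∀ x, SUq.lift _ h x 0 0 = σ x := by
    refine DFunLike.congr_fun (SUq.isGeneratedBy.ext (F := Matrix.entryLinearMap ℂ (SUq q φ)
      (0 : Fin 2) (0 : Fin 2) ∘ₗ (SUq.lift _ h).toLinearMap) (G := σ.toLinearMap) ?_
      fun i x hx => ?_)
    · simp
    · simp only [LinearMap.comp_apply, AlgHom.toLinearMap_apply, Matrix.entryLinearMap_apply,
        map_mul, Matrix.mul_apply, Fin.sum_univ_two, SUq.lift_gen, h10] at hx ⊢
      simp [hx, SUq.derMatrix]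
  have h11 : ∀ x, SUq.lift _ h x 1 1 = τ x := by
    refine DFunLike.congr_fun (SUq.isGeneratedBy.ext (F := Matrix.entryLinearMap ℂ (SUq q φ)
      (1 : Fin 2) (1 : Fin 2) ∘ₗ (SUq.lift _ h).toLinearMap) (G := τ.toLinearMap) ?_
      fun i x hx => ?_)
    · simp
    · simp only [LinearMap.comp_apply, AlgHom.toLinearMap_apply, Matrix.entryLinearMap_apply,
        map_mul, Matrix.mul_apply, Fin.sum_univ_two, SUq.lift_gen] at hx ⊢
      simp [hx, SUq.derMatrix]
  ext i j
  fin_cases i <;> fin_cases j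
  · exact h00 x
  · rfl
  · exact h10 x
  · exact h11 x

theorem SUq.der_one : SUq.der h 1 = 0 := by
  simp [SUq.der]

theorem SUq.der_gen (g : SUGen) : SUq.der h (SUq.gen q φ g) = d g := by
  simp [SUq.der, SUq.derMatrix]

theorem SUq.der_mul (x y : SUq q φ) :
    SUq.der h (x * y) = σ x * SUq.der h y + SUq.der h x * τ y := by
  have key : SUq.der h (x * y) = SUq.lift _ h (x * y) 0 1 := rfl
  rw [key, map_mul, SUq.lift_derMatrix, SUq.lift_derMatrix]
  simp [Matrix.mul_apply, Fin.sum_univ_two]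

end Der

/-- `u` and `v` are the weights of `k` and `k*` at `α`: `u v = q⁻¹` and `u / v = e^{4 i φ}`. -/
structure IsWeightPair (q φ : ℝ) (u v : ℂˣ) : Prop where
  q_eq : (q : ℂ) = (u : ℂ)⁻¹ * (v : ℂ)⁻¹
  phase_four : phase φ 4 = u * (v : ℂ)⁻¹

/-- Through this and the next two lemmas the scalars in the relation checks become rational
functions of `u` and `v`, so that neither `√q` nor an exponential appears in them. -/
theorem IsWeightPair.phase_neg_four {u v : ℂˣ} (h : IsWeightPair q φ u v) :
    phase φ (-4) = v * (u : ℂ)⁻¹ := by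
  rw [phase, zpow_neg, ← phase, h.phase_four, mul_inv, inv_inv, mul_comm]

theorem IsWeightPair.phase_eight {u v : ℂˣ} (h : IsWeightPair q φ u v) :
    phase φ 8 = (u * (v : ℂ)⁻¹) ^ 2 := by
  rw [← h.phase_four, pow_two, ← phase_add]; rfl

theorem IsWeightPair.phase_neg_eight {u v : ℂˣ} (h : IsWeightPair q φ u v) :
    phase φ (-8) = (v * (u : ℂ)⁻¹) ^ 2 := by
  rw [← h.phase_neg_four, pow_two, ← phase_add]; rfl

/-- The values of the action of `e` on generators. -/
def SUq.eGen (q φ : ℝ) : SUGen → SUq q φ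
  | .αStar => SUq.gen q φ .γ
  | .γStar => (-(q : ℂ)⁻¹ * phase φ (-4)) • SUq.gen q φ .α
  | _ => 0

/-- The values of the action of `f` on generators. -/
def SUq.fGen (q φ : ℝ) : SUGen → SUq q φ
  | .α => (-(q : ℂ) * phase φ 4) • SUq.gen q φ .γStar
  | .γ => SUq.gen q φ .αStar
  | _ => 0

/-- The two automorphisms are read off from `Δe = e ⊗ k + k⁻¹ ⊗ e`: in the second term `e`, of index
`-2`, crosses the first factor, hence the twist by `-2` on top of the action of `k⁻¹`. The values
`SUq.eGen` are those of `(id ⊗ ⟨e, ·⟩)` on the coproduct of a generator whose left leg is twisted by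
`-2`. -/
theorem SUq.der_e_rel {u v : ℂˣ} (h : IsWeightPair q φ u v) : ∀ a b,
    SURel q φ (SUq.derMatrix ((twist φ (SUq.grading q φ) (-2)).comp (SUq.scale q φ u⁻¹))
      (SUq.scale q φ u) (SUq.eGen q φ)) a b → a = b := by
  have hu := u.ne_zero
  have hv := v.ne_zero
  have r5 := SUq.gen_rel (q := q) (φ := φ) .α_αStar
  have r6 := SUq.gen_rel (q := q) (φ := φ) .αStar_α
  rw [← eq_sub_iff_add_eq] at r5 r6
  intro a b hab
  cases hab <;> ext i j <;> fin_cases i <;> fin_cases j <;>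
    simp [SUq.derMatrix, SUq.scale, SUq.twist_gen, SUGen.index, SUq.eGen, r5, r6,
      SUq.gen_rel .α_γ, SUq.gen_rel .α_γStar, SUq.gen_rel .γ_αStar, SUq.gen_rel .γStar_αStar,
      SUq.gen_rel .γ_γStar, smul_smul, h.phase_four, h.phase_neg_four, h.phase_eight,
      h.phase_neg_eight, phase_zero, h.q_eq] <;>
    match_scalars <;> field_simp <;> ring

/-- The same recipe with `Δf = f ⊗ k* + (k*)⁻¹ ⊗ f`, where `f` has index `2` and `k*` has weight
`v`. -/
theorem SUq.der_f_rel {u v : ℂˣ} (h : IsWeightPair q φ u v) : ∀ a b,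
    SURel q φ (SUq.derMatrix ((twist φ (SUq.grading q φ) 2).comp (SUq.scale q φ v⁻¹))
      (SUq.scale q φ v) (SUq.fGen q φ)) a b → a = b := by
  have hu := u.ne_zero
  have hv := v.ne_zero
  have r5 := SUq.gen_rel (q := q) (φ := φ) .α_αStar
  have r6 := SUq.gen_rel (q := q) (φ := φ) .αStar_α
  rw [← eq_sub_iff_add_eq] at r5 r6
  intro a b hab
  cases hab <;> ext i j <;> fin_cases i <;> fin_cases j <;>
    simp [SUq.derMatrix, SUq.scale, SUq.twist_gen, SUGen.index, SUq.fGen, r5, r6,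
      SUq.gen_rel .α_γ, SUq.gen_rel .α_γStar, SUq.gen_rel .γ_αStar, SUq.gen_rel .γStar_αStar,
      SUq.gen_rel .γ_γStar, smul_smul, h.phase_four, h.phase_neg_four, h.phase_eight,
      h.phase_neg_eight, phase_zero, h.q_eq] <;>
    match_scalars <;> field_simp <;> ring

/-- The action of the generators of `U_{q,φ}(û(2))` on `SU_{q,φ}(2)`. -/
def SUq.actGen {u v : ℂˣ} (h : IsWeightPair q φ u v) : UGen → Module.End ℂ (SUq q φ)
  | .e => SUq.der (SUq.der_e_rel h)
  | .f => SUq.der (SUq.der_f_rel h)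
  | .k => (SUq.scale q φ u).toLinearMap
  | .kInv => (SUq.scale q φ u⁻¹).toLinearMap
  | .kStar => (SUq.scale q φ v).toLinearMap
  | .kStarInv => (SUq.scale q φ v⁻¹).toLinearMap

theorem SUq.scale_mul (u v : ℂˣ) (x : SUq q φ) :
    SUq.scale q φ u (SUq.scale q φ v x) = SUq.scale q φ (u * v) x := by
  have : (SUq.scale q φ u).comp (SUq.scale q φ v) = SUq.scale q φ (u * v) := by
    apply SUq.hom_ext
    intro g
    cases g <;> simp [SUq.scale, smul_smul, mul_comm]
  exact DFunLike.congr_fun this x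

theorem SUq.scale_one (x : SUq q φ) : SUq.scale q φ 1 x = x := by
  have : SUq.scale q φ 1 = AlgHom.id ℂ _ := by
    apply SUq.hom_ext
    intro g
    cases g <;> simp [SUq.scale]
  exact DFunLike.congr_fun this x

theorem SUq.scale_twist (u : ℂˣ) (n : ℤ) (x : SUq q φ) :
    SUq.scale q φ u (twist φ (SUq.grading q φ) n x) =
      twist φ (SUq.grading q φ) n (SUq.scale q φ u x) := by
  have : (SUq.scale q φ u).comp (twist φ (SUq.grading q φ) n) =
      (twist φ (SUq.grading q φ) n).comp (SUq.scale q φ u) := by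
    apply SUq.hom_ext
    intro g
    cases g <;> simp [SUq.scale, SUq.twist_gen, smul_smul, mul_comm]
  exact DFunLike.congr_fun this x

end Action

/-! ### The relations of `U` as identities between operators on `SU` -/

section ActionRelations

variable {q φ : ℝ} {u v : ℂˣ} (h : IsWeightPair q φ u v)

theorem SUq.scale_gen (w : ℂˣ) (g : SUGen) :
    SUq.scale q φ w (SUq.gen q φ g) = g.scaleFactor w • SUq.gen q φ g := by
  rw [SUq.scale, SUq.lift_gen]

/-- Give `α, γ` weight `1` and `α*, γ*` weight `-1`: then `e` raises the weight by `2`. For `w = u`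
and `w = v` the scalar is the one in the relations of `e` with `k` and `k*`. -/
theorem SUq.der_e_scale (w : ℂˣ) (x : SUq q φ) :
    SUq.der (SUq.der_e_rel h) (SUq.scale q φ w x) =
      ((w : ℂ)⁻¹ ^ 2) • SUq.scale q φ w (SUq.der (SUq.der_e_rel h) x) := by
  have hw := w.ne_zero
  refine DFunLike.congr_fun (SUq.isGeneratedBy.ext
    (F := SUq.der (SUq.der_e_rel h) ∘ₗ (SUq.scale q φ w).toLinearMap)
    (G := ((w : ℂ)⁻¹ ^ 2) • ((SUq.scale q φ w).toLinearMap ∘ₗ SUq.der (SUq.der_e_rel h)))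
    ?_ fun i x hx => ?_) x
  · simp [SUq.der_one]
  · simp only [LinearMap.comp_apply, AlgHom.toLinearMap_apply, LinearMap.smul_apply] at hx ⊢
    cases i <;> simp [SUq.der_mul, SUq.der_gen, SUq.scale_gen, SUq.eGen, hx, SUq.scale_mul,
      SUq.twist_gen, smul_smul, mul_comm w] <;> match_scalars <;> field_simp

theorem SUq.der_f_scale (w : ℂˣ) (x : SUq q φ) :
    SUq.der (SUq.der_f_rel h) (SUq.scale q φ w x) =
      ((w : ℂ) ^ 2) • SUq.scale q φ w (SUq.der (SUq.der_f_rel h) x) := by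
  have hw := w.ne_zero
  refine DFunLike.congr_fun (SUq.isGeneratedBy.ext
    (F := SUq.der (SUq.der_f_rel h) ∘ₗ (SUq.scale q φ w).toLinearMap)
    (G := ((w : ℂ) ^ 2) • ((SUq.scale q φ w).toLinearMap ∘ₗ SUq.der (SUq.der_f_rel h)))
    ?_ fun i x hx => ?_) x
  · simp [SUq.der_one]
  · simp only [LinearMap.comp_apply, AlgHom.toLinearMap_apply, LinearMap.smul_apply] at hx ⊢
    cases i <;> simp [SUq.der_mul, SUq.der_gen, SUq.scale_gen, SUq.fGen, hx, SUq.scale_mul,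
      SUq.twist_gen, smul_smul, mul_comm w] <;> match_scalars <;> field_simp

/-- On a product of a generator with `x`, two applications of the Leibniz rule reduce the claim to
the values on that generator and the induction hypothesis for `x`. The mixed terms are matched by
the weight rules `SUq.der_e_scale` and `SUq.der_f_scale`. -/
theorem SUq.der_e_der_f (hq : (q : ℂ)⁻¹ - q ≠ 0) (x : SUq q φ) :
    SUq.der (SUq.der_e_rel h) (SUq.der (SUq.der_f_rel h) x) =
      SUq.der (SUq.der_f_rel h) (SUq.der (SUq.der_e_rel h) x) +
      (1 / ((q : ℂ)⁻¹ - q)) • (SUq.scale q φ (u * v) x - SUq.scale q φ (u * v)⁻¹ x) := by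
  have hu := u.ne_zero
  have hv := v.ne_zero
  refine DFunLike.congr_fun (SUq.isGeneratedBy.ext
    (F := SUq.der (SUq.der_e_rel h) ∘ₗ SUq.der (SUq.der_f_rel h))
    (G := SUq.der (SUq.der_f_rel h) ∘ₗ SUq.der (SUq.der_e_rel h) +
      (1 / ((q : ℂ)⁻¹ - q)) • ((SUq.scale q φ (u * v)).toLinearMap -
        (SUq.scale q φ (u * v)⁻¹).toLinearMap)) ?_ fun i x hx => ?_) x
  · simp [SUq.der_one]
  · simp only [LinearMap.comp_apply, AlgHom.toLinearMap_apply, LinearMap.smul_apply,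
      LinearMap.add_apply, LinearMap.sub_apply] at hx ⊢
    rw [h.q_eq] at hq
    -- This is the numerator of `q⁻¹ - q = u v - (u v)⁻¹`, in the form needed to clear denominators.
    have hq' : (v : ℂ) ^ 2 * (u : ℂ) ^ 2 - 1 ≠ 0 := by
      contrapose! hq
      field_simp
      rw [mul_comm ((u : ℂ) ^ 2), hq, mul_zero]
    cases i <;> simp only [SUq.der_mul, SUq.der_gen, SUq.scale_gen, SUGen.scaleFactor,
      SUq.fGen, SUq.eGen, map_add, map_zero, map_mul, map_smul, zero_mul, mul_zero, add_zero, zero_add,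
      SUq.der_e_scale h,
      SUq.der_f_scale h, AlgHom.comp_apply, SUq.scale_mul, mul_comm v u,
      SUq.twist_gen, smul_smul, hx, SUGen.index, smul_mul_assoc, mul_smul_comm]
    all_goals
      norm_num only
      simp only [h.phase_four, h.phase_neg_four, h.phase_eight, h.phase_neg_eight, phase_zero,
        h.q_eq, Units.val_inv_eq_inv_val, Units.val_mul, mul_sub, mul_add, smul_sub, smul_add,
        mul_smul_comm, smul_smul]
      match_scalars <;> field_simp <;> ring

theorem SUq.actGen_rel (hq : (q : ℂ)⁻¹ - q ≠ 0) :
    ∀ a b, URel q φ (SUq.actGen h) a b → a = b := by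
  have hu := u.ne_zero
  have hv := v.ne_zero
  intro a b hab
  cases hab <;> refine LinearMap.ext fun x => ?_ <;>
    simp [SUq.actGen, SUq.scale_mul, SUq.scale_one, SUq.der_e_scale h, SUq.der_f_scale h,
      mul_comm v u, SUq.der_e_der_f h hq, smul_smul, h.phase_four, h.phase_neg_four, h.q_eq,
      mul_comm v⁻¹ u⁻¹] <;>
    match_scalars <;> field_simp

/-- The action of `U_{q,φ}(û(2))` on `SU_{q,φ}(2)`. -/
def SUq.act (hq : (q : ℂ)⁻¹ - q ≠ 0) : Uq q φ →ₐ[ℂ] Module.End ℂ (SUq q φ) :=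
  Uq.lift (SUq.actGen h) (SUq.actGen_rel h hq)

end ActionRelations

/-! ### Compatibility of the action with coproducts and products -/

section ActionProperties

variable {q φ : ℝ} {u v : ℂˣ} (h : IsWeightPair q φ u v)

/-- In the coproduct of each generator all right legs have the weight of that generator. -/
theorem SUq.comul_scale (hq : q ≠ 0) (w : ℂˣ) (a : SUq q φ) :
    (SUq.hopf q φ hq).comul (SUq.scale q φ w a) =
      LinearMap.lTensor _ (SUq.scale q φ w).toLinearMap ((SUq.hopf q φ hq).comul a) := by
  have hS := SUq.isBraidedHopfOn (φ := φ) hq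
  refine DFunLike.congr_fun (hS.ext
    (F := (SUq.hopf q φ hq).comul ∘ₗ (SUq.scale q φ w).toLinearMap)
    (G := LinearMap.lTensor _ (SUq.scale q φ w).toLinearMap ∘ₗ (SUq.hopf q φ hq).comul)
    ?_ fun i x hx => ?_) a
  · simp [hS.comul_one]
  · simp only [LinearMap.comp_apply, AlgHom.toLinearMap_apply, map_mul, SUq.scale_gen,
      smul_mul_assoc, map_smul, hS.comul_gen_mul] at hx ⊢
    rw [hx]
    generalize (SUq.hopf q φ hq).comul x = T
    induction T with
    | zero => simp
    | add T T' hT hT' => simp only [map_add, smul_add, hT, hT']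
    | tmul b c =>
      cases i <;> simp [SUq.hopf, SUq.comul_gen, SUq.comulGen, smul_sub,
        braidedMul_tmul φ (SUq.hasIndex_gen _), SUq.scale_gen, TensorProduct.tmul_smul, smul_smul,
        mul_comm]

theorem phase_neg (φ : ℝ) (n : ℤ) : phase φ (-n) = (phase φ n)⁻¹ := zpow_neg _ _

theorem SUq.twist_der_e (n : ℤ) (a : SUq q φ) :
    twist φ (SUq.grading q φ) n (SUq.der (SUq.der_e_rel h) a) =
      phase φ (2 * n * (-2)) • SUq.der (SUq.der_e_rel h) (twist φ (SUq.grading q φ) n a) := by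
  have ht := phase_ne_zero φ (2 * n * 2)
  refine DFunLike.congr_fun (SUq.isGeneratedBy.ext
    (F := (twist φ (SUq.grading q φ) n).toLinearMap ∘ₗ SUq.der (SUq.der_e_rel h))
    (G := phase φ (2 * n * (-2)) • (SUq.der (SUq.der_e_rel h) ∘ₗ
      (twist φ (SUq.grading q φ) n).toLinearMap)) ?_ fun i x hx => ?_) a
  · simp [SUq.der_one]
  · simp only [LinearMap.comp_apply, AlgHom.toLinearMap_apply, LinearMap.smul_apply] at hx ⊢
    cases i <;> simp [SUq.der_mul, SUq.der_gen, SUq.eGen, hx, SUq.scale_twist, SUq.scale_gen,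
      SUq.twist_gen, SUGen.index, phase_zero, smul_smul, phase_neg φ (2 * n * 2)] <;>
      match_scalars <;> field_simp

theorem SUq.twist_der_f (n : ℤ) (a : SUq q φ) :
    twist φ (SUq.grading q φ) n (SUq.der (SUq.der_f_rel h) a) =
      phase φ (2 * n * 2) • SUq.der (SUq.der_f_rel h) (twist φ (SUq.grading q φ) n a) := by
  have ht := phase_ne_zero φ (2 * n * 2)
  refine DFunLike.congr_fun (SUq.isGeneratedBy.ext
    (F := (twist φ (SUq.grading q φ) n).toLinearMap ∘ₗ SUq.der (SUq.der_f_rel h))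
    (G := phase φ (2 * n * 2) • (SUq.der (SUq.der_f_rel h) ∘ₗ
      (twist φ (SUq.grading q φ) n).toLinearMap)) ?_ fun i x hx => ?_) a
  · simp [SUq.der_one]
  · simp only [LinearMap.comp_apply, AlgHom.toLinearMap_apply, LinearMap.smul_apply] at hx ⊢
    cases i <;> simp [SUq.der_mul, SUq.der_gen, SUq.fGen, hx, SUq.scale_twist, SUq.scale_gen,
      SUq.twist_gen, SUGen.index, phase_zero, smul_smul, phase_neg φ (2 * n * 2)] <;>
      match_scalars <;> field_simp

/-- The operator of `e` acts on the right leg, after `e` has been braided past the left one. The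
Leibniz rule reduces the identity to the coproducts of generators, multiplied by an arbitrary tensor
in place of `Δx`. -/
theorem SUq.comul_der_e (hq : q ≠ 0) (a : SUq q φ) :
    (SUq.hopf q φ hq).comul (SUq.der (SUq.der_e_rel h) a) =
      TensorProduct.map (twist φ (SUq.grading q φ) (-2)).toLinearMap (SUq.der (SUq.der_e_rel h))
        ((SUq.hopf q φ hq).comul a) := by
  have hu := u.ne_zero
  have hv := v.ne_zero
  have hS := SUq.isBraidedHopfOn (φ := φ) hq
  refine DFunLike.congr_fun (hS.ext
    (F := (SUq.hopf q φ hq).comul ∘ₗ SUq.der (SUq.der_e_rel h))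
    (G := TensorProduct.map (twist φ (SUq.grading q φ) (-2)).toLinearMap
      (SUq.der (SUq.der_e_rel h)) ∘ₗ (SUq.hopf q φ hq).comul) ?_ fun i x hx => ?_) a
  · simp [hS.comul_one, SUq.der_one]
  · simp only [LinearMap.comp_apply, SUq.der_mul, map_add, hS.comul_mul, SUq.comul_scale] at hx ⊢
    rw [hx]
    generalize (SUq.hopf q φ hq).comul x = T
    induction T with
    | zero => simp
    | add T T' hT hT' =>
      simp only [map_add, ← hT, ← hT']
      abel
    | tmul b c =>
      cases i <;> simp [SUq.hopf, SUq.comul_gen, SUq.comulGen, SUq.der_gen, SUq.eGen,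
        braidedMul_tmul φ (SUq.hasIndex_gen _), SUq.scale_gen, SUq.der_mul,
        SUq.twist_gen, SUGen.index, TensorProduct.tmul_add, TensorProduct.tmul_smul, smul_smul,
        SUq.twist_twist, SUq.twist_zero, TensorProduct.tmul_neg, ← TensorProduct.smul_tmul',
        h.phase_four, h.phase_neg_four, h.phase_eight, h.phase_neg_eight, phase_zero, h.q_eq] <;>
        match_scalars <;> field_simp

theorem SUq.comul_der_f (hq : q ≠ 0) (a : SUq q φ) :
    (SUq.hopf q φ hq).comul (SUq.der (SUq.der_f_rel h) a) =
      TensorProduct.map (twist φ (SUq.grading q φ) 2).toLinearMap (SUq.der (SUq.der_f_rel h))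
        ((SUq.hopf q φ hq).comul a) := by
  have hu := u.ne_zero
  have hv := v.ne_zero
  have hS := SUq.isBraidedHopfOn (φ := φ) hq
  refine DFunLike.congr_fun (hS.ext
    (F := (SUq.hopf q φ hq).comul ∘ₗ SUq.der (SUq.der_f_rel h))
    (G := TensorProduct.map (twist φ (SUq.grading q φ) 2).toLinearMap
      (SUq.der (SUq.der_f_rel h)) ∘ₗ (SUq.hopf q φ hq).comul) ?_ fun i x hx => ?_) a
  · simp [hS.comul_one, SUq.der_one]
  · simp only [LinearMap.comp_apply, SUq.der_mul, map_add, hS.comul_mul, SUq.comul_scale] at hx ⊢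
    rw [hx]
    generalize (SUq.hopf q φ hq).comul x = T
    induction T with
    | zero => simp
    | add T T' hT hT' =>
      simp only [map_add, ← hT, ← hT']
      abel
    | tmul b c =>
      cases i <;> simp [SUq.hopf, SUq.comul_gen, SUq.comulGen, SUq.der_gen, SUq.fGen,
        braidedMul_tmul φ (SUq.hasIndex_gen _), SUq.scale_gen, SUq.der_mul,
        SUq.twist_gen, SUGen.index, TensorProduct.tmul_add, TensorProduct.tmul_smul, smul_smul,
        SUq.twist_twist, SUq.twist_zero, TensorProduct.tmul_neg, ← TensorProduct.smul_tmul',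
        h.phase_four, h.phase_neg_four, h.phase_eight, h.phase_neg_eight, phase_zero, h.q_eq] <;>
        match_scalars <;> field_simp

theorem SUq.twist_actGen (n : ℤ) (g : UGen) (a : SUq q φ) :
    twist φ (SUq.grading q φ) n (SUq.actGen h g a) =
      phase φ (2 * n * g.index) • SUq.actGen h g (twist φ (SUq.grading q φ) n a) := by
  cases g
  · exact SUq.twist_der_e h n a
  · exact SUq.twist_der_f h n a
  all_goals simp [SUq.actGen, UGen.index, phase_zero, SUq.scale_twist]

theorem SUq.comul_actGen (hq : q ≠ 0) (g : UGen) (a : SUq q φ) :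
    (SUq.hopf q φ hq).comul (SUq.actGen h g a) =
      TensorProduct.map (twist φ (SUq.grading q φ) g.index).toLinearMap (SUq.actGen h g)
        ((SUq.hopf q φ hq).comul a) := by
  have h0 : (twist φ (SUq.grading q φ) 0).toLinearMap = LinearMap.id :=
    LinearMap.ext SUq.twist_zero
  cases g
  · exact SUq.comul_der_e h hq a
  · exact SUq.comul_der_f h hq a
  all_goals
    change _ = TensorProduct.map (twist φ (SUq.grading q φ) 0).toLinearMap _ _
    rw [h0]
    exact SUq.comul_scale hq _ a

variable (hq : (q : ℂ)⁻¹ - q ≠ 0)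

theorem SUq.act_gen (g : UGen) : SUq.act h hq (Uq.gen q φ g) = SUq.actGen h g :=
  Uq.lift_gen _ _ _

/-- The action adds indices. This is what makes it compatible with the braidings, and it is the
source of the twist invariance of the pairing. -/
theorem SUq.twist_act (n : ℤ) (x : Uq q φ) (a : SUq q φ) :
    twist φ (SUq.grading q φ) n (SUq.act h hq x a) =
      SUq.act h hq (twist φ (Uq.grading q φ) n x) (twist φ (SUq.grading q φ) n a) := by
  revert a
  have := Uq.isGeneratedBy (q := q) (φ := φ).ext
    (F := LinearMap.llcomp ℂ _ _ _ (twist φ (SUq.grading q φ) n).toLinearMap ∘ₗ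
      (SUq.act h hq).toLinearMap)
    (G := (LinearMap.lcomp ℂ _ (twist φ (SUq.grading q φ) n).toLinearMap) ∘ₗ
      (SUq.act h hq).toLinearMap ∘ₗ (twist φ (Uq.grading q φ) n).toLinearMap) ?_ fun i x hx => ?_
  · exact fun a => DFunLike.congr_fun (DFunLike.congr_fun this x) a
  · ext a
    simp
  · refine LinearMap.ext fun a => ?_
    have hx' := DFunLike.congr_fun hx (a)
    simp only [LinearMap.comp_apply, AlgHom.toLinearMap_apply, LinearMap.llcomp_apply,
      LinearMap.lcomp_apply, map_mul, Module.End.mul_apply, SUq.act_gen, Uq.twist_gen, map_smul,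
      SUq.twist_actGen, LinearMap.smul_apply] at hx' ⊢
    rw [hx']

/-- The index of `x` occurs in the formula and the proof is by induction on length, hence monomials.
Composing operators adds their indices, in agreement with the composition of twists. -/
theorem SUq.comul_act (hq' : q ≠ 0) {n : ℤ} {x : Uq q φ}
    (hx : IsMonomial (Uq.gen q φ) UGen.index n x) (a : SUq q φ) :
    (SUq.hopf q φ hq').comul (SUq.act h hq x a) =
      TensorProduct.map (twist φ (SUq.grading q φ) n).toLinearMap (SUq.act h hq x)
        ((SUq.hopf q φ hq').comul a) := by
  induction hx with
  | one =>
    have h0 : (twist φ (SUq.grading q φ) 0).toLinearMap = LinearMap.id :=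
      LinearMap.ext SUq.twist_zero
    rw [h0, map_one, Module.End.one_eq_id, TensorProduct.map_id]
    rfl
  | mul i hx ih =>
    rw [map_mul, Module.End.mul_apply, SUq.act_gen, SUq.comul_actGen, ih, TensorProduct.map_map]
    congr 2
    exact LinearMap.ext fun b => SUq.twist_twist _ _ b

/-- `U ⊗ U` acting on `SU ⊗ SU`, using the braiding `Ξ`. -/
def SUq.tensorAct (T : Uq q φ ⊗[ℂ] Uq q φ) :
    SUq q φ ⊗[ℂ] SUq q φ →ₗ[ℂ] SUq q φ ⊗[ℂ] SUq q φ :=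
  TensorProduct.map (TensorProduct.lift (SUq.act h hq).toLinearMap)
    (TensorProduct.lift (SUq.act h hq).toLinearMap) ∘ₗ midSwap (mixedBraid q φ) ∘ₗ
    TensorProduct.mk ℂ _ _ T

theorem SUq.tensorAct_tmul {m : ℤ} {y : Uq q φ} (hy : HasIndex (Uq.grading q φ) m y) (x : Uq q φ)
    (c d : SUq q φ) : SUq.tensorAct h hq (x ⊗ₜ y) (c ⊗ₜ d) =
      SUq.act h hq x (twist φ (SUq.grading q φ) m c) ⊗ₜ SUq.act h hq y d := by
  simp [SUq.tensorAct, mixedBraid, midSwap_of_index hy]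

theorem SUq.tensorAct_add (S T : Uq q φ ⊗[ℂ] Uq q φ) :
    SUq.tensorAct h hq (S + T) = SUq.tensorAct h hq S + SUq.tensorAct h hq T := by
  simp [SUq.tensorAct, LinearMap.comp_add]

/-- `SU ⊗ SU` is a module over the braided tensor square of `U`: moving `y` past `x' ▷ c` amounts to
moving it past `x'` and `c` separately, by `SUq.twist_act`. -/
theorem SUq.tensorAct_braidedMul (S T : Uq q φ ⊗[ℂ] Uq q φ) (w : SUq q φ ⊗[ℂ] SUq q φ) :
    SUq.tensorAct h hq (braidedMul (gradedBraiding φ (Uq.grading q φ) (Uq.grading q φ)) S T) w =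
      SUq.tensorAct h hq S (SUq.tensorAct h hq T w) := by
  have hU := Uq.isGeneratedBy (q := q) (φ := φ) |>.isSpanned
  induction S using tensor_induction_right hU with
  | add S S' hS hS' =>
    simp only [map_add, LinearMap.add_apply, SUq.tensorAct_add, hS, hS']
  | tmul m x y hy =>
    induction T using tensor_induction_right hU with
    | add S S' hS hS' =>
      simp only [map_add, LinearMap.add_apply, SUq.tensorAct_add, hS, hS']
    | tmul n x' y' hy' =>
      induction w with
      | zero => simp
      | add S S' hS hS' => simp only [map_add, hS, hS']
      | tmul c d =>
        rw [braidedMul_tmul φ hy, SUq.tensorAct_tmul h hq (hy.mul hy'), SUq.tensorAct_tmul h hq hy',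
          SUq.tensorAct_tmul h hq hy, SUq.twist_act, SUq.twist_twist]
        simp

/-- The twisted Leibniz rule for `e` and `f`, and multiplicativity of the rescalings, are exactly
the module algebra law for the coproduct of a generator. -/
theorem SUq.actGen_mul (hq' : q ≠ 0) (g : UGen) (w : SUq q φ ⊗[ℂ] SUq q φ) :
    SUq.actGen h g (LinearMap.mul' ℂ _ w) =
      LinearMap.mul' ℂ _ (SUq.tensorAct h hq ((Uq.hopf q φ hq').comul (Uq.gen q φ g)) w) := by
  induction w with
  | zero => simp
  | add w w' hw hw' => simp only [map_add, hw, hw']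
  | tmul c d =>
    cases g <;> simp [Uq.hopf, Uq.comul_gen, Uq.comulGen, SUq.tensorAct_add,
      SUq.tensorAct_tmul h hq (Uq.hasIndex_gen _), UGen.index, SUq.twist_zero, SUq.act_gen,
      SUq.actGen, SUq.der_mul, SUq.scale_twist, add_comm]

/-- `SU_{q,φ}(2)` is a braided module algebra. -/
theorem SUq.act_mul (hq' : q ≠ 0) (x : Uq q φ) (w : SUq q φ ⊗[ℂ] SUq q φ) :
    SUq.act h hq x (LinearMap.mul' ℂ _ w) =
      LinearMap.mul' ℂ _ (SUq.tensorAct h hq ((Uq.hopf q φ hq').comul x) w) := by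
  have hU := Uq.isBraidedHopfOn (φ := φ) hq'
  refine DFunLike.congr_fun (hU.ext_monomial
    (F := LinearMap.applyₗ (LinearMap.mul' ℂ _ w) ∘ₗ (SUq.act h hq).toLinearMap)
    (G := LinearMap.mul' ℂ _ ∘ₗ TensorProduct.map (TensorProduct.lift (SUq.act h hq).toLinearMap)
      (TensorProduct.lift (SUq.act h hq).toLinearMap) ∘ₗ midSwap (mixedBraid q φ) ∘ₗ
      (TensorProduct.mk ℂ _ _).flip w ∘ₗ (Uq.hopf q φ hq').comul) fun n x hx => ?_) x
  change SUq.act h hq x (LinearMap.mul' ℂ _ w) =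
    LinearMap.mul' ℂ _ (SUq.tensorAct h hq ((Uq.hopf q φ hq').comul x) w)
  induction hx generalizing w with
  | one =>
    rw [hU.comul_one]
    induction w with
    | zero => simp
    | add w w' hw hw' => simp only [map_add, hw, hw']
    | tmul c d => simp [SUq.tensorAct_tmul h hq (hasIndex_one _), SUq.twist_zero]
  | mul i hx ih =>
    rw [map_mul, Module.End.mul_apply, ih, SUq.act_gen, SUq.actGen_mul h hq hq', hU.comul_gen_mul,
      SUq.tensorAct_braidedMul]

theorem SUq.act_one (x : Uq q φ) : SUq.act h hq x 1 = Uq.counit q φ x • 1 := by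
  refine DFunLike.congr_fun (Uq.isGeneratedBy.ext
    (F := LinearMap.applyₗ 1 ∘ₗ (SUq.act h hq).toLinearMap)
    (G := (Uq.counit q φ).toLinearMap.smulRight 1) ?_ fun i x hx => ?_) x
  · simp
  · simp only [LinearMap.comp_apply, AlgHom.toLinearMap_apply, LinearMap.smulRight_apply,
      LinearMap.applyₗ_apply_apply, map_mul, Module.End.mul_apply, SUq.act_gen,
      Uq.counit_gen] at hx ⊢
    rw [hx]
    cases i <;> simp [SUq.actGen, SUq.der_one, UGen.index]

end ActionProperties

/-! ### The pairing, its laws and its uniqueness -/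

section PairingProperties

variable {q φ : ℝ}

/-- The pairing `⟨x, a⟩ = ε (x ▷ a)`. -/
def SUq.pairing {u v : ℂˣ} (h : IsWeightPair q φ u v) (hq : (q : ℂ)⁻¹ - q ≠ 0) :
    Uq q φ ⊗[ℂ] SUq q φ →ₗ[ℂ] ℂ :=
  (SUq.counit q φ).toLinearMap ∘ₗ TensorProduct.lift (SUq.act h hq).toLinearMap

section

variable {u v : ℂˣ} (h : IsWeightPair q φ u v) (hq : (q : ℂ)⁻¹ - q ≠ 0)

theorem SUq.pairing_tmul (x : Uq q φ) (a : SUq q φ) :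
    SUq.pairing h hq (x ⊗ₜ a) = SUq.counit q φ (SUq.act h hq x a) := rfl

theorem SUq.counit_twist (n : ℤ) (a : SUq q φ) :
    SUq.counit q φ (twist φ (SUq.grading q φ) n a) = SUq.counit q φ a := by
  have : (SUq.counit q φ).comp (twist φ (SUq.grading q φ) n) = SUq.counit q φ := by
    apply SUq.hom_ext
    intro g
    cases g <;> simp [SUq.twist_gen, SUq.counit_gen, SUGen.index, phase_zero]
  exact DFunLike.congr_fun this a

/-- The action is graded and `ε` vanishes on generators of nonzero index, so the pairing is
homogeneous of degree zero. -/
theorem SUq.pairing_twist (n : ℤ) (x : Uq q φ) (a : SUq q φ) :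
    SUq.pairing h hq (twist φ (Uq.grading q φ) n x ⊗ₜ twist φ (SUq.grading q φ) n a) =
      SUq.pairing h hq (x ⊗ₜ a) := by
  rw [SUq.pairing_tmul, SUq.pairing_tmul, ← SUq.twist_act, SUq.counit_twist]

theorem SUq.pairing_mul_right (hq' : q ≠ 0) (x : Uq q φ) (a b : SUq q φ) :
    SUq.pairing h hq (x ⊗ₜ (a * b)) = pairPair (SUq.pairing h hq)
      (midSwap (mixedBraid q φ) ((Uq.hopf q φ hq').comul x ⊗ₜ (a ⊗ₜ b))) := by
  have key : (SUq.counit q φ).toLinearMap ∘ₗ LinearMap.mul' ℂ (SUq q φ) ∘ₗ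
      TensorProduct.map (TensorProduct.lift (SUq.act h hq).toLinearMap)
        (TensorProduct.lift (SUq.act h hq).toLinearMap) = pairPair (SUq.pairing h hq) :=
    TensorProduct.ext' fun s t => by simp [pairPair, SUq.pairing]
  rw [← key, SUq.pairing_tmul, ← LinearMap.mul'_apply (R := ℂ), SUq.act_mul h hq hq']
  rfl

theorem SUq.pairing_mul_left (hq' : q ≠ 0) (x y : Uq q φ) (a : SUq q φ) :
    SUq.pairing h hq ((x * y) ⊗ₜ a) = pairPair (SUq.pairing h hq)
      (midSwap (mixedBraid q φ) ((x ⊗ₜ y) ⊗ₜ (SUq.hopf q φ hq').comul a)) := by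
  have hS := SUq.isBraidedHopfOn (φ := φ) hq'
  refine DFunLike.congr_fun (Uq.isGeneratedBy.ext_monomial
    (F := SUq.pairing h hq ∘ₗ (TensorProduct.mk ℂ _ _).flip a ∘ₗ LinearMap.mul ℂ _ x)
    (G := pairPair (SUq.pairing h hq) ∘ₗ midSwap (mixedBraid q φ) ∘ₗ
      (TensorProduct.mk ℂ _ _).flip ((SUq.hopf q φ hq').comul a) ∘ₗ TensorProduct.mk ℂ _ _ x)
    fun n y hy => ?_) y
  -- At `T = Δa` the argument of `x ▷` is `(id ⊗ ε)Δ(y ▷ a) = y ▷ a`, by `SUq.comul_act` and the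
  -- counit law, so the left side is `ε(xy ▷ a)`.
  have key : ∀ T : SUq q φ ⊗[ℂ] SUq q φ, SUq.counit q φ (SUq.act h hq x (TensorProduct.rid ℂ _
      (LinearMap.lTensor _ (SUq.hopf q φ hq').counit (TensorProduct.map
        (twist φ (SUq.grading q φ) n).toLinearMap (SUq.act h hq y) T)))) =
      pairPair (SUq.pairing h hq) (midSwap (mixedBraid q φ) ((x ⊗ₜ y) ⊗ₜ T)) := by
    intro T
    induction T with
    | zero => simp
    | add T T' hT hT' => simp only [map_add, TensorProduct.tmul_add, hT, hT']
    | tmul c d =>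
      rw [mixedBraid, midSwap_of_index (Uq.isGeneratedBy.hasIndex_of_isMonomial hy)]
      simp [pairPair, SUq.pairing_tmul, SUq.hopf, mul_comm]
  change SUq.counit q φ (SUq.act h hq (x * y) a) = pairPair (SUq.pairing h hq)
      (midSwap (mixedBraid q φ) ((x ⊗ₜ y) ⊗ₜ (SUq.hopf q φ hq').comul a))
  rw [← key, ← SUq.comul_act h hq hq' hy, hS.comul_counit, map_mul, Module.End.mul_apply]

theorem SUq.pairing_one_right (x : Uq q φ) :
    SUq.pairing h hq (x ⊗ₜ 1) = Uq.counit q φ x := by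
  simp [SUq.pairing_tmul, SUq.act_one]

theorem SUq.pairing_one_left (a : SUq q φ) :
    SUq.pairing h hq (1 ⊗ₜ a) = SUq.counit q φ a := by
  simp [SUq.pairing_tmul]

theorem SUq.isBraidedPairing_pairing (hq' : q ≠ 0) :
    IsBraidedPairing (Uq.hopf q φ hq') (SUq.hopf q φ hq') (mixedBraid q φ)
      (SUq.pairing h hq) where
  left_hopf := (Uq.isBraidedHopfOn hq').isBraidedHopfAlgebra
  right_hopf := (SUq.isBraidedHopfOn hq').isBraidedHopfAlgebra
  braiding := (Uq.isBraidedHopfOn hq').preservesIndex.isCompatibleBraiding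
    (SUq.isBraidedHopfOn hq').preservesIndex
  pair_mul := SUq.pairing_mul_right h hq hq'
  mul_pair := SUq.pairing_mul_left h hq hq'
  antipode_pair := antipode_pair_of_mul (Uq.isBraidedHopfOn hq').preservesIndex
    (SUq.isBraidedHopfOn hq').preservesIndex (Uq.isBraidedHopfOn hq').isBraidedHopfAlgebra
    (SUq.isBraidedHopfOn hq').isBraidedHopfAlgebra (SUq.pairing_mul_right h hq hq')
    (SUq.pairing_mul_left h hq hq') (SUq.pairing_one_right h hq) (SUq.pairing_one_left h hq)
  pair_one := SUq.pairing_one_right h hq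
  one_pair := SUq.pairing_one_left h hq

/-- A homogeneous spectator crossing both arguments of the pairing twists them by the same index,
and the pairing is invariant under that. -/
theorem SUq.satisfiesActionConditions_pairing (hq' : q ≠ 0) :
    SatisfiesActionConditions (Uq.hopf q φ hq') (SUq.hopf q φ hq') (mixedBraid q φ)
      (SUq.pairing h hq) where
  right x a b := by
    refine DFunLike.congr_fun (SUq.isGeneratedBy.isSpanned.ext
      (F := (TensorProduct.rid ℂ _).toLinearMap ∘ₗ LinearMap.lTensor _ (SUq.pairing h hq) ∘ₗ
        (TensorProduct.assoc ℂ _ _ _).toLinearMap ∘ₗ LinearMap.rTensor _ (mixedBraid q φ) ∘ₗ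
        (TensorProduct.assoc ℂ _ _ _).symm.toLinearMap ∘ₗ TensorProduct.mk ℂ _ _ x ∘ₗ
        SUq.braid q φ ∘ₗ TensorProduct.mk ℂ _ _ a)
      (G := SUq.pairing h hq (x ⊗ₜ a) • LinearMap.id) fun n b hb => ?_) b
    simp [SUq.braid, mixedBraid, gradedBraiding_of_index_right SUq.isGeneratedBy.isSpanned hb,
      gradedBraiding_of_index_right Uq.isGeneratedBy.isSpanned hb, SUq.pairing_twist]
  left x y a := by
    refine DFunLike.congr_fun (Uq.isGeneratedBy.isSpanned.ext
      (F := (TensorProduct.lid ℂ _).toLinearMap ∘ₗ LinearMap.rTensor _ (SUq.pairing h hq) ∘ₗ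
        (TensorProduct.assoc ℂ _ _ _).symm.toLinearMap ∘ₗ LinearMap.lTensor _ (mixedBraid q φ) ∘ₗ
        (TensorProduct.assoc ℂ _ _ _).toLinearMap ∘ₗ (TensorProduct.mk ℂ _ _).flip a ∘ₗ
        Uq.braid q φ ∘ₗ (TensorProduct.mk ℂ _ _).flip y)
      (G := SUq.pairing h hq (y ⊗ₜ a) • LinearMap.id) fun n x hx => ?_) x
    simp [Uq.braid, mixedBraid, gradedBraiding_of_index φ _ hx, SUq.pairing_twist]

end

/-- The coproduct of a generator of `U` involves only generators in both legs, so the first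
induction, on monomials of `SU`, never leaves the generators of `U`. The second induction is on
monomials of `U`. Only the product and unit laws are needed. -/
theorem IsBraidedPairing.ext_gen {hq : q ≠ 0} {B B' : Uq q φ ⊗[ℂ] SUq q φ →ₗ[ℂ] ℂ}
    (hB : IsBraidedPairing (Uq.hopf q φ hq) (SUq.hopf q φ hq) (mixedBraid q φ) B)
    (hB' : IsBraidedPairing (Uq.hopf q φ hq) (SUq.hopf q φ hq) (mixedBraid q φ) B')
    (hgen : ∀ g a, B (Uq.gen q φ g ⊗ₜ SUq.gen q φ a) = B' (Uq.gen q φ g ⊗ₜ SUq.gen q φ a)) :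
    B = B' := by
  have h1 : ∀ g a, B (Uq.gen q φ g ⊗ₜ a) = B' (Uq.gen q φ g ⊗ₜ a) := by
    intro g
    refine DFunLike.congr_fun (SUq.isGeneratedBy.ext_monomial
      (F := B ∘ₗ TensorProduct.mk ℂ _ _ (Uq.gen q φ g))
      (G := B' ∘ₗ TensorProduct.mk ℂ _ _ (Uq.gen q φ g)) fun n a ha => ?_)
    change B (Uq.gen q φ g ⊗ₜ a) = B' (Uq.gen q φ g ⊗ₜ a)
    induction ha generalizing g with
    | one => rw [hB.pair_one, hB'.pair_one]
    | mul i ha ih =>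
      rw [hB.pair_mul, hB'.pair_mul]
      cases g <;> simp [Uq.hopf, Uq.comul_gen, Uq.comulGen, TensorProduct.add_tmul, mixedBraid,
        midSwap_of_index (Uq.hasIndex_gen _), pairPair, SUq.twist_gen, hgen, ih]
  refine TensorProduct.ext (Uq.isGeneratedBy.ext_monomial fun n x hx => LinearMap.ext fun a => ?_)
  change B (x ⊗ₜ a) = B' (x ⊗ₜ a)
  induction hx generalizing a with
  | one => rw [hB.one_pair, hB'.one_pair]
  | mul i hx ih =>
    rw [hB.mul_pair, hB'.mul_pair]
    generalize (SUq.hopf q φ hq).comul a = T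
    induction T with
    | zero => simp
    | add T T' hT hT' => simp only [map_add, TensorProduct.tmul_add, hT, hT']
    | tmul c d =>
      rw [mixedBraid, midSwap_of_index (Uq.isGeneratedBy.hasIndex_of_isMonomial hx)]
      simp [pairPair, h1, ih]

theorem sqrt_ofReal_ne_zero (hq : 0 < q) : ((√q : ℝ) : ℂ) ≠ 0 := by
  exact_mod_cast (Real.sqrt_pos.2 hq).ne'

/-- The weight `q^{-1/2} e^{i n φ}`. -/
def weight (φ : ℝ) (hq : 0 < q) (n : ℤ) : ℂˣ :=
  Units.mk0 ((√q : ℂ)⁻¹ * phase φ n)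
    (mul_ne_zero (inv_ne_zero (sqrt_ofReal_ne_zero hq)) (phase_ne_zero φ n))

/-- These weights are the prescribed values `⟨k, α⟩` and `⟨k*, α⟩`. -/
theorem isWeightPair_weight (hq : 0 < q) :
    IsWeightPair q φ (weight φ hq 2) (weight φ hq (-2)) where
  q_eq := by
    have h2 : ((√q : ℝ) : ℂ) * (√q : ℝ) = q := by exact_mod_cast Real.mul_self_sqrt hq.le
    have := phase_ne_zero φ 2
    have := sqrt_ofReal_ne_zero hq
    simp only [weight, Units.val_mk0, phase_neg]
    rw [← h2]
    field_simp
  phase_four := by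
    have := phase_ne_zero φ 2
    have := sqrt_ofReal_ne_zero hq
    have h4 : phase φ 4 = phase φ 2 * phase φ 2 := phase_add φ 2 2
    simp only [weight, Units.val_mk0, phase_neg, h4]
    field_simp

theorem SUq.pairing_gen (hq : 0 < q) (hq' : (q : ℂ)⁻¹ - q ≠ 0) (g : UGen) (a : SUGen) :
    SUq.pairing (isWeightPair_weight (φ := φ) hq) hq' (Uq.gen q φ g ⊗ₜ SUq.gen q φ a) =
      pairGen q φ g a := by
  rw [SUq.pairing_tmul, SUq.act_gen]
  cases g <;> cases a <;>
    simp [SUq.actGen, SUq.der_gen, SUq.eGen, SUq.fGen, SUq.scale_gen, SUq.counit_gen, SUGen.index,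
      pairGen, weight, phase_neg φ 2] <;>
    ring

end PairingProperties

end

end BraidedPairing

theorem mainTheorem2 (q φ : ℝ) (hq0 : 0 < q) (hq1 : q < 1) :
    ∃ B : Uq q φ ⊗[ℂ] SUq q φ →ₗ[ℂ] ℂ,
      (∀ (h : UGen) (a : SUGen), B (Uq.gen q φ h ⊗ₜ SUq.gen q φ a) = pairGen q φ h a) ∧
      IsBraidedPairing (Uq.hopf q φ hq0.ne') (SUq.hopf q φ hq0.ne') (mixedBraid q φ) B ∧
      SatisfiesActionConditions (Uq.hopf q φ hq0.ne') (SUq.hopf q φ hq0.ne') (mixedBraid q φ) B ∧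
      (∀ B' : Uq q φ ⊗[ℂ] SUq q φ →ₗ[ℂ] ℂ,
        (∀ (h : UGen) (a : SUGen), B' (Uq.gen q φ h ⊗ₜ SUq.gen q φ a) = pairGen q φ h a) →
        IsBraidedPairing (Uq.hopf q φ hq0.ne') (SUq.hopf q φ hq0.ne') (mixedBraid q φ) B' →
        B' = B) := by
  -- `q < 1` enters only here: the commutator relation of `e` and `f` divides by `q⁻¹ - q`.
  have hq : (q : ℂ)⁻¹ - q ≠ 0 := by
    have h1 : q⁻¹ - q ≠ 0 := (sub_pos.2 (hq1.trans ((one_lt_inv₀ hq0).2 hq1))).ne'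
    exact_mod_cast h1
  have hB := SUq.isBraidedPairing_pairing (isWeightPair_weight (φ := φ) hq0) hq hq0.ne'
  refine ⟨_, SUq.pairing_gen hq0 hq, hB, SUq.satisfiesActionConditions_pairing _ hq _,
    fun B' hgen hB' => hB'.ext_gen hB fun g a => ?_⟩
  rw [hgen, SUq.pairing_gen hq0 hq]
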